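/- Fix an integer $\kappa_0\ge 1$, put $K:=(\kappa_0+\tfrac14)\pi$ and, for $E>K$, let $r=r(E):=K/E\in(0,1)$. **Definitions.** A map $f:[E_1,E_2]\to\mathbb R^{\kappa_0}$ is *non-degenerate* on $[E_1,E_2]$ if for every $c\in\mathbb R^{\kappa_0}\setminus\{0\}$ the function $E\mapsto c\cdot f(E)$ is not identically zero on $[E_1,E_2]$. *Limit frequencies.* For $j=1,\dots,\kappa_0$ let $\lambda_{j,\infty}(E)$ be the $j$-th largest zero in $(0,E)$ of $$\mathfrak F(\lambda)=\lambda\cos\!\big(r\sqrt{E^2-\lambda^2}\big)\coth((1-r)\lambda)-\sqrt{E^2-\lambda^2}\,\sin\!\big(r\sqrt{E^2-\lambda^2}\big),$$ and $\vec\omega_\infty(E):=(\lambda_{1,\infty}(E),\dots,\lambda_{\kappa_0,\infty}(E))$. *The potential $Q_{\mathfrak m}$.* Let $h_{\mathfrak m}(z):=\big((\cosh z/\cosh 1)^{\mathfrak m}+1\big)^{-1}$, $\mathfrak m\in\mathbb N$. Given $S\in\mathbb N$ (the case $S=0$, i.e. $g_{\mathfrak m,S}=0$, is allowed), points $y_{1,\mathfrak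 m}(E),\dots,y_{\kappa_0,\mathfrak m}(E)\in(0,r)$ and $T=T(E)>1$, put $z_{\pm p}:=\pm y_{p,\mathfrak m}(E)/r$, and let $g_{\mathfrak m,S}$ be the polynomial $$g_{\mathfrak m,S}(z)=\sum_{j=\pm1,\dots,\pm\kappa_0}\ \sum_{k=1}^{S}a_{j,2k-1}\,f_{j,2k-1}(z),\qquad f_{j,2k-1}(z)=\frac{(z-z_j)^{2k-1}}{(2k-1)!}\,\widehat f_j(z),\qquad \widehat f_j(z)=(z^2-T^2)^{2S}\prod_{j'\ne j}(z-z_{j'})^{2S},$$ with coefficients given recursively by $$a_{j,2k-1}=\frac{1}{\widehat f_j(z_j)}\Big(-h_{\mathfrak m}^{(2k-1)}(z_j)-\sum_{n=1}^{k-1}a_{j,2n-1}\,f_{j,2n-1}^{(2k-1)}(z_j)\Big),\qquad k=1,\dots,S$$ (so that, when the points $z_j$ are distinct, the odd derivatives of order $1,3,\dots,2S-1$ of $h_{\mathfrak m}+g_{\mathfrak m,S}$ vanish at every $z_j$). Set $$Q_{\mathfrak m}(y)=Q_{\mathfrak m}(E;y):=-E^2\big(h_{\mathfrak m}(y/r)+g_{\mathfrak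 m,S}(y/r)\big).$$ *Frequencies at level $\mathfrak m$.* Let $\mu_{1,\mathfrak m}(E)<\mu_{2,\mathfrak m}(E)<\cdots$ be the eigenvalues of $-\partial_y^2+Q_{\mathfrak m}(E;y)$ on even functions on $[-1,1]$ with Dirichlet conditions at $y=\pm1$. Whenever $\mu_{j,\mathfrak m}(E)<0$ for all $j\le\kappa_0$, put $\lambda_{j,\mathfrak m}(E):=\sqrt{-\mu_{j,\mathfrak m}(E)}$ and $\vec\omega_{\mathfrak m}(E):=(\lambda_{1,\mathfrak m}(E),\dots,\lambda_{\kappa_0,\mathfrak m}(E))$. **Theorem.** (i) *(Asymptotics.)* For every $j=1,\dots,\kappa_0$ there are $\alpha_0(j)\in(0,\tfrac12)$ with $$\sin(\pi\alpha_0(j))=\frac{j-\frac12-\alpha_0(j)}{\kappa_0+\frac14}$$ and a real number $\alpha_2(j)=\alpha_2(\alpha_0(j))\neq0$ such that, as $E\to+\infty$, $$\lambda_{j,\infty}(E)=E\cos\!\Big(\pi\big(\alpha_0(j)+\alpha_2(j)\beta_j(E)^2+o(\beta_j(E)^3)\big)\Big),\qquad \beta_j(E):=\exp\!\big((K-E)\cos(\pi\alpha_0(j))\big).$$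 Moreover there is $E_*=E_*(\kappa_0)>K$ such that for all $E\ge E_*$ the zeros $\lambda_{1,\infty}(E)>\dots>\lambda_{\kappa_0,\infty}(E)$ exist, and such that for all $E_2>E_1\ge E_*$: (ii) *(Limit vector.)* $\vec\omega_\infty$ is non-degenerate on $[E_1,E_2]$. (iii) *(Regularized vector.)* Let $S\in\mathbb N$, let $T:[E_1,E_2]\to(1,\infty)$ be continuous, and let $y_{p,\mathfrak m}(E)\in(0,r(E))$ ($p=1,\dots,\kappa_0$, $\mathfrak m\in\mathbb N$, $E\in[E_1,E_2]$) be arbitrary with $y_{p,\mathfrak m}(E)\to p\pi/E$ as $\mathfrak m\to\infty$, uniformly in $E\in[E_1,E_2]$, for each $p$. Then there is $\bar{\mathfrak m}\in\mathbb N$ such that for every $\mathfrak m\ge\bar{\mathfrak m}$ one has $-E^2<\mu_{j,\mathfrak m}(E)<0$ for all $E\in[E_1,E_2]$ and $j\le\kappa_0$ (so that $\vec\omega_{\mathfrak m}$ is defined on $[E_1,E_2]$), and $\vec\omega_{\mathfrak m}$ is non-degenerate on $[E_1,E_2]$. -/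

import Mathlib

open Real Set Filter Topology

noncomputable section

namespace ShearFreq

/-- The fixed product `E * r = (κ₀ + 1/4) π` of the root of the depth and the half-width of the
potential well. -/
def wellProduct (κ₀ : ℕ) : ℝ := ((κ₀ : ℝ) + 1 / 4) * π

/-- The half-width `r` of the well, determined by `E * r = (κ₀ + 1/4) π`. -/
def halfWidth (κ₀ : ℕ) (E : ℝ) : ℝ := wellProduct κ₀ / E

/-- `x` is an element of `A` with exactly `j` elements of `A` above it: with `j` counted from `0`,
`x` is the `j`-th largest element of `A`. -/
def IsNthLargest (A : Set ℝ) (j : ℕ) (x : ℝ) : Prop :=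
  x ∈ A ∧ (A ∩ Ioi x).encard = (j : ℕ∞)

/-- `x` is an element of `A` with exactly `j` elements of `A` below it: with `j` counted from `0`,
`x` is the `j`-th smallest element of `A`. -/
def IsNthSmallest (A : Set ℝ) (j : ℕ) (x : ℝ) : Prop :=
  x ∈ A ∧ (A ∩ Iio x).encard = (j : ℕ∞)

/-- A curve `f : [E₁, E₂] → ℝⁿ` is non-degenerate if no nonzero linear combination of its
components vanishes identically on `[E₁, E₂]`. -/
def NonDegenerateOn {n : ℕ} (f : ℝ → Fin n → ℝ) (E₁ E₂ : ℝ) : Prop :=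
  ∀ c : Fin n → ℝ, c ≠ 0 → ∃ E ∈ Icc E₁ E₂, ∑ j, c j * f E j ≠ 0

/-! ### The limit frequencies -/

/-- The secular function
`λ cos(r √(E² - λ²)) coth((1 - r) λ) - √(E² - λ²) sin(r √(E² - λ²))`. -/
def secular (κ₀ : ℕ) (E lam : ℝ) : ℝ :=
  lam * cos (halfWidth κ₀ E * √(E ^ 2 - lam ^ 2)) *
      (cosh ((1 - halfWidth κ₀ E) * lam) / sinh ((1 - halfWidth κ₀ E) * lam)) -
    √(E ^ 2 - lam ^ 2) * sin (halfWidth κ₀ E * √(E ^ 2 - lam ^ 2))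

/-- The zeros of the secular function in `(0, E)`. -/
def secularRoots (κ₀ : ℕ) (E : ℝ) : Set ℝ :=
  {lam | lam ∈ Ioo 0 E ∧ secular κ₀ E lam = 0}

/-- The limit frequency vector: its `j`-th entry is the `j`-th largest zero of the secular
function in `(0, E)`, so that minus its square is the `j`-th lowest eigenvalue of the limit
operator. -/
def limitFreq (κ₀ : ℕ) (E : ℝ) (j : Fin κ₀) : ℝ :=
  Classical.epsilon (IsNthLargest (secularRoots κ₀ E) j)

/-! ### The potential `Q_m` -/

/-- The regularized indicator function `h_m(z) = ((cosh z / cosh 1)^m + 1)⁻¹` of `(-1, 1)`. -/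
def profile (m : ℕ) (z : ℝ) : ℝ := ((cosh z / cosh 1) ^ m + 1)⁻¹

/-- The `2 κ₀` interpolation points `z_p` and `-z_p`. -/
def signedNode {κ₀ : ℕ} (z : Fin κ₀ → ℝ) : Fin κ₀ ⊕ Fin κ₀ → ℝ :=
  Sum.elim z (fun p => -z p)

/-- The polynomial `(X² - T²)^{2S} ∏_{j' ≠ j} (X - z_{j'})^{2S}`. -/
def nodeWeight {κ₀ : ℕ} (S : ℕ) (T : ℝ) (z : Fin κ₀ → ℝ) (j : Fin κ₀ ⊕ Fin κ₀) :
    Polynomial ℝ :=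
  (Polynomial.X ^ 2 - Polynomial.C (T ^ 2)) ^ (2 * S) *
    ∏ j' ∈ Finset.univ.erase j,
      (Polynomial.X - Polynomial.C (signedNode z j')) ^ (2 * S)

/-- The Hermite basis polynomial `(X - z_j)^{2i+1} / (2i+1)!` times the weight of the node `j`. -/
def hermiteBasis {κ₀ : ℕ} (S : ℕ) (T : ℝ) (z : Fin κ₀ → ℝ) (j : Fin κ₀ ⊕ Fin κ₀) (i : ℕ) :
    Polynomial ℝ :=
  Polynomial.C (((2 * i + 1).factorial : ℝ)⁻¹) *
    (Polynomial.X - Polynomial.C (signedNode z j)) ^ (2 * i + 1) * nodeWeight S T z j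

/-- The coefficients of the interpolation at the node `j`, obtained by forward substitution in
the triangular system
`∑_{n ≤ i} a_n * (hermiteBasis n)^{(2i+1)}(z_j) = - h_m^{(2i+1)}(z_j)`, `i = 0, …, S - 1`. -/
def hermiteCoeff {κ₀ : ℕ} (m S : ℕ) (T : ℝ) (z : Fin κ₀ → ℝ) (j : Fin κ₀ ⊕ Fin κ₀) (i : ℕ) : ℝ :=
  (-iteratedDeriv (2 * i + 1) (profile m) (signedNode z j) -
      ∑ n : Fin i, hermiteCoeff m S T z j n *
        (Polynomial.derivative^[2 * i + 1] (hermiteBasis S T z j n)).eval (signedNode z j)) /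
    (nodeWeight S T z j).eval (signedNode z j)
termination_by i
decreasing_by exact n.2

/-- The polynomial corrector `g`: the odd derivatives of `h_m + g` of order `1, 3, …, 2S - 1`
vanish at the (distinct) points `± z_p`. -/
def corrector {κ₀ : ℕ} (m S : ℕ) (T : ℝ) (z : Fin κ₀ → ℝ) : Polynomial ℝ :=
  ∑ j : Fin κ₀ ⊕ Fin κ₀, ∑ i ∈ Finset.range S,
    Polynomial.C (hermiteCoeff m S T z j i) * hermiteBasis S T z j i

/-- The analytic potential `Q_m(y) = -E² (h_m(y/r) + g(y/r))`, where the corrector `g` belongs to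
the points `y_p / r`. -/
def potential {κ₀ : ℕ} (m S : ℕ) (T : ℝ) (yp : Fin κ₀ → ℝ) (E y : ℝ) : ℝ :=
  -E ^ 2 * (profile m (y / halfWidth κ₀ E) +
    (corrector m S T (fun p => yp p / halfWidth κ₀ E)).eval (y / halfWidth κ₀ E))

/-! ### The frequencies of the operator `-∂_y² + Q_m` -/

/-- The eigenvalues of `-∂_y² + Q` on even functions on `[-1, 1]` with Dirichlet boundary
conditions: there is a nontrivial even `φ` with derivative `φ'` such that `φ'' = (Q - μ) φ` on
`[-1, 1]` and `φ(±1) = 0`. -/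
def evenDirichletSpectrum (Q : ℝ → ℝ) : Set ℝ :=
  {μ | ∃ φ φ' : ℝ → ℝ,
    (∀ y ∈ Icc (-1 : ℝ) 1, HasDerivWithinAt φ (φ' y) (Icc (-1) 1) y) ∧
    (∀ y ∈ Icc (-1 : ℝ) 1, HasDerivWithinAt φ' ((Q y - μ) * φ y) (Icc (-1) 1) y) ∧
    (∀ y ∈ Icc (-1 : ℝ) 1, φ (-y) = φ y) ∧
    φ (-1) = 0 ∧ φ 1 = 0 ∧ ∃ y ∈ Icc (-1 : ℝ) 1, φ y ≠ 0}

/-- The frequency `λ_j = √(-μ_j)`, where `μ_j` is the `j`-th lowest eigenvalue (counted from `0`)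
of `-∂_y² + Q` on even functions with Dirichlet boundary conditions. -/
def wellFreq (Q : ℝ → ℝ) (j : ℕ) : ℝ :=
  √(-Classical.epsilon (IsNthSmallest (evenDirichletSpectrum Q) j))

/-- The vector of linear frequencies `(λ_{1,m}(E), …, λ_{κ₀,m}(E))` of `-∂_y² + Q_m`. -/
def freq {κ₀ : ℕ} (m S : ℕ) (T : ℝ) (yp : Fin κ₀ → ℝ) (E : ℝ) (j : Fin κ₀) : ℝ :=
  wellFreq (potential m S T yp E) j

end ShearFreq

end

/-! The eigenvalue problem is made scalar by the Prüfer angle. For `φ'' = (q - μ) φ`, `φ 0 = 1`, `φ'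
0 = 0`, put `φ = ρ sin θ`, `φ' = ρ cos θ`; then `θ' = 1 - (1 + q - μ) sin² θ` and `θ 0 = π / 2`. The
end angle `Θ(μ) = θ 1` (`prueferEnd`) is positive, continuous and strictly increasing in `μ`, and
the Dirichlet condition reads `Θ(μ) ∈ π ℤ`. Once `Θ < π` somewhere, the `j`-th eigenvalue, counted
from `0`, is therefore the solution of `Θ(μ) = (j + 1) π` (`isNthSmallest_iff`). The angle depends
on `q` in a Lipschitz way with respect to the `L¹` norm (`IsPruefer.abs_sub_le`), so the
discontinuous square well, whose condition `Θ(-λ²) ∈ π ℤ` is the secular equation, can be compared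
with `Q_m`.

With `λ = E cos t` and `a = E - K` the secular equation involves `E` only through `a`. It has one
root on each branch `0 < K sin t - j π < π / 2`, `j < κ₀`, and this root is simple, hence analytic
in `a > 0` (`analyticAt_rootAngle`). Writing the hyperbolic functions as exponentials gives the
exact identity `sin (K sin t + t - (j π + π / 2)) = exp (-2 a cos t) cos (K sin t - j π - t)`. So
`t` tends to the solution `t₀` of `K sin t₀ + t₀ = j π + π / 2`, with a first correction
proportional to `exp (-2 a cos t₀)` and an error `O(a exp (-4 a cos t₀))` (`rootAngle_sub_isBigO`).
This is (i), with `α₀ = t₀ / π`.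

For (ii), a linear relation between the frequencies on an interval extends by analyticity to all `a
> 0`. As `a → ∞` the corrections decay at the pairwise different rates `2 cos t_j`, so the slowest
one present in the relation cannot be cancelled (`eq_zero_of_sum_cos_rootAngle_eq_zero`).

For (iii), the derivatives of `h_m` at the nodes, which stay inside `(-1, 1)`, are exponentially
small. Hence the corrector tends to `0` uniformly on bounded sets, while `h_m` tends to the
indicator of `(-1, 1)` in `L¹`. The end angles converge uniformly in `E`, so the frequencies exist
and converge (`tendsto_freq`), and compactness of the unit sphere of coefficients transfers
non-degeneracy from the limit (`NonDegenerateOn.eventually_of_tendsto`). -/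

noncomputable section

namespace ShearFreq

open Asymptotics

/-! ### Prüfer angles -/

/-- `θ` solves the Prüfer equation `θ' = cos² θ - q sin² θ` of `φ'' = q φ` on `[a, b]`, with
right derivatives. -/
structure IsPrueferOn (q θ : ℝ → ℝ) (a b : ℝ) : Prop where
  continuousOn : ContinuousOn θ (Icc a b)
  hasDerivWithinAt : ∀ y ∈ Ico a b,
    HasDerivWithinAt θ (1 - (1 + q y) * sin (θ y) ^ 2) (Ici y) y

/-- The Prüfer angle on `[0, 1]` of the solution with `φ 0 = 1`, `φ' 0 = 0`. -/
def IsPruefer (q θ : ℝ → ℝ) : Prop := IsPrueferOn q θ 0 1 ∧ θ 0 = π / 2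

theorem abs_sin_sq_sub_sin_sq_le (a b : ℝ) : |sin a ^ 2 - sin b ^ 2| ≤ |a - b| := by
  have h : sin a ^ 2 - sin b ^ 2 = sin (a - b) * sin (a + b) := by
    rw [sin_sub, sin_add]
    have h1 := sin_sq_add_cos_sq a
    have h2 := sin_sq_add_cos_sq b
    linear_combination (sin b ^ 2) * h1 - (sin a ^ 2) * h2
  rw [h, abs_mul]
  calc |sin (a - b)| * |sin (a + b)| ≤ |a - b| * 1 :=
        mul_le_mul abs_sin_le_abs (abs_sin_le_one _) (abs_nonneg _) (abs_nonneg _)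
    _ = |a - b| := mul_one _

/-- Sine is bounded and `sin²` is `1`-Lipschitz, so the vector field is bounded by `1 + M` and
`M`-Lipschitz in the angle on the whole line. A ball of radius `(1 + M) (b - a)` cannot be left, and
a single application of Picard–Lindelöf covers all of `[a, b]`. -/
theorem exists_pruefer_of_continuous {q : ℝ → ℝ} (hq : Continuous q) {a b t₀ : ℝ}
    (ht : t₀ ∈ Icc a b) (x₀ : ℝ) :
    ∃ θ : ℝ → ℝ, θ t₀ = x₀ ∧ ∀ y ∈ Icc a b,
      HasDerivWithinAt θ (1 - (1 + q y) * sin (θ y) ^ 2) (Icc a b) y := by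
  obtain ⟨M, hM⟩ := (isCompact_Icc (a := a) (b := b)).exists_bound_of_continuousOn
    (f := fun y => 1 + q y) (by fun_prop)
  have hM0 : 0 ≤ M := (norm_nonneg _).trans (hM t₀ ht)
  have hab : a ≤ b := ht.1.trans ht.2
  have key : IsPicardLindelof (fun y x => 1 - (1 + q y) * sin x ^ 2) (tmin := a) (tmax := b)
      ⟨t₀, ht⟩ x₀ (⟨(1 + M) * (b - a), by nlinarith⟩ : NNReal) 0
      (⟨1 + M, by linarith⟩ : NNReal) (⟨M, hM0⟩ : NNReal) := by
    refine ⟨fun t ht => ?_, fun x _ => by fun_prop, fun t ht x _ => ?_, ?_⟩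
    · refine LipschitzOnWith.of_dist_le_mul fun x _ y _ => ?_
      rw [Real.dist_eq, Real.dist_eq]
      have : 1 - (1 + q t) * sin x ^ 2 - (1 - (1 + q t) * sin y ^ 2)
          = -((1 + q t) * (sin x ^ 2 - sin y ^ 2)) := by ring
      rw [this, abs_neg, abs_mul]
      exact mul_le_mul (hM t ht) (abs_sin_sq_sub_sin_sq_le x y) (abs_nonneg _) hM0
    · have h1 := hM t ht
      rw [Real.norm_eq_abs] at h1 ⊢
      have h2 : |(1 + q t) * sin x ^ 2| ≤ M * 1 := by
        rw [abs_mul]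
        refine mul_le_mul h1 ?_ (abs_nonneg _) hM0
        rw [abs_of_nonneg (sq_nonneg _)]
        exact sin_sq_le_one x
      change _ ≤ 1 + M
      calc |1 - (1 + q t) * sin x ^ 2| ≤ |1| + |(1 + q t) * sin x ^ 2| := abs_sub _ _
        _ ≤ 1 + M := by rw [abs_one]; linarith
    · change (1 + M) * max (b - t₀) (t₀ - a) ≤ (1 + M) * (b - a) - 0
      rw [sub_zero]
      refine mul_le_mul_of_nonneg_left (max_le ?_ ?_) (by linarith)
      · linarith [ht.1]
      · linarith [ht.2]
  obtain ⟨θ, h0, h⟩ := key.exists_eq_forall_mem_Icc_hasDerivWithinAt₀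
  exact ⟨θ, h0, h⟩

theorem isPrueferOn_of_hasDerivWithinAt {q θ : ℝ → ℝ} {a b a' b' : ℝ}
    (h : ∀ y ∈ Icc a' b', HasDerivWithinAt θ (1 - (1 + q y) * sin (θ y) ^ 2) (Icc a' b') y)
    (ha : a' ≤ a) (hb : b ≤ b') : IsPrueferOn q θ a b where
  continuousOn y hy :=
    ((h y ⟨ha.trans hy.1, hy.2.trans hb⟩).continuousWithinAt).mono (Icc_subset_Icc ha hb)
  hasDerivWithinAt y hy := by
    refine (h y ⟨ha.trans hy.1, hy.2.le.trans hb⟩).mono_of_mem_nhdsWithin ?_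
    refine mem_of_superset (Icc_mem_nhdsGE (hy.2.trans_le hb)) ?_
    exact Icc_subset_Icc (ha.trans hy.1) le_rfl

theorem exists_isPruefer_of_continuous {q : ℝ → ℝ} (hq : Continuous q) : ∃ θ, IsPruefer q θ := by
  obtain ⟨θ, h0, h⟩ := exists_pruefer_of_continuous hq
    (show (0 : ℝ) ∈ Icc 0 1 from ⟨le_rfl, zero_le_one⟩) (π / 2)
  exact ⟨θ, isPrueferOn_of_hasDerivWithinAt h le_rfl le_rfl, h0⟩

/-- The potential with value `A` on `y < r` and `B` on `y ≥ r`. -/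
def step (r A B y : ℝ) : ℝ := if y < r then A else B

/-- Solutions for the two constants are glued at `r`. Only right derivatives are demanded, so the
corner of the angle at `r` is harmless: there the potential already has its right-hand value `B`. -/
theorem exists_isPruefer_step {r : ℝ} (hr : r ∈ Ioo (0 : ℝ) 1) (A B : ℝ) :
    ∃ θ, IsPruefer (step r A B) θ := by
  obtain ⟨α, hα0, hα⟩ := exists_pruefer_of_continuous (continuous_const (y := A))
    (show (0 : ℝ) ∈ Icc 0 r from ⟨le_rfl, hr.1.le⟩) (π / 2)
  obtain ⟨β, hβ0, hβ⟩ := exists_pruefer_of_continuous (continuous_const (y := B))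
    (show r ∈ Icc r 1 from ⟨le_rfl, hr.2.le⟩) (α r)
  have pα := isPrueferOn_of_hasDerivWithinAt (q := fun _ => A) hα le_rfl le_rfl
  have pβ := isPrueferOn_of_hasDerivWithinAt (q := fun _ => B) hβ le_rfl le_rfl
  set θ : ℝ → ℝ := fun y => if y ≤ r then α y else β y with hθ
  have eα : ∀ y, y ≤ r → θ y = α y := fun y hy => by simp [hθ, hy]
  have eβ : ∀ y, r ≤ y → θ y = β y := fun y hy => by
    rcases hy.eq_or_lt with rfl | h
    · simp [hθ, hβ0]
    · simp [hθ, not_le.2 h]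
  have cα : ContinuousOn θ (Icc 0 r) := pα.continuousOn.congr fun y hy => eα y hy.2
  have cβ : ContinuousOn θ (Icc r 1) := pβ.continuousOn.congr fun y hy => eβ y hy.1
  have dα : ∀ y ∈ Ico 0 r, HasDerivWithinAt θ (1 - (1 + A) * sin (θ y) ^ 2) (Ici y) y := by
    intro y hy
    rw [eα y hy.2.le]
    refine (pα.hasDerivWithinAt y hy).congr_of_eventuallyEq ?_ (eα y hy.2.le)
    filter_upwards [Icc_mem_nhdsGE hy.2] with z hz using eα z hz.2
  have dβ : ∀ y ∈ Ico r 1, HasDerivWithinAt θ (1 - (1 + B) * sin (θ y) ^ 2) (Ici y) y := by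
    intro y hy
    rw [eβ y hy.1]
    refine (pβ.hasDerivWithinAt y hy).congr (fun z hz => eβ z (hy.1.trans hz)) (eβ y hy.1)
  refine ⟨θ, ⟨?_, ?_⟩, by rw [eα 0 hr.1.le, hα0]⟩
  · rw [← Icc_union_Icc_eq_Icc hr.1.le hr.2.le]
    exact cα.union_of_isClosed cβ isClosed_Icc isClosed_Icc
  · intro y hy
    by_cases h : y < r
    · simpa [step, h] using dα y ⟨hy.1, h⟩
    · simpa [step, h] using dβ y ⟨not_lt.1 h, hy.2⟩

/-! ### Comparison -/

/-- Grönwall's inequality with the difference of the potentials measured in `L¹`: `I` is a primitive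
of a pointwise bound `d`. A sup-norm bound would not suffice later, since continuous potentials
cannot approach a step uniformly. -/
theorem IsPruefer.abs_sub_le {q₁ q₂ θ₁ θ₂ : ℝ → ℝ} (h₁ : IsPruefer q₁ θ₁) (h₂ : IsPruefer q₂ θ₂)
    {L : ℝ} (hL : ∀ y ∈ Ico (0 : ℝ) 1, |1 + q₁ y| ≤ L) {I d : ℝ → ℝ}
    (hI : ContinuousOn I (Icc 0 1)) (hI0 : I 0 = 0)
    (hd : ∀ y ∈ Ico (0 : ℝ) 1, HasDerivWithinAt I (d y) (Ici y) y)
    (hq : ∀ y ∈ Ico (0 : ℝ) 1, |q₁ y - q₂ y| ≤ d y) :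
    |θ₁ 1 - θ₂ 1| ≤ exp L * I 1 := by
  have hL0 : 0 ≤ L := (abs_nonneg _).trans (hL 0 ⟨le_rfl, zero_lt_one⟩)
  have main : ∀ ε > 0, |θ₁ 1 - θ₂ 1| ≤ exp L * (I 1 + 2 * ε) := by
    intro ε hε
    have hlin : ∀ y : ℝ, HasDerivAt (fun y => exp (L * y)) (exp (L * y) * L) y := fun y => by
      simpa using ((hasDerivAt_id y).const_mul L).exp
    -- The two `ε` terms make the barrier start above the difference and grow strictly faster than
    -- it at contact; `ε` is sent to `0` at the end.
    have := image_norm_le_of_norm_deriv_right_lt_deriv_boundary' (f := fun y => θ₁ y - θ₂ y)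
      (B := fun y => exp (L * y) * (I y + ε * y + ε)) (a := 0) (b := 1)
      (B' := fun y => exp (L * y) * L * (I y + ε * y + ε) + exp (L * y) * (d y + ε))
      (h₁.1.continuousOn.sub h₂.1.continuousOn)
      (fun y hy => (h₁.1.hasDerivWithinAt y hy).sub (h₂.1.hasDerivWithinAt y hy))
      (by simp [h₁.2, h₂.2, hI0, hε.le]) (by fun_prop)
      (fun y hy => by
        have := (((hd y hy).add ((hasDerivWithinAt_id y _).const_mul ε)).add_const ε)
        simpa using! (hlin y).hasDerivWithinAt.mul this)
      (fun y hy heq => by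
        rw [Real.norm_eq_abs] at heq ⊢
        have e : 1 - (1 + q₁ y) * sin (θ₁ y) ^ 2 - (1 - (1 + q₂ y) * sin (θ₂ y) ^ 2)
            = -((1 + q₁ y) * (sin (θ₁ y) ^ 2 - sin (θ₂ y) ^ 2))
              + (-((q₁ y - q₂ y) * sin (θ₂ y) ^ 2)) := by ring
        rw [e]
        have b1 : |(1 + q₁ y) * (sin (θ₁ y) ^ 2 - sin (θ₂ y) ^ 2)| ≤ L * |θ₁ y - θ₂ y| := by
          rw [abs_mul]
          exact mul_le_mul (hL y hy) (abs_sin_sq_sub_sin_sq_le _ _) (abs_nonneg _) hL0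
        have b2 : |(q₁ y - q₂ y) * sin (θ₂ y) ^ 2| ≤ d y := by
          rw [abs_mul, abs_of_nonneg (sq_nonneg (sin (θ₂ y)))]
          calc |q₁ y - q₂ y| * sin (θ₂ y) ^ 2 ≤ |q₁ y - q₂ y| * 1 :=
                mul_le_mul_of_nonneg_left (sin_sq_le_one _) (abs_nonneg _)
            _ ≤ d y := by simpa using hq y hy
        have d0 : 0 ≤ d y := (abs_nonneg _).trans (hq y hy)
        have e1 : 1 ≤ exp (L * y) := one_le_exp (mul_nonneg hL0 hy.1)
        have b3 : d y + ε ≤ exp (L * y) * (d y + ε) :=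
          le_mul_of_one_le_left (by linarith) e1
        calc _ ≤ |(1 + q₁ y) * (sin (θ₁ y) ^ 2 - sin (θ₂ y) ^ 2)|
              + |(q₁ y - q₂ y) * sin (θ₂ y) ^ 2| := by
                refine (abs_add_le _ _).trans ?_
                rw [abs_neg, abs_neg]
          _ ≤ L * (exp (L * y) * (I y + ε * y + ε)) + d y := by
                rw [← heq]; exact add_le_add b1 b2
          _ < _ := by nlinarith)
      (show (1 : ℝ) ∈ Icc 0 1 from ⟨zero_le_one, le_rfl⟩)
    rw [Real.norm_eq_abs] at this
    refine this.trans (le_of_eq ?_)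
    simp only [mul_one]; ring
  have : Tendsto (fun ε : ℝ => exp L * (I 1 + 2 * ε)) (𝓝[>] 0) (𝓝 (exp L * (I 1 + 2 * 0))) :=
    (Continuous.tendsto (by fun_prop) 0).mono_left nhdsWithin_le_nhds
  simpa using ge_of_tendsto this (by filter_upwards [self_mem_nhdsWithin] with ε hε using main ε hε)

theorem IsPruefer.abs_sub_le_of_abs_le {q₁ q₂ θ₁ θ₂ : ℝ → ℝ} (h₁ : IsPruefer q₁ θ₁)
    (h₂ : IsPruefer q₂ θ₂) {L δ : ℝ} (hL : ∀ y ∈ Ico (0 : ℝ) 1, |1 + q₁ y| ≤ L)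
    (hq : ∀ y ∈ Ico (0 : ℝ) 1, |q₁ y - q₂ y| ≤ δ) :
    |θ₁ 1 - θ₂ 1| ≤ exp L * δ := by
  simpa using h₁.abs_sub_le h₂ hL (I := fun y => δ * y) (d := fun _ => δ) (by fun_prop)
    (by simp) (fun y _ => by simpa using (hasDerivWithinAt_id y (Ici y)).const_mul δ) hq

theorem IsPruefer.le_of_le {q₁ q₂ θ₁ θ₂ : ℝ → ℝ} (h₁ : IsPruefer q₁ θ₁) (h₂ : IsPruefer q₂ θ₂)
    {L : ℝ} (hL : ∀ y ∈ Ico (0 : ℝ) 1, |1 + q₁ y| ≤ L)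
    (hq : ∀ y ∈ Ico (0 : ℝ) 1, q₂ y ≤ q₁ y) : ∀ y ∈ Icc (0 : ℝ) 1, θ₁ y ≤ θ₂ y := by
  have hL0 : 0 ≤ L := (abs_nonneg _).trans (hL 0 ⟨le_rfl, zero_lt_one⟩)
  intro y hy
  have main : ∀ ε > 0, θ₁ y - θ₂ y ≤ ε * exp ((L + 1) * y) := by
    intro ε hε
    refine image_le_of_deriv_right_lt_deriv_boundary (f := fun y => θ₁ y - θ₂ y)
      (B := fun y => ε * exp ((L + 1) * y)) (a := 0) (b := 1)
      (B' := fun y => ε * (exp ((L + 1) * y) * (L + 1)))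
      (h₁.1.continuousOn.sub h₂.1.continuousOn)
      (fun y hy => (h₁.1.hasDerivWithinAt y hy).sub (h₂.1.hasDerivWithinAt y hy))
      (by simp [h₁.2, h₂.2, hε.le])
      (fun y => by simpa using (((hasDerivAt_id y).const_mul (L + 1)).exp).const_mul ε)
      (fun y hy heq => ?_) hy
    have e : 1 - (1 + q₁ y) * sin (θ₁ y) ^ 2 - (1 - (1 + q₂ y) * sin (θ₂ y) ^ 2)
        = -((1 + q₁ y) * (sin (θ₁ y) ^ 2 - sin (θ₂ y) ^ 2))
          - (q₁ y - q₂ y) * sin (θ₂ y) ^ 2 := by ring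
    have b1 : |(1 + q₁ y) * (sin (θ₁ y) ^ 2 - sin (θ₂ y) ^ 2)| ≤ L * |θ₁ y - θ₂ y| := by
      rw [abs_mul]
      exact mul_le_mul (hL y hy) (abs_sin_sq_sub_sin_sq_le _ _) (abs_nonneg _) hL0
    have hB : 0 < ε * exp ((L + 1) * y) := by positivity
    rw [heq, abs_of_pos hB] at b1
    have b2 := mul_nonneg (sub_nonneg.2 (hq y hy)) (sq_nonneg (sin (θ₂ y)))
    rw [e]
    have := neg_abs_le ((1 + q₁ y) * (sin (θ₁ y) ^ 2 - sin (θ₂ y) ^ 2))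
    nlinarith
  have : Tendsto (fun ε : ℝ => ε * exp ((L + 1) * y)) (𝓝[>] 0) (𝓝 (0 * exp ((L + 1) * y))) :=
    (Continuous.tendsto (by fun_prop) 0).mono_left nhdsWithin_le_nhds
  have := ge_of_tendsto this (by filter_upwards [self_mem_nhdsWithin] with ε hε using main ε hε)
  linarith

/-- If the end angles agreed, the non-positive function `exp (L y) (θ₁ - θ₂)`, which is
non-increasing, would end at `0` and so vanish throughout. The right derivatives at `0` forbid this:
there `sin θ = 1`, and they differ by `q₂ 0 - q₁ 0`. -/
theorem IsPruefer.lt_of_le {q₁ q₂ θ₁ θ₂ : ℝ → ℝ} (h₁ : IsPruefer q₁ θ₁) (h₂ : IsPruefer q₂ θ₂)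
    {L : ℝ} (hL : ∀ y ∈ Ico (0 : ℝ) 1, |1 + q₁ y| ≤ L)
    (hq : ∀ y ∈ Ico (0 : ℝ) 1, q₂ y ≤ q₁ y) (hq0 : q₂ 0 < q₁ 0) : θ₁ 1 < θ₂ 1 := by
  have hle := h₁.le_of_le h₂ hL hq
  have h11 : (1 : ℝ) ∈ Icc (0 : ℝ) 1 := ⟨zero_le_one, le_rfl⟩
  refine lt_of_le_of_ne (hle 1 h11) fun heq => ?_
  have hzero : ∀ x ∈ Icc (0 : ℝ) 1, θ₁ x - θ₂ x = 0 := by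
    intro x hx
    have h0 : exp (L * x) * (θ₁ x - θ₂ x) ≤ 0 := by
      exact mul_nonpos_of_nonneg_of_nonpos (exp_pos _).le (by linarith [hle x hx])
    have hsub : Icc x 1 ⊆ Icc 0 1 := Icc_subset_Icc hx.1 le_rfl
    by_contra hne
    have hlt : θ₁ x - θ₂ x < 0 := lt_of_le_of_ne (by linarith [hle x hx]) hne
    have hB := image_le_of_deriv_right_le_deriv_boundary
      (f := fun y => exp (L * y) * (θ₁ y - θ₂ y))
      (f' := fun y => exp (L * y) * L * (θ₁ y - θ₂ y) + exp (L * y) *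
        (1 - (1 + q₁ y) * sin (θ₁ y) ^ 2 - (1 - (1 + q₂ y) * sin (θ₂ y) ^ 2)))
      (B := fun _ => exp (L * x) * (θ₁ x - θ₂ x)) (B' := fun _ => 0) (a := x) (b := 1)
      (((by fun_prop : Continuous fun y => exp (L * y)).continuousOn).mul
        ((h₁.1.continuousOn.sub h₂.1.continuousOn).mono hsub))
      (fun y hy => by
        have hlin : HasDerivAt (fun y => exp (L * y)) (exp (L * y) * L) y := by
          simpa using ((hasDerivAt_id y).const_mul L).exp
        have hy' : y ∈ Ico (0 : ℝ) 1 := ⟨hx.1.trans hy.1, hy.2⟩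
        exact hlin.hasDerivWithinAt.mul
          ((h₁.1.hasDerivWithinAt y hy').sub (h₂.1.hasDerivWithinAt y hy')))
      le_rfl continuousOn_const (fun y _ => hasDerivWithinAt_const _ _ _)
      (fun y hy => by
        have hy' : y ∈ Ico (0 : ℝ) 1 := ⟨hx.1.trans hy.1, hy.2⟩
        have e : 1 - (1 + q₁ y) * sin (θ₁ y) ^ 2 - (1 - (1 + q₂ y) * sin (θ₂ y) ^ 2)
            = -((1 + q₁ y) * (sin (θ₁ y) ^ 2 - sin (θ₂ y) ^ 2))
              - (q₁ y - q₂ y) * sin (θ₂ y) ^ 2 := by ring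
        have b1 : |(1 + q₁ y) * (sin (θ₁ y) ^ 2 - sin (θ₂ y) ^ 2)| ≤ L * |θ₁ y - θ₂ y| := by
          rw [abs_mul]
          exact mul_le_mul (hL y hy') (abs_sin_sq_sub_sin_sq_le _ _) (abs_nonneg _)
            ((abs_nonneg _).trans (hL y hy'))
        have hD : θ₁ y - θ₂ y ≤ 0 := by linarith [hle y ⟨hy'.1, hy'.2.le⟩]
        rw [abs_of_nonpos hD] at b1
        have b2 := mul_nonneg (sub_nonneg.2 (hq y hy')) (sq_nonneg (sin (θ₂ y)))
        have := neg_abs_le ((1 + q₁ y) * (sin (θ₁ y) ^ 2 - sin (θ₂ y) ^ 2))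
        have hs : L * (θ₁ y - θ₂ y) + (1 - (1 + q₁ y) * sin (θ₁ y) ^ 2
            - (1 - (1 + q₂ y) * sin (θ₂ y) ^ 2)) ≤ 0 := by rw [e]; linarith
        calc _ = exp (L * y) * (L * (θ₁ y - θ₂ y) + (1 - (1 + q₁ y) * sin (θ₁ y) ^ 2
            - (1 - (1 + q₂ y) * sin (θ₂ y) ^ 2))) := by ring
          _ ≤ 0 := mul_nonpos_of_nonneg_of_nonpos (exp_pos _).le hs)
      (show (1 : ℝ) ∈ Icc x 1 from ⟨hx.2, le_rfl⟩)
    have : exp (L * x) * (θ₁ x - θ₂ x) < 0 := mul_neg_of_pos_of_neg (exp_pos _) hlt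
    simp only [heq, sub_self, mul_zero] at hB
    linarith
  have d0 := (h₁.1.hasDerivWithinAt 0 ⟨le_rfl, zero_lt_one⟩).sub
    (h₂.1.hasDerivWithinAt 0 ⟨le_rfl, zero_lt_one⟩)
  have d1 : HasDerivWithinAt (θ₁ - θ₂) 0 (Ici 0) 0 := by
    refine (hasDerivWithinAt_const (0 : ℝ) (Ici 0) (0 : ℝ)).congr_of_eventuallyEq ?_
      (by simp [h₁.2, h₂.2])
    filter_upwards [Icc_mem_nhdsGE (zero_lt_one (α := ℝ))] with z hz using hzero z hz
  have := (uniqueDiffOn_Ici (0 : ℝ) 0 self_mem_Ici).eq_deriv _ d0 d1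
  rw [h₁.2, h₂.2, sin_pi_div_two] at this
  linarith

/-- The angle cannot cross a small level downwards, because `θ' > 0` wherever `sin² θ` is small. -/
theorem IsPruefer.pos {q θ : ℝ → ℝ} (h : IsPruefer q θ) {L : ℝ}
    (hL : ∀ y ∈ Ico (0 : ℝ) 1, |1 + q y| ≤ L) : 0 < θ 1 := by
  have hL0 : 0 ≤ L := (abs_nonneg _).trans (hL 0 ⟨le_rfl, zero_lt_one⟩)
  -- At `θ = δ`, `sin² δ < δ` gives `(1 + q) sin² δ ≤ L δ = L / (1 + L) < 1`, so the angle increases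
  -- there.
  set δ : ℝ := 1 / (1 + L) with hδ
  have hδ0 : 0 < δ := by positivity
  have hδ1 : δ ≤ 1 := by rw [hδ, div_le_one (by linarith)]; linarith
  have := image_le_of_deriv_right_lt_deriv_boundary' (f := fun y => -θ y)
    (f' := fun y => -(1 - (1 + q y) * sin (θ y) ^ 2)) (B := fun _ => -δ) (B' := fun _ => 0)
    (a := 0) (b := 1) h.1.continuousOn.neg (fun y hy => (h.1.hasDerivWithinAt y hy).neg)
    (by simp only [h.2]; linarith [Real.pi_gt_three]) continuousOn_const
    (fun y _ => hasDerivWithinAt_const _ _ _)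
    (fun y hy heq => by
      have he : θ y = δ := by linarith
      rw [he]
      have s1 : sin δ < δ := sin_lt hδ0
      have s0 : 0 ≤ sin δ := sin_nonneg_of_nonneg_of_le_pi hδ0.le (by linarith [Real.pi_gt_three])
      have s2 : sin δ ^ 2 < δ := by nlinarith
      have h1 : (1 + q y) * sin δ ^ 2 ≤ L * sin δ ^ 2 :=
        mul_le_mul_of_nonneg_right ((le_abs_self _).trans (hL y hy)) (sq_nonneg _)
      have h2 : L * sin δ ^ 2 ≤ L * δ := mul_le_mul_of_nonneg_left s2.le hL0
      have h3 : L * δ < 1 := by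
        rw [hδ, mul_one_div, div_lt_one (by linarith)]; linarith
      linarith)
    (show (1 : ℝ) ∈ Icc 0 1 from ⟨zero_le_one, le_rfl⟩)
  linarith

/-- If `φ' = ψ` and `ψ' = q φ`, then `(φ, ψ)` stays parallel to `(sin θ, cos θ)`. -/
theorem IsPrueferOn.mul_cos_eq {q θ φ ψ : ℝ → ℝ} {a b : ℝ} (h : IsPrueferOn q θ a b) {L : ℝ}
    (hL : ∀ y ∈ Ico a b, |1 + q y| ≤ L)
    (cφ : ContinuousOn φ (Icc a b)) (cψ : ContinuousOn ψ (Icc a b))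
    (dφ : ∀ y ∈ Ico a b, HasDerivWithinAt φ (ψ y) (Ici y) y)
    (dψ : ∀ y ∈ Ico a b, HasDerivWithinAt ψ (q y * φ y) (Ici y) y)
    (h0 : φ a * cos (θ a) = ψ a * sin (θ a)) :
    ∀ y ∈ Icc a b, φ y * cos (θ y) = ψ y * sin (θ y) := by
  intro y hy
  refine sub_eq_zero.1 (eq_zero_of_abs_deriv_le_mul_abs_self_of_eq_zero_right (K := L)
    (f := fun y => φ y * cos (θ y) - ψ y * sin (θ y))
    ((cφ.mul (continuous_cos.comp_continuousOn h.continuousOn)).sub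
      (cψ.mul (continuous_sin.comp_continuousOn h.continuousOn)))
    (fun y hy => ((dφ y hy).mul (h.hasDerivWithinAt y hy).cos).sub
      ((dψ y hy).mul (h.hasDerivWithinAt y hy).sin)) (sub_eq_zero.2 h0) (fun y hy => ?_) y hy)
  have hs := sin_sq_add_cos_sq (θ y)
  -- The defect `w = φ cos θ - ψ sin θ` solves the homogeneous equation `w' = -(1 + q) sin θ cos θ
  -- w`, so it stays zero.
  have e : ψ y * cos (θ y) + φ y * (-sin (θ y) * (1 - (1 + q y) * sin (θ y) ^ 2))
      - (q y * φ y * sin (θ y) + ψ y * (cos (θ y) * (1 - (1 + q y) * sin (θ y) ^ 2)))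
      = -((1 + q y) * (sin (θ y) * cos (θ y)) * (φ y * cos (θ y) - ψ y * sin (θ y))) := by
    linear_combination φ y * sin (θ y) * (1 + q y) * hs
  have hsc : |sin (θ y) * cos (θ y)| ≤ 1 := by
    rw [abs_mul]
    exact mul_le_one₀ (abs_sin_le_one _) (abs_nonneg _) (abs_cos_le_one _)
  rw [e, norm_neg, Real.norm_eq_abs, Real.norm_eq_abs, abs_mul, abs_mul]
  refine mul_le_mul_of_nonneg_right ?_ (abs_nonneg _)
  calc |1 + q y| * |sin (θ y) * cos (θ y)| ≤ L * 1 :=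
        mul_le_mul (hL y hy) hsc (abs_nonneg _) ((abs_nonneg _).trans (hL y hy))
    _ = L := mul_one L

/-! ### The Prüfer angle at the end point as a function of the spectral parameter -/

/-- The Prüfer angle at `1` for the potential `q` and the spectral parameter `μ`. -/
def prueferEnd (q : ℝ → ℝ) (μ : ℝ) : ℝ :=
  Classical.epsilon (IsPruefer fun y => q y - μ) 1

/-- A bounded potential for which the Prüfer equation is solvable for all spectral parameters. -/
def IsAdmissible (q : ℝ → ℝ) : Prop :=
  (∀ μ, ∃ θ, IsPruefer (fun y => q y - μ) θ) ∧ ∃ M, ∀ y ∈ Ico (0 : ℝ) 1, |1 + q y| ≤ M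

theorem isAdmissible_of_continuous {q : ℝ → ℝ} (hq : Continuous q) : IsAdmissible q := by
  refine ⟨fun μ => exists_isPruefer_of_continuous (by fun_prop), ?_⟩
  obtain ⟨M, hM⟩ := (isCompact_Icc (a := (0 : ℝ)) (b := 1)).exists_bound_of_continuousOn
    (f := fun y => 1 + q y) (by fun_prop)
  exact ⟨M, fun y hy => hM y ⟨hy.1, hy.2.le⟩⟩

theorem isAdmissible_step {r : ℝ} (hr : r ∈ Ioo (0 : ℝ) 1) (A B : ℝ) :
    IsAdmissible (step r A B) := by
  refine ⟨fun μ => ?_, max |1 + A| |1 + B|, fun y _ => ?_⟩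
  · obtain ⟨θ, h⟩ := exists_isPruefer_step hr (A - μ) (B - μ)
    refine ⟨θ, ?_⟩
    have : (fun y => step r A B y - μ) = step r (A - μ) (B - μ) := by
      funext y; unfold step; split_ifs <;> rfl
    rwa [this]
  · unfold step; split_ifs
    exacts [le_max_left _ _, le_max_right _ _]

theorem IsAdmissible.exists_isPruefer {q : ℝ → ℝ} (h : IsAdmissible q) (μ : ℝ) :
    ∃ θ, IsPruefer (fun y => q y - μ) θ ∧ θ 1 = prueferEnd q μ :=
  ⟨_, Classical.epsilon_spec (h.1 μ), rfl⟩

theorem abs_one_add_sub_le {q : ℝ → ℝ} {M : ℝ} (h : ∀ y ∈ Ico (0 : ℝ) 1, |1 + q y| ≤ M) (μ : ℝ) :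
    ∀ y ∈ Ico (0 : ℝ) 1, |1 + (q y - μ)| ≤ M + |μ| := fun y hy => by
  have e : 1 + (q y - μ) = (1 + q y) - μ := by ring
  rw [e]
  exact (abs_sub _ _).trans (by linarith [h y hy])

theorem IsAdmissible.prueferEnd_pos {q : ℝ → ℝ} (h : IsAdmissible q) (μ : ℝ) :
    0 < prueferEnd q μ := by
  obtain ⟨θ, hθ, e⟩ := h.exists_isPruefer μ
  obtain ⟨M, hM⟩ := h.2
  exact e ▸ hθ.pos (abs_one_add_sub_le hM μ)

theorem IsAdmissible.strictMono {q : ℝ → ℝ} (h : IsAdmissible q) : StrictMono (prueferEnd q) := by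
  intro μ ν hμν
  obtain ⟨θ, hθ, e⟩ := h.exists_isPruefer μ
  obtain ⟨η, hη, e'⟩ := h.exists_isPruefer ν
  obtain ⟨M, hM⟩ := h.2
  rw [← e, ← e']
  exact hθ.lt_of_le hη (abs_one_add_sub_le hM μ) (fun y _ => by linarith) (by linarith)

theorem IsAdmissible.continuous {q : ℝ → ℝ} (h : IsAdmissible q) : Continuous (prueferEnd q) := by
  obtain ⟨M, hM⟩ := h.2
  rw [continuous_iff_continuousAt]
  intro μ
  obtain ⟨θ, hθ, e⟩ := h.exists_isPruefer μ
  rw [ContinuousAt, tendsto_iff_dist_tendsto_zero]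
  refine squeeze_zero (g := fun ν => exp (M + |μ|) * |ν - μ|) (fun _ => dist_nonneg)
    (fun ν => ?_) ?_
  · obtain ⟨η, hη, e'⟩ := h.exists_isPruefer ν
    rw [← e, ← e', dist_comm, Real.dist_eq]
    exact hθ.abs_sub_le_of_abs_le hη (abs_one_add_sub_le hM μ) (fun y _ => by ring_nf; rfl)
  · have : Continuous fun ν : ℝ => exp (M + |μ|) * |ν - μ| := by fun_prop
    simpa using this.tendsto μ

theorem IsAdmissible.abs_prueferEnd_sub_le {q₁ q₂ : ℝ → ℝ} (h₁ : IsAdmissible q₁)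
    (h₂ : IsAdmissible q₂) {M : ℝ} (hM : ∀ y ∈ Ico (0 : ℝ) 1, |1 + q₁ y| ≤ M) {I d : ℝ → ℝ}
    (hI : ContinuousOn I (Icc 0 1)) (hI0 : I 0 = 0)
    (hd : ∀ y ∈ Ico (0 : ℝ) 1, HasDerivWithinAt I (d y) (Ici y) y)
    (hq : ∀ y ∈ Ico (0 : ℝ) 1, |q₁ y - q₂ y| ≤ d y) (μ : ℝ) :
    |prueferEnd q₁ μ - prueferEnd q₂ μ| ≤ exp (M + |μ|) * I 1 := by
  obtain ⟨θ, hθ, e⟩ := h₁.exists_isPruefer μ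
  obtain ⟨η, hη, e'⟩ := h₂.exists_isPruefer μ
  rw [← e, ← e']
  exact hθ.abs_sub_le hη (abs_one_add_sub_le hM μ) hI hI0 hd (fun y hy => by simpa using hq y hy)

/-! ### Counting -/

theorem encard_inter_Iio_of_eq {Θ : ℝ → ℝ} (hm : StrictMono Θ) (hc : Continuous Θ)
    (hp : ∀ μ, 0 < Θ μ) {μ₀ : ℝ} (h0 : Θ μ₀ < π) {j : ℕ} {x : ℝ} (hx : Θ x = (j + 1) * π) :
    ({μ | ∃ n : ℤ, Θ μ = n * π} ∩ Iio x).encard = (j : ℕ∞) := by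
  have himg : Θ '' ({μ | ∃ n : ℤ, Θ μ = n * π} ∩ Iio x)
      = (fun i : ℕ => ((i : ℝ) + 1) * π) '' (Finset.range j : Set ℕ) := by
    ext t
    constructor
    · rintro ⟨μ, ⟨⟨n, hn⟩, hμ⟩, rfl⟩
      have h1 := hp μ
      have h2 := hm hμ
      rw [hn] at h1 h2 ⊢
      rw [hx] at h2
      have hn0 : (0 : ℝ) < n := pos_of_mul_pos_left h1 pi_pos.le
      have hn1 : (n : ℝ) < j + 1 := lt_of_mul_lt_mul_right h2 pi_pos.le
      have hn0' : 0 < n := by exact_mod_cast hn0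
      have hn1' : n < j + 1 := by exact_mod_cast hn1
      obtain ⟨k, rfl⟩ : ∃ k : ℕ, n = k + 1 := ⟨(n - 1).toNat, by omega⟩
      refine ⟨k, ?_, by push_cast; ring⟩
      simp only [Finset.coe_range, mem_Iio]; omega
    · rintro ⟨i, hi, rfl⟩
      have hi' : i < j := by simpa using hi
      have hij : (i : ℝ) + 1 ≤ j := by exact_mod_cast hi'
      have hpi := pi_pos
      have hμx : μ₀ < x := hm.lt_iff_lt.1 (by rw [hx]; nlinarith [(Nat.cast_nonneg j : (0 : ℝ) ≤ j)])
      obtain ⟨μ, hμ, e⟩ : ((i : ℝ) + 1) * π ∈ Θ '' Icc μ₀ x :=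
        intermediate_value_Icc hμx.le hc.continuousOn
          ⟨h0.le.trans (by nlinarith [(Nat.cast_nonneg i : (0 : ℝ) ≤ i)]), by rw [hx]; nlinarith⟩
      refine ⟨μ, ⟨⟨i + 1, by rw [e]; push_cast; ring⟩, hm.lt_iff_lt.1 ?_⟩, e⟩
      rw [e, hx]; nlinarith
  rw [← hm.injective.encard_image, himg, Function.Injective.encard_image]
  · rw [encard_coe_eq_coe_finsetCard, Finset.card_range]
  · intro a b hab
    have := mul_right_cancel₀ pi_ne_zero hab
    exact_mod_cast add_right_cancel this

/-- By the intermediate value theorem a strictly increasing, positive `Θ` that starts below `π`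
meets each of `π, …, j π` exactly once before it reaches `(j + 1) π`; the shift by one comes from
counting `j` from `0`. -/
theorem isNthSmallest_iff {Θ : ℝ → ℝ} (hm : StrictMono Θ) (hc : Continuous Θ)
    (hp : ∀ μ, 0 < Θ μ) {μ₀ : ℝ} (h0 : Θ μ₀ < π) {j : ℕ} {x : ℝ} :
    IsNthSmallest {μ | ∃ n : ℤ, Θ μ = n * π} j x ↔ Θ x = (j + 1) * π := by
  constructor
  · rintro ⟨⟨n, hn⟩, hcard⟩
    have h1 := hp x
    rw [hn] at h1
    have hn0 : (0 : ℝ) < n := pos_of_mul_pos_left h1 pi_pos.le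
    have hn0' : 0 < n := by exact_mod_cast hn0
    obtain ⟨k, rfl⟩ : ∃ k : ℕ, n = k + 1 := ⟨(n - 1).toNat, by omega⟩
    have hk : Θ x = ((k : ℝ) + 1) * π := by rw [hn]; push_cast; ring
    have := encard_inter_Iio_of_eq hm hc hp h0 hk
    rw [hcard] at this
    have hjk : j = k := by exact_mod_cast this
    rw [hk, hjk]
  · intro h
    exact ⟨⟨j + 1, by rw [h]; push_cast; ring⟩, encard_inter_Iio_of_eq hm hc hp h0 h⟩

/-! ### Eigenvalues and Prüfer angles -/

theorem eq_zero_of_linear_ode {q φ ψ : ℝ → ℝ} {a b t₀ : ℝ} (hq : Continuous q)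
    (ht : t₀ ∈ Icc a b) (dφ : ∀ y ∈ Icc a b, HasDerivWithinAt φ (ψ y) (Icc a b) y)
    (dψ : ∀ y ∈ Icc a b, HasDerivWithinAt ψ (q y * φ y) (Icc a b) y)
    (h0 : φ t₀ = 0) (h0' : ψ t₀ = 0) : ∀ y ∈ Icc a b, φ y = 0 := by
  obtain ⟨M, hM⟩ := (isCompact_Icc (a := a) (b := b)).exists_bound_of_continuousOn hq.continuousOn
  have hM0 : 0 ≤ M := (norm_nonneg _).trans (hM t₀ ht)
  set v : ℝ → ℝ × ℝ → ℝ × ℝ := fun y p => (p.2, q y * p.1)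
  set f : ℝ → ℝ × ℝ := fun y => (φ y, ψ y)
  have hv : ∀ y ∈ Icc a b, LipschitzOnWith (⟨1 + M, by linarith⟩ : NNReal) (v y) univ := by
    intro y hy
    refine LipschitzOnWith.of_dist_le_mul fun p _ p' _ => ?_
    change dist _ _ ≤ (1 + M) * dist p p'
    rw [Prod.dist_eq]
    refine max_le ?_ ?_
    · calc dist p.2 p'.2 ≤ dist p p' := le_max_right _ _
        _ ≤ (1 + M) * dist p p' := le_mul_of_one_le_left dist_nonneg (by linarith)
    · have h1 : dist (q y * p.1) (q y * p'.1) = ‖q y‖ * dist p.1 p'.1 := by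
        rw [Real.dist_eq, Real.dist_eq, ← mul_sub, abs_mul, Real.norm_eq_abs]
      calc dist (q y * p.1) (q y * p'.1) = ‖q y‖ * dist p.1 p'.1 := h1
        _ ≤ (1 + M) * dist p p' :=
          mul_le_mul ((hM y hy).trans (by linarith)) (le_max_left _ _) dist_nonneg (by linarith)
  have df : ∀ y ∈ Icc a b, HasDerivWithinAt f (v y (f y)) (Icc a b) y :=
    fun y hy => (dφ y hy).prodMk (dψ y hy)
  have cf : ContinuousOn f (Icc a b) := fun y hy => (df y hy).continuousWithinAt
  have dz : ∀ (s : Set ℝ) (y : ℝ),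
      HasDerivWithinAt (fun _ : ℝ => (0 : ℝ × ℝ)) (v y ((fun _ : ℝ => (0 : ℝ × ℝ)) y)) s y := by
    intro s y
    have : v y (0 : ℝ × ℝ) = 0 := by simp [v]
    rw [this]; exact hasDerivWithinAt_const _ _ _
  have hf0 : f t₀ = 0 := by simp [f, h0, h0']
  have hl : EqOn f (fun _ => 0) (Icc a t₀) := by
    refine ODE_solution_unique_of_mem_Icc_left (v := v) (s := fun _ => univ)
      (fun y hy => hv y ⟨hy.1.le, hy.2.trans ht.2⟩) (cf.mono (Icc_subset_Icc le_rfl ht.2))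
      (fun y hy => ?_) (fun _ _ => mem_univ _) continuousOn_const (fun y _ => dz _ y)
      (fun _ _ => mem_univ _) hf0
    refine (df y ⟨hy.1.le, hy.2.trans ht.2⟩).mono_of_mem_nhdsWithin ?_
    exact mem_of_superset (Icc_mem_nhdsLE hy.1) (Icc_subset_Icc le_rfl (hy.2.trans ht.2))
  have hr : EqOn f (fun _ => 0) (Icc t₀ b) := by
    refine ODE_solution_unique_of_mem_Icc_right (v := v) (s := fun _ => univ)
      (fun y hy => hv y ⟨ht.1.trans hy.1, hy.2.le⟩) (cf.mono (Icc_subset_Icc ht.1 le_rfl))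
      (fun y hy => ?_) (fun _ _ => mem_univ _) continuousOn_const (fun y _ => dz _ y)
      (fun _ _ => mem_univ _) hf0
    refine (df y ⟨ht.1.trans hy.1, hy.2.le⟩).mono_of_mem_nhdsWithin ?_
    exact mem_of_superset (Icc_mem_nhdsGE hy.2) (Icc_subset_Icc (ht.1.trans hy.1) le_rfl)
  intro y hy
  rcases le_total y t₀ with h | h
  · exact congrArg Prod.fst (hl ⟨hy.1, h⟩)
  · exact congrArg Prod.fst (hr ⟨h, hy.2⟩)

/-- Evenness forces `φ' 0 = 0`, so `(φ, φ')` is parallel to `(sin θ, cos θ)` up to the end point.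
There `φ 1 = 0` leaves only `sin θ = 0`, as `φ' 1 = 0` as well would make `φ` trivial. -/
theorem sin_prueferEnd_eq_zero_of_mem {Q : ℝ → ℝ} (hQ : Continuous Q) {μ : ℝ}
    (h : μ ∈ evenDirichletSpectrum Q) : sin (prueferEnd Q μ) = 0 := by
  obtain ⟨φ, ψ, dφ, dψ, heven, -, h1, y₁, hy₁, hne⟩ := h
  have hadm := isAdmissible_of_continuous hQ
  obtain ⟨θ, hθ, e⟩ := hadm.exists_isPruefer μ
  obtain ⟨M, hM⟩ := hadm.2
  have h00 : (0 : ℝ) ∈ Icc (-1 : ℝ) 1 := by constructor <;> norm_num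
  have nhds0 : Icc (-1 : ℝ) 1 ∈ 𝓝 (0 : ℝ) := Icc_mem_nhds (by norm_num) (by norm_num)
  have hψ0 : ψ 0 = 0 := by
    have d1 : HasDerivAt φ (ψ 0) 0 := (dφ 0 h00).hasDerivAt nhds0
    have d2 : HasDerivAt (fun y => φ (-y)) (-ψ 0) 0 := by
      have : HasDerivAt φ (ψ 0) (-0) := by simpa using d1
      simpa using! this.comp (0 : ℝ) (hasDerivAt_neg (0 : ℝ))
    have d3 : HasDerivAt φ (-ψ 0) 0 := d2.congr_of_eventuallyEq (by
      filter_upwards [nhds0] with y hy using (heven y hy).symm)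
    have := d1.unique d3
    linarith
  have sub : Icc (0 : ℝ) 1 ⊆ Icc (-1) 1 := Icc_subset_Icc (by norm_num) le_rfl
  have right : ∀ {f : ℝ → ℝ} {f' y : ℝ}, y ∈ Ico (0 : ℝ) 1 →
      HasDerivWithinAt f f' (Icc (-1) 1) y → HasDerivWithinAt f f' (Ici y) y := by
    intro f f' y hy hf
    refine hf.mono_of_mem_nhdsWithin (mem_of_superset (Icc_mem_nhdsGE hy.2) ?_)
    exact Icc_subset_Icc (by linarith [hy.1]) le_rfl
  have key := hθ.1.mul_cos_eq (abs_one_add_sub_le hM μ)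
    (fun y hy => ((dφ y (sub hy)).continuousWithinAt).mono sub)
    (fun y hy => ((dψ y (sub hy)).continuousWithinAt).mono sub)
    (fun y hy => right hy (dφ y (sub ⟨hy.1, hy.2.le⟩)))
    (fun y hy => right hy (dψ y (sub ⟨hy.1, hy.2.le⟩)))
    (by simp [hθ.2, hψ0]) 1 ⟨zero_le_one, le_rfl⟩
  rw [h1, zero_mul, e] at key
  rcases mul_eq_zero.1 key.symm with h | h
  · exact absurd (eq_zero_of_linear_ode (q := fun y => Q y - μ) (by fun_prop)
      (show (1 : ℝ) ∈ Icc (-1) 1 by constructor <;> norm_num) dφ dψ h1 h y₁ hy₁) hne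
  · exact h

/-- The eigenfunction is rebuilt as `ρ sin θ`, where the amplitude solves `ρ' = ρ (1 + q) sin θ cos
θ`. It is even because its reflection solves the same equation, by evenness of `Q`, with the same
data at `0`. -/
theorem mem_of_sin_prueferEnd_eq_zero {Q : ℝ → ℝ} (hQ : Continuous Q)
    (heven : ∀ y, Q (-y) = Q y) {μ : ℝ} (h : sin (prueferEnd Q μ) = 0) :
    μ ∈ evenDirichletSpectrum Q := by
  have hadm := isAdmissible_of_continuous hQ
  obtain ⟨η, hη, e⟩ := hadm.exists_isPruefer μ
  obtain ⟨M, hM⟩ := hadm.2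
  have hq : Continuous fun y => Q y - μ := by fun_prop
  -- The larger interval `[-2, 2]` provides two-sided derivatives at `±1`.
  obtain ⟨θ, hθ0, hθ⟩ := exists_pruefer_of_continuous hq
    (show (0 : ℝ) ∈ Icc (-2) 2 by constructor <;> norm_num) (π / 2)
  have cθ : ContinuousOn θ (Icc (-2) 2) := fun y hy => (hθ y hy).continuousWithinAt
  set g : ℝ → ℝ := fun y => (1 + (Q y - μ)) * (sin (θ y) * cos (θ y)) with hg
  have cg : ContinuousOn g (Icc (-2) 2) := by
    have c1 := continuous_sin.comp_continuousOn cθ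
    have c2 := continuous_cos.comp_continuousOn cθ
    exact ContinuousOn.mul (by fun_prop) (c1.mul c2)
  set ρ : ℝ → ℝ := fun y => exp (∫ t in (0 : ℝ)..y, g t) with hρ
  have dρ : ∀ y ∈ Icc (-1 : ℝ) 1, HasDerivAt ρ (ρ y * g y) y := by
    intro y hy
    refine (intervalIntegral.integral_hasDerivAt_right ?_ ?_ ?_).exp
    · refine (cg.mono ?_).intervalIntegrable
      exact uIcc_subset_Icc (by constructor <;> norm_num)
        ⟨by linarith [hy.1], by linarith [hy.2]⟩
    · exact (cg.mono Ioo_subset_Icc_self).stronglyMeasurableAtFilter isOpen_Ioo y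
        ⟨by linarith [hy.1], by linarith [hy.2]⟩
    · exact cg.continuousAt (Icc_mem_nhds (by linarith [hy.1]) (by linarith [hy.2]))
  have dθ : ∀ y ∈ Icc (-1 : ℝ) 1,
      HasDerivAt θ (1 - (1 + (Q y - μ)) * sin (θ y) ^ 2) y := fun y hy =>
    (hθ y ⟨by linarith [hy.1], by linarith [hy.2]⟩).hasDerivAt
      (Icc_mem_nhds (by linarith [hy.1]) (by linarith [hy.2]))
  set φ : ℝ → ℝ := fun y => ρ y * sin (θ y) with hφ
  set ψ : ℝ → ℝ := fun y => ρ y * cos (θ y) with hψ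
  have dφ : ∀ y ∈ Icc (-1 : ℝ) 1, HasDerivAt φ (ψ y) y := by
    intro y hy
    convert! (dρ y hy).mul (dθ y hy).sin using 1
    simp only [hψ, hg]
    ring
  have dψ : ∀ y ∈ Icc (-1 : ℝ) 1, HasDerivAt ψ ((Q y - μ) * φ y) y := by
    intro y hy
    convert! (dρ y hy).mul (dθ y hy).cos using 1
    simp only [hφ, hg]
    linear_combination (-ρ y * sin (θ y) * (1 + (Q y - μ))) * sin_sq_add_cos_sq (θ y)
  have neg_mem : ∀ y ∈ Icc (-1 : ℝ) 1, -y ∈ Icc (-1 : ℝ) 1 := fun y hy =>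
    ⟨by linarith [hy.2], by linarith [hy.1]⟩
  have hψ0 : ψ 0 = 0 := by simp [hψ, hθ0]
  have hev : ∀ y ∈ Icc (-1 : ℝ) 1, φ (-y) = φ y := by
    intro y hy
    refine sub_eq_zero.1 (eq_zero_of_linear_ode (q := fun y => Q y - μ)
      (φ := fun y => φ (-y) - φ y) (ψ := fun y => -ψ (-y) - ψ y) (t₀ := 0) hq
      (show (0 : ℝ) ∈ Icc (-1) 1 by constructor <;> norm_num) (fun y hy => ?_) (fun y hy => ?_)
      (by simp) (by simp [hψ0]) y hy)
    · have := (dφ (-y) (neg_mem y hy)).comp y (hasDerivAt_neg y)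
      simpa using! (this.sub (dφ y hy)).hasDerivWithinAt
    · have := ((dψ (-y) (neg_mem y hy)).comp y (hasDerivAt_neg y)).neg
      have := (this.sub (dψ y hy)).hasDerivWithinAt (s := Icc (-1) 1)
      rw [heven] at this
      convert! this using 1
      ring
  have hφ1 : φ 1 = 0 := by
    have right : ∀ {f : ℝ → ℝ} {f' : ℝ → ℝ}, (∀ y ∈ Icc (-1 : ℝ) 1, HasDerivAt f (f' y) y) →
        ∀ y ∈ Ico (0 : ℝ) 1, HasDerivWithinAt f (f' y) (Ici y) y := fun hf y hy =>
      (hf y ⟨by linarith [hy.1], hy.2.le⟩).hasDerivWithinAt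
    have cts : ∀ {f : ℝ → ℝ} {f' : ℝ → ℝ}, (∀ y ∈ Icc (-1 : ℝ) 1, HasDerivAt f (f' y) y) →
        ContinuousOn f (Icc 0 1) := fun hf y hy =>
      (hf y ⟨by linarith [hy.1], hy.2⟩).continuousAt.continuousWithinAt
    -- The hypothesis concerns the chosen angle `η`, not `θ`; parallelism with `(sin η, cos η)`
    -- carries the boundary condition over without identifying the two angles.
    have key := hη.1.mul_cos_eq (abs_one_add_sub_le hM μ) (cts dφ) (cts dψ) (right dφ) (right dψ)
      (by simp [hη.2, hψ0]) 1 ⟨zero_le_one, le_rfl⟩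
    rw [e, h, mul_zero] at key
    refine (mul_eq_zero.1 key).resolve_right fun hc => ?_
    have := sin_sq_add_cos_sq (prueferEnd Q μ)
    rw [h, hc] at this
    norm_num at this
  refine ⟨φ, ψ, fun y hy => (dφ y hy).hasDerivWithinAt, fun y hy => (dψ y hy).hasDerivWithinAt,
    hev, ?_, hφ1, 0, by constructor <;> norm_num, ?_⟩
  · rw [hev 1 (by constructor <;> norm_num), hφ1]
  · simp [hφ, hρ, hθ0]

theorem evenDirichletSpectrum_eq {Q : ℝ → ℝ} (hQ : Continuous Q) (heven : ∀ y, Q (-y) = Q y) :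
    evenDirichletSpectrum Q = {μ | ∃ n : ℤ, prueferEnd Q μ = n * π} := by
  ext μ
  have : (∃ n : ℤ, prueferEnd Q μ = n * π) ↔ sin (prueferEnd Q μ) = 0 := by
    rw [sin_eq_zero_iff]
    simp only [eq_comm]
  rw [mem_ofPred_eq, this]
  exact ⟨sin_prueferEnd_eq_zero_of_mem hQ, mem_of_sin_prueferEnd_eq_zero hQ heven⟩

/-! ### The square well -/

theorem IsPruefer.of_step {r A B μ : ℝ} {θ : ℝ → ℝ} (hr : r ∈ Ioo (0 : ℝ) 1)
    (h : IsPruefer (fun y => step r A B y - μ) θ) :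
    IsPrueferOn (fun _ => A - μ) θ 0 r ∧ IsPrueferOn (fun _ => B - μ) θ r 1 := by
  refine ⟨⟨h.1.continuousOn.mono (Icc_subset_Icc le_rfl hr.2.le), fun y hy => ?_⟩,
    ⟨h.1.continuousOn.mono (Icc_subset_Icc hr.1.le le_rfl), fun y hy => ?_⟩⟩
  · simpa [step, hy.2] using h.1.hasDerivWithinAt y ⟨hy.1, hy.2.trans hr.2⟩
  · simpa [step, not_lt.2 hy.1] using h.1.hasDerivWithinAt y ⟨hr.1.le.trans hy.1, hy.2⟩

/-- At the bottom of the well `q - μ ≥ 0`, and comparison with the zero potential, whose angle is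
constantly `π / 2`, applies. -/
theorem prueferEnd_step_bottom_le {r : ℝ} (hr : r ∈ Ioo (0 : ℝ) 1) (E : ℝ) :
    prueferEnd (step r (-E ^ 2) 0) (-E ^ 2) ≤ π / 2 := by
  have hadm := isAdmissible_step hr (-E ^ 2) 0
  obtain ⟨θ, hθ, e⟩ := hadm.exists_isPruefer (-E ^ 2)
  obtain ⟨M, hM⟩ := hadm.2
  rw [← e]
  have h0 : IsPruefer (fun _ => 0) (fun _ => π / 2) :=
    ⟨⟨continuousOn_const, fun y _ => by simpa using hasDerivWithinAt_const y (Ici y) (π / 2)⟩, rfl⟩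
  refine hθ.le_of_le h0 (abs_one_add_sub_le hM _) (fun y _ => ?_) 1 ⟨zero_le_one, le_rfl⟩
  unfold step; split_ifs
  · simp
  · nlinarith [sq_nonneg E]

theorem IsPrueferOn.mul_cos_eq_of_well {θ : ℝ → ℝ} {k r : ℝ} (h : IsPrueferOn (fun _ => -k ^ 2) θ 0 r)
    (h0 : θ 0 = π / 2) :
    ∀ y ∈ Icc 0 r, cos (k * y) * cos (θ y) = -k * sin (k * y) * sin (θ y) := by
  have hd : ∀ y : ℝ, HasDerivAt (fun y => k * y) k y := fun y => by
    simpa using (hasDerivAt_id y).const_mul k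
  refine h.mul_cos_eq (φ := fun y => cos (k * y)) (ψ := fun y => -k * sin (k * y))
    (L := |1 + -k ^ 2|) (fun _ _ => le_rfl) (by fun_prop) (by fun_prop)
    (fun y _ => ?_) (fun y _ => ?_) (by simp [h0])
  · convert! (hd y).cos.hasDerivWithinAt using 1; ring
  · convert! ((hd y).sin.const_mul (-k)).hasDerivWithinAt using 1; ring

/-- In the well `φ = cos (E y)`. If the angle ever equalled `E y`, then `cos² + E sin²` would vanish
at that point; so `θ - E y`, which starts at `π / 2`, stays positive up to `r`. Beyond `r` the angle
satisfies `θ' = cos² θ ≥ 0`. -/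
theorem mul_lt_prueferEnd_step {r E : ℝ} (hr : r ∈ Ioo (0 : ℝ) 1) (hE : 0 < E) :
    E * r < prueferEnd (step r (-E ^ 2) 0) 0 := by
  obtain ⟨θ, hθ, e⟩ := (isAdmissible_step hr (-E ^ 2) 0).exists_isPruefer 0
  obtain ⟨h1, h2⟩ := hθ.of_step hr
  rw [← e]
  have hge : θ r ≤ θ 1 := by
    refine image_le_of_deriv_right_le_deriv_boundary (f := fun _ => θ r) (f' := fun _ => 0)
      continuousOn_const (fun y _ => hasDerivWithinAt_const _ _ _) le_rfl h2.continuousOn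
      h2.hasDerivWithinAt (fun y _ => ?_) ⟨hr.2.le, le_rfl⟩
    simp [abs_sin_le_one]
  refine lt_of_lt_of_le ?_ hge
  rw [sub_zero] at h1
  have key := h1.mul_cos_eq_of_well hθ.2
  by_contra! hle
  have hc : ContinuousOn (fun y => θ y - E * y) (Icc 0 r) := h1.continuousOn.sub (by fun_prop)
  obtain ⟨y, hy, hy0⟩ : (0 : ℝ) ∈ (fun y => θ y - E * y) '' Icc 0 r :=
    intermediate_value_Icc' hr.1.le hc ⟨by simpa using hle, by simp [hθ.2]; positivity⟩
  have hk := key y hy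
  have hs : sin (θ y) * cos (E * y) - cos (θ y) * sin (E * y) = 0 := by
    rw [← sin_sub]; simp only at hy0; rw [hy0, sin_zero]
  set s := sin (θ y)
  set c := cos (θ y)
  set C := cos (E * y)
  set S := sin (E * y)
  have hsc : s ^ 2 + c ^ 2 = 1 := sin_sq_add_cos_sq _
  have hSC : S ^ 2 + C ^ 2 = 1 := sin_sq_add_cos_sq _
  have hpos : 0 < c ^ 2 + E * s ^ 2 := by
    rcases eq_or_ne s 0 with h | h
    · rw [h] at hsc ⊢; nlinarith
    · have := sq_pos_of_ne_zero h; positivity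
  have hC : C = 0 := by
    have : C * (c ^ 2 + E * s ^ 2) = 0 := by linear_combination c * hk + E * s * hs
    exact (mul_eq_zero.1 this).resolve_right hpos.ne'
  have hS : S = 0 := by
    have : S * (c ^ 2 + E * s ^ 2) = 0 := by linear_combination s * hk - c * hs
    exact (mul_eq_zero.1 this).resolve_right hpos.ne'
  rw [hC, hS] at hSC
  norm_num at hSC

theorem sin_prueferEnd_step_eq_zero_iff {r k l E : ℝ} (hr : r ∈ Ioo (0 : ℝ) 1) (hk : 0 < k)
    (hl : 0 < l) (hE : k ^ 2 + l ^ 2 = E ^ 2) :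
    sin (prueferEnd (step r (-E ^ 2) 0) (-l ^ 2)) = 0 ↔
      l * cos (k * r) * cosh (l * (1 - r)) - k * sin (k * r) * sinh (l * (1 - r)) = 0 := by
  obtain ⟨θ, hθ, e⟩ := (isAdmissible_step hr (-E ^ 2) 0).exists_isPruefer (-l ^ 2)
  obtain ⟨h1, h2⟩ := hθ.of_step hr
  rw [← e]
  have hk2 : -E ^ 2 - -l ^ 2 = -k ^ 2 := by linarith
  rw [hk2] at h1
  have hr1 := h1.mul_cos_eq_of_well hθ.2 r ⟨hr.1.le, le_rfl⟩
  have hd : ∀ y : ℝ, HasDerivAt (fun y => l * (y - r)) l y := fun y => by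
    simpa using ((hasDerivAt_id y).sub_const r).const_mul l
  set A := l * cos (k * r) with hA
  set B := k * sin (k * r) with hB
  -- This is the continuation outside the well of `l` times the inner solution: at `r` its data are
  -- `l cos (k r)` and `-l k sin (k r)`. The factor `l` avoids a division.
  have key := h2.mul_cos_eq (φ := fun y => A * cosh (l * (y - r)) - B * sinh (l * (y - r)))
    (ψ := fun y => l * (A * sinh (l * (y - r)) - B * cosh (l * (y - r))))
    (L := |1 + (0 - -l ^ 2)|) (fun _ _ => le_rfl) (by fun_prop) (by fun_prop)
    (fun y _ => by
      convert! (((hd y).cosh.const_mul A).sub ((hd y).sinh.const_mul B)).hasDerivWithinAt using 1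
      ring)
    (fun y _ => by
      convert! ((((hd y).sinh.const_mul A).sub
        ((hd y).cosh.const_mul B)).const_mul l).hasDerivWithinAt using 1
      ring)
    (by simp only [sub_self, mul_zero, cosh_zero, sinh_zero]; linear_combination l * hr1) 1 ⟨hr.2.le, le_rfl⟩
  constructor
  · intro hs
    rw [hs, mul_zero] at key
    refine (mul_eq_zero.1 key).resolve_right fun hc => ?_
    have := sin_sq_add_cos_sq (θ 1)
    rw [hs, hc] at this
    norm_num at this
  · intro h0
    rw [h0, zero_mul] at key
    refine (mul_eq_zero.1 key.symm).resolve_left fun hz => ?_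
    have hz' := (mul_eq_zero.1 hz).resolve_left hl.ne'
    have hch := cosh_sq (l * (1 - r))
    have hA0 : A = 0 := by
      linear_combination cosh (l * (1 - r)) * h0 - sinh (l * (1 - r)) * hz' - A * hch
    have hB0 : B = 0 := by
      linear_combination sinh (l * (1 - r)) * h0 - cosh (l * (1 - r)) * hz' - B * hch
    have c0 : cos (k * r) = 0 := (mul_eq_zero.1 hA0).resolve_left hl.ne'
    have s0 : sin (k * r) = 0 := (mul_eq_zero.1 hB0).resolve_left hk.ne'
    have := sin_sq_add_cos_sq (k * r)
    rw [c0, s0] at this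
    norm_num at this

theorem wellProduct_pos (κ₀ : ℕ) : 0 < wellProduct κ₀ := by unfold wellProduct; positivity

theorem halfWidth_mem_Ioo {κ₀ : ℕ} {E : ℝ} (hE : wellProduct κ₀ < E) :
    halfWidth κ₀ E ∈ Ioo (0 : ℝ) 1 := by
  have h := wellProduct_pos κ₀
  have h' : 0 < E := h.trans hE
  exact ⟨div_pos h h', (div_lt_one h').2 hE⟩

theorem mem_secularRoots_iff {κ₀ : ℕ} {E : ℝ} (hE : wellProduct κ₀ < E) {l : ℝ} :
    l ∈ secularRoots κ₀ E ↔ l ∈ Ioo 0 E ∧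
      ∃ n : ℤ, prueferEnd (step (halfWidth κ₀ E) (-E ^ 2) 0) (-l ^ 2) = n * π := by
  have hr := halfWidth_mem_Ioo hE
  set r := halfWidth κ₀ E with hrdef
  refine and_congr_right fun hl => ?_
  have hpos : 0 < E ^ 2 - l ^ 2 := by nlinarith [hl.1, hl.2]
  have hk : 0 < √(E ^ 2 - l ^ 2) := sqrt_pos.2 hpos
  have hk2 : √(E ^ 2 - l ^ 2) ^ 2 + l ^ 2 = E ^ 2 := by rw [sq_sqrt hpos.le]; ring
  have h1 := sin_prueferEnd_step_eq_zero_iff hr hk hl.1 hk2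
  rw [sin_eq_zero_iff] at h1
  have hs : 0 < sinh ((1 - r) * l) := sinh_pos_iff.2 (mul_pos (by linarith [hr.2]) hl.1)
  have h2 : (∃ n : ℤ, prueferEnd (step r (-E ^ 2) 0) (-l ^ 2) = n * π) ↔
      ∃ n : ℤ, (n : ℝ) * π = prueferEnd (step r (-E ^ 2) 0) (-l ^ 2) := by simp only [eq_comm]
  rw [h2, h1]
  unfold secular
  rw [← hrdef, mul_comm l (1 - r), mul_comm r]
  set k := √(E ^ 2 - l ^ 2)
  set t := (1 - r) * l
  have e : l * cos (k * r) * cosh t - k * sin (k * r) * sinh t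
      = (l * cos (k * r) * (cosh t / sinh t) - k * sin (k * r)) * sinh t := by
    field_simp
  rw [e, mul_eq_zero, or_iff_left hs.ne']

/-- The map `λ ↦ -λ²` reverses order on `(0, E)`, so largest roots become lowest levels. No level is
lost below: `Θ(μ) ∈ π ℤ` forces `Θ(μ) ≥ π > Θ(-E²)`, hence `μ > -E²`. -/
theorem prueferEnd_eq_of_isNthLargest {κ₀ : ℕ} {E : ℝ} (hE : wellProduct κ₀ < E) {j : ℕ} {l : ℝ}
    (h : IsNthLargest (secularRoots κ₀ E) j l) :
    prueferEnd (step (halfWidth κ₀ E) (-E ^ 2) 0) (-l ^ 2) = (j + 1) * π := by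
  have hr := halfWidth_mem_Ioo hE
  have hadm := isAdmissible_step hr (-E ^ 2) 0
  have hE0 : 0 < E := (wellProduct_pos κ₀).trans hE
  have hb := prueferEnd_step_bottom_le hr E
  have hbot : prueferEnd (step (halfWidth κ₀ E) (-E ^ 2) 0) (-E ^ 2) < π :=
    hb.trans_lt (by linarith [pi_pos])
  refine (isNthSmallest_iff hadm.strictMono hadm.continuous hadm.prueferEnd_pos hbot).1
    ⟨((mem_secularRoots_iff hE).1 h.1).2, ?_⟩
  have hl := h.1.1
  rw [← h.2]
  have himg : {μ | ∃ n : ℤ, prueferEnd (step (halfWidth κ₀ E) (-E ^ 2) 0) μ = n * π} ∩ Iio (-l ^ 2)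
      = (fun x => -x ^ 2) '' (secularRoots κ₀ E ∩ Ioi l) := by
    ext μ
    constructor
    · rintro ⟨⟨n, hn⟩, hμ⟩
      have hμl : μ < -l ^ 2 := hμ
      have hμ0 : μ < 0 := by nlinarith
      have hμE : -E ^ 2 < μ := by
        refine hadm.strictMono.lt_iff_lt.1 (hbot.trans_le ?_)
        have h1 := hadm.prueferEnd_pos μ
        rw [hn] at h1 ⊢
        have : (0 : ℝ) < n := pos_of_mul_pos_left h1 pi_pos.le
        have : (1 : ℝ) ≤ n := by exact_mod_cast (show (0 : ℤ) < n by exact_mod_cast this)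
        nlinarith [pi_pos]
      have hsq : -√(-μ) ^ 2 = μ := by rw [sq_sqrt (by linarith)]; ring
      refine ⟨√(-μ), ⟨(mem_secularRoots_iff hE).2 ⟨⟨sqrt_pos.2 (by linarith), ?_⟩, n, ?_⟩, ?_⟩, hsq⟩
      · exact (sqrt_lt' hE0).2 (by linarith)
      · rw [hsq, hn]
      · exact (lt_sqrt hl.1.le).2 (by linarith)
    · rintro ⟨x, ⟨hx, hlx⟩, rfl⟩
      refine ⟨((mem_secularRoots_iff hE).1 hx).2, ?_⟩
      have hlx' : l < x := hlx
      change -x ^ 2 < -l ^ 2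
      nlinarith [hl.1]
  rw [himg, InjOn.encard_image]
  intro x hx y hy hxy
  have hx0 : 0 < x := hx.1.1.1
  have hy0 : 0 < y := hy.1.1.1
  simp only [neg_inj] at hxy
  exact (pow_left_inj₀ hx0.le hy0.le two_ne_zero).1 hxy

/-! ### The secular equation in the angle variable -/

/-- The secular function at `λ = E cos t`, up to a positive factor, with `a = E - K`. -/
def angleFn (K a t : ℝ) : ℝ :=
  cos t * cos (K * sin t) * cosh (a * cos t) - sin t * sin (K * sin t) * sinh (a * cos t)

/-- The `j`-th branch of angles, on which `tan (K sin t)` increases from `0` to `∞`. -/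
def branch (K : ℝ) (j : ℕ) : Set ℝ :=
  {t | t ∈ Ioo 0 (π / 2) ∧ K * sin t ∈ Ioo (j * π) (j * π + π / 2)}

theorem angleFn_eq (K a t : ℝ) (j : ℕ) :
    (-1) ^ j * angleFn K a t = cos t * cos (K * sin t - j * π) * cosh (a * cos t) -
      sin t * sin (K * sin t - j * π) * sinh (a * cos t) := by
  rw [cos_sub_nat_mul_pi, sin_sub_nat_mul_pi, angleFn]; ring

theorem angleFn_eq_zero_iff (K a t : ℝ) (j : ℕ) :
    angleFn K a t = 0 ↔ cos t * cos (K * sin t - j * π) * cosh (a * cos t) -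
      sin t * sin (K * sin t - j * π) * sinh (a * cos t) = 0 := by
  rw [← angleFn_eq]; simp

theorem mul_cos_mem_secularRoots_iff {κ₀ : ℕ} {E : ℝ} (hE : wellProduct κ₀ < E) {t : ℝ}
    (ht : t ∈ Ioo 0 (π / 2)) :
    E * cos t ∈ secularRoots κ₀ E ↔ angleFn (wellProduct κ₀) (E - wellProduct κ₀) t = 0 := by
  have hE0 : 0 < E := (wellProduct_pos κ₀).trans hE
  have hs : 0 < sin t := sin_pos_of_pos_of_lt_pi ht.1 (by linarith [ht.2, pi_pos])
  have hc : 0 < cos t := cos_pos_of_mem_Ioo ⟨by linarith [ht.1, pi_pos], ht.2⟩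
  have hc1 : cos t < 1 := by nlinarith [sin_sq_add_cos_sq t]
  have hmem : E * cos t ∈ Ioo 0 E := ⟨by positivity, by nlinarith⟩
  have hsq : √(E ^ 2 - (E * cos t) ^ 2) = E * sin t := by
    rw [show E ^ 2 - (E * cos t) ^ 2 = (E * sin t) ^ 2 by
      linear_combination (-E ^ 2) * sin_sq_add_cos_sq t]
    exact sqrt_sq (by positivity)
  have h1 : halfWidth κ₀ E * (E * sin t) = wellProduct κ₀ * sin t := by
    unfold halfWidth; field_simp
  have h2 : (1 - halfWidth κ₀ E) * (E * cos t) = (E - wellProduct κ₀) * cos t := by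
    unfold halfWidth; field_simp
  have hsh : 0 < sinh ((E - wellProduct κ₀) * cos t) :=
    sinh_pos_iff.2 (mul_pos (by linarith) hc)
  rw [secularRoots, mem_ofPred_eq, and_iff_right hmem, secular, hsq, h1, h2]
  have e : angleFn (wellProduct κ₀) (E - wellProduct κ₀) t * E
      = (E * cos t * cos (wellProduct κ₀ * sin t) *
        (cosh ((E - wellProduct κ₀) * cos t) / sinh ((E - wellProduct κ₀) * cos t)) -
        E * sin t * sin (wellProduct κ₀ * sin t)) * sinh ((E - wellProduct κ₀) * cos t) := by
    rw [angleFn]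
    set s := sinh ((E - wellProduct κ₀) * cos t) with hsdef
    field_simp
  constructor
  · intro h
    rw [h, zero_mul] at e
    exact (mul_eq_zero.1 e).resolve_right hE0.ne'
  · intro h
    rw [h, zero_mul] at e
    exact (mul_eq_zero.1 e.symm).resolve_right hsh.ne'

/-- At a root `cos` and `sin` of `K sin t` must have the same sign, both nonzero, so `K sin t` lies
modulo `π` in the first quadrant. -/
theorem exists_mem_branch_of_angleFn_eq_zero {K a t : ℝ} (hK : 0 < K) (ha : 0 < a)
    (ht : t ∈ Ioo 0 (π / 2)) (h : angleFn K a t = 0) : ∃ j, t ∈ branch K j := by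
  have hs : 0 < sin t := sin_pos_of_pos_of_lt_pi ht.1 (by linarith [ht.2, pi_pos])
  have hc : 0 < cos t := cos_pos_of_mem_Ioo ⟨by linarith [ht.1, pi_pos], ht.2⟩
  have hsh : 0 < sinh (a * cos t) := sinh_pos_iff.2 (mul_pos ha hc)
  have hch := cosh_pos (a * cos t)
  have hX : 0 ≤ K * sin t / π := by positivity
  set j := ⌊K * sin t / π⌋₊ with hj
  have h1 : j * π ≤ K * sin t := (le_div_iff₀ pi_pos).1 (Nat.floor_le hX)
  have h2 : K * sin t < (j + 1) * π := (div_lt_iff₀ pi_pos).1 (Nat.lt_floor_add_one _)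
  rw [angleFn_eq_zero_iff K a t j] at h
  set x := K * sin t - j * π with hx
  have hx0 : 0 ≤ x := by linarith
  have hxpi : x < π := by linarith
  refine ⟨j, ht, ?_, ?_⟩
  · refine lt_of_le_of_ne h1 fun he => ?_
    have : x = 0 := by rw [hx, ← he]; ring
    rw [this] at h
    simp only [cos_zero, sin_zero, mul_one, mul_zero, zero_mul, sub_zero] at h
    exact (mul_pos hc hch).ne' h
  · by_contra! hge
    have hxp : π / 2 ≤ x := by linarith
    have hcx : cos x ≤ 0 := cos_nonpos_of_pi_div_two_le_of_le hxp (by linarith)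
    have hsx : 0 < sin x := sin_pos_of_pos_of_lt_pi (by linarith [pi_pos]) hxpi
    have : cos t * cos x * cosh (a * cos t) ≤ 0 :=
      mul_nonpos_of_nonpos_of_nonneg (mul_nonpos_of_nonneg_of_nonpos hc.le hcx) hch.le
    have : 0 < sin t * sin x * sinh (a * cos t) := by positivity
    linarith

theorem strictMonoOn_mul_coth : StrictMonoOn (fun u : ℝ => u * cosh u / sinh u) (Ioi 0) := by
  have hne : ∀ u ∈ Ioi (0 : ℝ), sinh u ≠ 0 := fun u hu => (sinh_pos_iff.2 hu).ne'
  refine strictMonoOn_of_deriv_pos (convex_Ioi 0)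
    (ContinuousOn.div (by fun_prop) (by fun_prop) hne) fun u hu => ?_
  rw [interior_Ioi] at hu
  have hu0 : (0 : ℝ) < u := hu
  have hs : 0 < sinh u := sinh_pos_iff.2 hu
  have hd := ((hasDerivAt_id u).mul (hasDerivAt_cosh u)).div (hasDerivAt_sinh u) hs.ne'
  have : deriv (fun u : ℝ => u * cosh u / sinh u) u = _ := hd.deriv
  rw [this]
  have h1 := self_lt_sinh_iff.2 hu0
  have h2 := one_le_cosh u
  have h3 := cosh_sq u
  simp only [id, Pi.mul_apply]
  refine div_pos ?_ (by positivity)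
  nlinarith

/-- With `u = a cos t` the equation reads `a sin t tan (K sin t - j π) = u coth u`. Along a branch
the left side increases, while the right side decreases because `u coth u` is increasing in `u`. -/
theorem eq_of_mem_branch {K a t₁ t₂ : ℝ} (hK : 0 < K) (ha : 0 < a) {j : ℕ}
    (h₁ : t₁ ∈ branch K j) (h₂ : t₂ ∈ branch K j) (e₁ : angleFn K a t₁ = 0)
    (e₂ : angleFn K a t₂ = 0) : t₁ = t₂ := by
  wlog hlt : t₁ < t₂ generalizing t₁ t₂
  · rcases (not_lt.1 hlt).eq_or_lt with h | h
    · exact h.symm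
    · exact (this h₂ h₁ e₂ e₁ h).symm
  exfalso
  have key : ∀ t ∈ branch K j, angleFn K a t = 0 →
      a * (sin t * tan (K * sin t - j * π)) = a * cos t * cosh (a * cos t) / sinh (a * cos t) := by
    intro t ht e
    rw [angleFn_eq_zero_iff K a t j] at e
    have hc : 0 < cos t := cos_pos_of_mem_Ioo ⟨by linarith [ht.1.1, pi_pos], ht.1.2⟩
    have hsh : 0 < sinh (a * cos t) := sinh_pos_iff.2 (mul_pos ha hc)
    have hx : 0 < cos (K * sin t - j * π) :=
      cos_pos_of_mem_Ioo ⟨by linarith [ht.2.1, pi_pos], by linarith [ht.2.2]⟩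
    rw [tan_eq_sin_div_cos]
    set C := cos (K * sin t - j * π)
    set S := sin (K * sin t - j * π)
    set s := sinh (a * cos t)
    field_simp
    linear_combination -e
  have k₁ := key t₁ h₁ e₁
  have k₂ := key t₂ h₂ e₂
  have hs : sin t₁ < sin t₂ :=
    sin_lt_sin_of_lt_of_le_pi_div_two (by linarith [h₁.1.1, pi_pos]) h₂.1.2.le hlt
  have hs0 : 0 < sin t₁ := sin_pos_of_pos_of_lt_pi h₁.1.1 (by linarith [h₁.1.2, pi_pos])
  have hc : cos t₂ < cos t₁ :=
    cos_lt_cos_of_nonneg_of_le_pi_div_two h₁.1.1.le h₂.1.2.le hlt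
  have hc0 : 0 < cos t₂ := cos_pos_of_mem_Ioo ⟨by linarith [h₂.1.1, pi_pos], h₂.1.2⟩
  have hx : K * sin t₁ - j * π < K * sin t₂ - j * π := by nlinarith
  have htan := tan_lt_tan_of_lt_of_lt_pi_div_two (x := K * sin t₁ - j * π)
    (y := K * sin t₂ - j * π) (by linarith [h₁.2.1, pi_pos]) (by linarith [h₂.2.2]) hx
  have htan0 : 0 < tan (K * sin t₁ - j * π) :=
    tan_pos_of_pos_of_lt_pi_div_two (by linarith [h₁.2.1]) (by linarith [h₁.2.2])
  have hp : a * cos t₂ * cosh (a * cos t₂) / sinh (a * cos t₂)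
      < a * cos t₁ * cosh (a * cos t₁) / sinh (a * cos t₁) :=
    strictMonoOn_mul_coth (mul_pos ha hc0) (mul_pos ha (hc0.trans hc)) (by nlinarith)
  have hl : sin t₁ * tan (K * sin t₁ - j * π) < sin t₂ * tan (K * sin t₂ - j * π) :=
    mul_lt_mul'' hs htan hs0.le htan0.le
  nlinarith

theorem exists_mem_branch {K a : ℝ} (ha : 0 < a) {j : ℕ} (hj : j * π + π / 2 < K) :
    ∃ t ∈ branch K j, angleFn K a t = 0 := by
  have hpi := pi_pos
  have hj0 : 0 ≤ (j : ℝ) * π := by positivity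
  have hK : 0 < K := by linarith
  set l := arcsin (j * π / K) with hl
  set u := arcsin ((j * π + π / 2) / K) with hu
  have b1 : 0 ≤ (j : ℝ) * π / K := by positivity
  have b2 : (j : ℝ) * π / K < (j * π + π / 2) / K := by gcongr; linarith
  have b3 : (j * π + π / 2) / K < 1 := (div_lt_one hK).2 hj
  have hl0 : 0 ≤ l := arcsin_nonneg.2 b1
  have hlu : l < u := arcsin_lt_arcsin (by linarith) b2 b3.le
  have hu1 : u < π / 2 := arcsin_lt_pi_div_two.2 b3
  have sl : K * sin l - j * π = 0 := by
    rw [hl, sin_arcsin (by linarith) (by linarith)]; field_simp; ring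
  have su : K * sin u - j * π = π / 2 := by
    rw [hu, sin_arcsin (by linarith) (by linarith)]; field_simp; ring
  set g : ℝ → ℝ := fun t => cos t * cos (K * sin t - j * π) * cosh (a * cos t) -
      sin t * sin (K * sin t - j * π) * sinh (a * cos t) with hg
  have gl : 0 < g l := by
    have : 0 < cos l := cos_pos_of_mem_Ioo ⟨by linarith, by linarith⟩
    have := cosh_pos (a * cos l)
    simp only [hg, sl, cos_zero, sin_zero]
    simp only [mul_one, mul_zero, zero_mul, sub_zero]; positivity
  have gu : g u < 0 := by
    have h1 : 0 < cos u := cos_pos_of_mem_Ioo ⟨by linarith, by linarith⟩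
    have h2 : 0 < sinh (a * cos u) := sinh_pos_iff.2 (mul_pos ha h1)
    have h3 : 0 < sin u := sin_pos_of_pos_of_lt_pi (by linarith) (by linarith)
    simp only [hg, su, cos_pi_div_two, sin_pi_div_two]
    simp only [mul_one, mul_zero, zero_mul, zero_sub, neg_lt_zero]; positivity
  obtain ⟨t, ht, h0⟩ : (0 : ℝ) ∈ g '' Ioo l u :=
    intermediate_value_Ioo' hlu.le (by fun_prop) ⟨gu, gl⟩
  refine ⟨t, ⟨⟨by linarith [ht.1], by linarith [ht.2]⟩, ?_, ?_⟩, (angleFn_eq_zero_iff K a t j).2 h0⟩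
  · have : sin l < sin t := sin_lt_sin_of_lt_of_le_pi_div_two (by linarith) (by linarith [ht.2]) ht.1
    nlinarith
  · have : sin t < sin u :=
      sin_lt_sin_of_lt_of_le_pi_div_two (by linarith [ht.1]) (by linarith) ht.2
    nlinarith

/-- The root of the secular equation in the `j`-th branch. -/
def rootAngle (K : ℝ) (j : ℕ) (a : ℝ) : ℝ :=
  Classical.epsilon fun t => t ∈ branch K j ∧ angleFn K a t = 0

theorem rootAngle_spec {K a : ℝ} (ha : 0 < a) {j : ℕ} (hj : j * π + π / 2 < K) :
    rootAngle K j a ∈ branch K j ∧ angleFn K a (rootAngle K j a) = 0 :=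
  Classical.epsilon_spec (p := fun t => t ∈ branch K j ∧ angleFn K a t = 0)
    (exists_mem_branch ha hj)

theorem rootAngle_eq {K a t : ℝ} (ha : 0 < a) {j : ℕ} (hj : j * π + π / 2 < K)
    (ht : t ∈ branch K j) (h : angleFn K a t = 0) : rootAngle K j a = t := by
  have hK : 0 < K := lt_trans (by have := pi_pos; positivity) hj
  exact eq_of_mem_branch hK ha (rootAngle_spec ha hj).1 ht (rootAngle_spec ha hj).2 h

theorem lt_of_mem_branch {K : ℝ} (hK : 0 < K) {i j : ℕ} (hij : i < j) {s t : ℝ}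
    (hs : s ∈ branch K i) (ht : t ∈ branch K j) : s < t := by
  have hij' : (i : ℝ) + 1 ≤ j := by exact_mod_cast hij
  have h : K * sin s < K * sin t := by
    have h1 := hs.2.2
    have h2 := ht.2.1
    nlinarith [pi_pos]
  have h' : sin s < sin t := lt_of_mul_lt_mul_left h hK.le
  by_contra! hle
  exact absurd h' (not_lt.2 (sin_le_sin_of_le_of_le_pi_div_two (by linarith [ht.1.1, pi_pos])
    hs.1.2.le hle))

theorem IsNthLargest.unique {A : Set ℝ} {j : ℕ} {x y : ℝ} (hx : IsNthLargest A j x)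
    (hy : IsNthLargest A j y) : x = y := by
  wlog hlt : x < y generalizing x y
  · rcases (not_lt.1 hlt).eq_or_lt with h | h
    · exact h.symm
    · exact (this hy hx h).symm
  exfalso
  have hfin : (A ∩ Ioi y).Finite := finite_of_encard_eq_coe hy.2
  have hss : A ∩ Ioi y ⊂ A ∩ Ioi x := by
    refine (ssubset_iff_of_subset (inter_subset_inter_right _ (Ioi_subset_Ioi hlt.le))).2 ?_
    exact ⟨y, ⟨hy.1, hlt⟩, fun h => lt_irrefl y h.2⟩
  have := hfin.encard_lt_encard hss
  rw [hx.2, hy.2] at this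
  exact lt_irrefl _ this

theorem branch_top_lt_wellProduct {κ₀ : ℕ} (j : Fin κ₀) : ((j : ℕ) : ℝ) * π + π / 2 < wellProduct κ₀ := by
  have : ((j : ℕ) : ℝ) + 1 ≤ κ₀ := by exact_mod_cast j.2
  unfold wellProduct
  nlinarith [pi_pos]

/-- The branches are ordered by their index and contain one root each, while `E cos t` decreases in
`t`. The roots above that of branch `j` are thus exactly those of the branches `0, …, j - 1`. -/
theorem isNthLargest_mul_cos_rootAngle {κ₀ : ℕ} {E : ℝ} (hE : wellProduct κ₀ < E) {j : ℕ}
    (hj : j * π + π / 2 < wellProduct κ₀) :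
    IsNthLargest (secularRoots κ₀ E) j
      (E * cos (rootAngle (wellProduct κ₀) j (E - wellProduct κ₀))) := by
  have hK := wellProduct_pos κ₀
  have hE0 : 0 < E := hK.trans hE
  have ha : 0 < E - wellProduct κ₀ := by linarith
  set K := wellProduct κ₀ with hKdef
  have hji : ∀ {i : ℕ}, i ≤ j → i * π + π / 2 < K := fun {i} hi => by
    have : (i : ℝ) ≤ j := by exact_mod_cast hi
    nlinarith [pi_pos]
  have hsp := fun {i : ℕ} (hi : i ≤ j) => rootAngle_spec ha (hji hi)
  have hlt : ∀ {s t : ℝ}, s ∈ Ioo 0 (π / 2) → t ∈ Ioo 0 (π / 2) → s < t → E * cos t < E * cos s :=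
    fun hs ht hst =>
      mul_lt_mul_of_pos_left (cos_lt_cos_of_nonneg_of_le_pi_div_two hs.1.le ht.2.le hst) hE0
  refine ⟨(mul_cos_mem_secularRoots_iff hE (hsp le_rfl).1.1).2 (hsp le_rfl).2, ?_⟩
  have himg : secularRoots κ₀ E ∩ Ioi (E * cos (rootAngle K j (E - K)))
      = (fun i : ℕ => E * cos (rootAngle K i (E - K))) '' (Finset.range j : Set ℕ) := by
    ext l
    constructor
    · rintro ⟨hl, hlj⟩
      obtain ⟨t, ht, rfl⟩ : ∃ t ∈ Ioo 0 (π / 2), l = E * cos t := by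
        have hl' := hl.1
        have h0 : 0 < l / E := div_pos hl'.1 hE0
        have h1 : l / E < 1 := (div_lt_one hE0).2 hl'.2
        refine ⟨arccos (l / E), ⟨arccos_pos.2 h1, arccos_lt_pi_div_two.2 h0⟩, ?_⟩
        rw [cos_arccos (by linarith) h1.le]; field_simp
      have h0 := (mul_cos_mem_secularRoots_iff hE ht).1 hl
      obtain ⟨i, hi⟩ := exists_mem_branch_of_angleFn_eq_zero hK ha ht h0
      have hij : i < j := by
        by_contra! hji'
        rcases hji'.eq_or_lt with h | h
        · subst h
          rw [rootAngle_eq ha hj hi h0] at hlj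
          exact lt_irrefl (E * cos t) hlj
        · have := hlt (hsp le_rfl).1.1 ht (lt_of_mem_branch hK h (hsp le_rfl).1 hi)
          exact lt_asymm this hlj
      exact ⟨i, by simpa using hij, by simp only [rootAngle_eq ha (hji hij.le) hi h0]⟩
    · rintro ⟨i, hi, rfl⟩
      have hij : i < j := by simpa using hi
      exact ⟨(mul_cos_mem_secularRoots_iff hE (hsp hij.le).1.1).2 (hsp hij.le).2,
        hlt (hsp hij.le).1.1 (hsp le_rfl).1.1
          (lt_of_mem_branch hK hij (hsp hij.le).1 (hsp le_rfl).1)⟩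
  rw [himg, InjOn.encard_image, encard_coe_eq_coe_finsetCard, Finset.card_range]
  intro i hi i' hi' h
  have hi1 : i < j := by simpa using hi
  have hi2 : i' < j := by simpa using hi'
  rcases lt_trichotomy i i' with hlt' | heq | hgt
  · exact absurd h (hlt (hsp hi1.le).1.1 (hsp hi2.le).1.1
      (lt_of_mem_branch hK hlt' (hsp hi1.le).1 (hsp hi2.le).1)).ne'
  · exact heq
  · exact absurd h (hlt (hsp hi2.le).1.1 (hsp hi1.le).1.1
      (lt_of_mem_branch hK hgt (hsp hi2.le).1 (hsp hi1.le).1)).ne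

theorem limitFreq_eq {κ₀ : ℕ} {E : ℝ} (hE : wellProduct κ₀ < E) (j : Fin κ₀) :
    limitFreq κ₀ E j = E * cos (rootAngle (wellProduct κ₀) j (E - wellProduct κ₀)) := by
  have h := isNthLargest_mul_cos_rootAngle hE (branch_top_lt_wellProduct j)
  exact (Classical.epsilon_spec (p := IsNthLargest (secularRoots κ₀ E) j) ⟨_, h⟩).unique h

theorem isNthLargest_limitFreq {κ₀ : ℕ} {E : ℝ} (hE : wellProduct κ₀ < E) (j : Fin κ₀) :
    IsNthLargest (secularRoots κ₀ E) j (limitFreq κ₀ E j) := by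
  rw [limitFreq_eq hE]
  exact isNthLargest_mul_cos_rootAngle hE (branch_top_lt_wellProduct j)

/-! ### Analyticity of the roots -/

theorem isInvertible_of_apply_one_ne_zero {f : ℝ →L[ℝ] ℝ} (h : f 1 ≠ 0) : f.IsInvertible := by
  refine ⟨.unitsEquivAut ℝ (.mk0 _ h), ?_⟩
  ext
  simp

theorem exists_hasDerivAt_angleFn_ne_zero {K a t : ℝ} (hK : 0 < K) (ha : 0 < a) {j : ℕ}
    (ht : t ∈ branch K j) (h : angleFn K a t = 0) :
    ∃ d, HasDerivAt (angleFn K a) d t ∧ d ≠ 0 := by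
  have hc : 0 < cos t := cos_pos_of_mem_Ioo ⟨by linarith [ht.1.1, pi_pos], ht.1.2⟩
  have hs : 0 < sin t := sin_pos_of_pos_of_lt_pi ht.1.1 (by linarith [ht.1.2, pi_pos])
  have hu : 0 < a * cos t := mul_pos ha hc
  have hsh : a * cos t < sinh (a * cos t) := self_lt_sinh_iff.2 hu
  have hch := one_le_cosh (a * cos t)
  have hC : 0 < cos (K * sin t - j * π) :=
    cos_pos_of_mem_Ioo ⟨by linarith [ht.2.1, pi_pos], by linarith [ht.2.2]⟩
  have hS : 0 < sin (K * sin t - j * π) :=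
    sin_pos_of_pos_of_lt_pi (by linarith [ht.2.1]) (by linarith [ht.2.2, pi_pos])
  have dX : HasDerivAt (fun t => K * sin t - j * π) (K * cos t) t := by
    simpa using ((hasDerivAt_sin t).const_mul K).sub_const (j * π)
  have du : HasDerivAt (fun t => a * cos t) (-(a * sin t)) t := by
    simpa using (hasDerivAt_cos t).const_mul a
  have d := (((hasDerivAt_cos t).mul dX.cos).mul du.cosh).sub
    (((hasDerivAt_sin t).mul dX.sin).mul du.sinh)
  have hpow : ((-1 : ℝ) ^ j) * (-1) ^ j = 1 := by rw [← mul_pow]; norm_num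
  have e : angleFn K a = fun t => (-1) ^ j * (cos t * cos (K * sin t - j * π) * cosh (a * cos t) -
      sin t * sin (K * sin t - j * π) * sinh (a * cos t)) := by
    funext s
    rw [← angleFn_eq, ← mul_assoc, hpow, one_mul]
  rw [angleFn_eq_zero_iff K a t j] at h
  rw [e]
  refine ⟨_, d.const_mul _, ?_⟩
  refine mul_ne_zero (pow_ne_zero _ (by norm_num)) (ne_of_lt ?_)
  have hcs := cosh_sq (a * cos t)
  simp only [Pi.mul_apply]
  set C := cos (K * sin t - j * π)
  set S := sin (K * sin t - j * π)
  set c := cos t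
  set s := sin t
  set ch := cosh (a * c)
  set sh := sinh (a * c)
  have hsh0 : 0 < sh := hu.trans hsh
  have h1 : s * C * (a * c - ch * sh) < 0 := by
    have : a * c - ch * sh < 0 := by nlinarith
    exact mul_neg_of_pos_of_neg (mul_pos hs hC) this
  have h2 : 0 < (K * c ^ 2 * S * ch + c * S * sh + K * s * c * C * sh) * sh := by positivity
  -- Multiplying the derivative by `sinh` allows the root equation to remove its only positive
  -- contribution, the one containing `a s² S cosh`.
  have : ((-s * C + c * (-S * (K * c))) * ch + c * C * (sh * -(a * s)) -
      ((c * S + s * (C * (K * c))) * sh + s * S * (ch * -(a * s)))) * sh < 0 := by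
    have : ((-s * C + c * (-S * (K * c))) * ch + c * C * (sh * -(a * s)) -
      ((c * S + s * (C * (K * c))) * sh + s * S * (ch * -(a * s)))) * sh
      = s * C * (a * c - ch * sh) - (K * c ^ 2 * S * ch + c * S * sh + K * s * c * C * sh) * sh := by
      linear_combination (-(a * s * ch)) * h + a * s * c * C * hcs
    linarith
  exact neg_of_mul_neg_left this hsh0.le

/-- The root is simple, so the implicit function theorem gives an analytic local solution;
uniqueness of the root on the open branch identifies it with `rootAngle`. -/
theorem analyticAt_rootAngle {K a : ℝ} (ha : 0 < a) {j : ℕ} (hj : j * π + π / 2 < K) :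
    AnalyticAt ℝ (rootAngle K j) a := by
  have hK : 0 < K := lt_trans (by have := pi_pos; positivity) hj
  obtain ⟨hb, h0⟩ := rootAngle_spec ha hj
  set t := rootAngle K j a with ht
  obtain ⟨d, hd, hd0⟩ := exists_hasDerivAt_angleFn_ne_zero hK ha hb h0
  set f : ℝ × ℝ → ℝ := fun p => angleFn K p.1 p.2 with hf
  -- The smoothness exponent `⊤` in `WithTop ℕ∞` means analytic, not merely `C^∞`.
  have cdf : ContDiffAt ℝ ⊤ f (a, t) := by
    have : ContDiff ℝ ⊤ f := by unfold f angleFn; fun_prop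
    exact this.contDiffAt
  have pn : (⊤ : WithTop ℕ∞) ≠ 0 := by simp
  have hinv : (fderiv ℝ f (a, t) ∘L .inr ℝ ℝ ℝ).IsInvertible := by
    refine isInvertible_of_apply_one_ne_zero ?_
    have h1 : HasFDerivAt f (fderiv ℝ f (a, t)) (a, t) :=
      (cdf.differentiableAt (by simp)).hasFDerivAt
    have h2 : HasDerivAt (fun s : ℝ => (a, s)) ((0 : ℝ), (1 : ℝ)) t :=
      (hasDerivAt_const t a).prodMk (hasDerivAt_id t)
    have h3 := (h1.comp_hasDerivAt t h2).unique hd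
    simpa [h3] using hd0
  have han : ContDiffAt ℝ ⊤ (cdf.implicitFunction pn hinv) a := cdf.contDiffAt_implicitFunction pn hinv
  have hself : cdf.implicitFunction pn hinv a = t := cdf.implicitFunction_apply_self pn hinv
  have hroot := cdf.eventually_apply_implicitFunction pn hinv
  have hcont : Tendsto (cdf.implicitFunction pn hinv) (𝓝 a) (𝓝 t) := by
    have := han.continuousAt.tendsto
    rwa [hself] at this
  have hopen : branch K j ∈ 𝓝 t := by
    have : IsOpen (branch K j) :=
      isOpen_Ioo.inter (isOpen_Ioo.preimage (by fun_prop : Continuous fun t => K * sin t))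
    exact this.mem_nhds hb
  refine AnalyticAt.congr (f := cdf.implicitFunction pn hinv) han.analyticAt ?_
  filter_upwards [hroot, hcont hopen, lt_mem_nhds ha] with b hb1 hb2 hb3
  refine (rootAngle_eq hb3 hj hb2 ?_).symm
  have : f (a, t) = 0 := h0
  rw [this] at hb1
  exact hb1

/-! ### Asymptotics of the roots -/

theorem exists_limit_angle {K : ℝ} {j : ℕ} (hj : j * π + π / 2 < K) :
    ∃ t ∈ Ioo 0 (π / 2), K * sin t + t = j * π + π / 2 := by
  have hpi := pi_pos
  have hj0 : 0 ≤ (j : ℝ) * π := by positivity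
  obtain ⟨t, ht, h⟩ : j * π + π / 2 ∈ (fun t => K * sin t + t) '' Ioo 0 (π / 2) :=
    intermediate_value_Ioo (by positivity) (by fun_prop) ⟨by simp; positivity, by simp; linarith⟩
  exact ⟨t, ht, h⟩

/-- With `x = K sin t - j π` and `v = a cos t`, the secular equation is `exp v cos (x + t) + exp
(-v) cos (x - t) = 0`. This isolates the exponentially small deviation from the limit equation `x +
t = π / 2`. -/
theorem sin_eq_exp_mul_cos {K a t : ℝ} {j : ℕ} (h : angleFn K a t = 0) :
    sin (K * sin t + t - (j * π + π / 2)) = exp (-(2 * a * cos t)) * cos (K * sin t - j * π - t) := by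
  rw [angleFn_eq_zero_iff K a t j] at h
  rw [show K * sin t + t - (j * π + π / 2) = (K * sin t - j * π) + t - π / 2 by ring,
    sin_sub_pi_div_two, cos_add (K * sin t - j * π) t, cos_sub (K * sin t - j * π) t]
  set C := cos (K * sin t - j * π)
  set S := sin (K * sin t - j * π)
  rw [cosh_eq, sinh_eq] at h
  have e1 : exp (-(2 * a * cos t)) = exp (-(a * cos t)) * exp (-(a * cos t)) := by
    rw [← exp_add]; ring_nf
  have e2 : exp (a * cos t) * exp (-(a * cos t)) = 1 := by rw [← exp_add]; simp
  rw [e1]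
  linear_combination (-2 * exp (-(a * cos t))) * h + (cos t * C - sin t * S) * e2

theorem rootAngle_sub_mem {K t₀ : ℝ} {j : ℕ} (hj : j * π + π / 2 < K)
    (ht₀ : t₀ ∈ Ioo 0 (π / 2)) (h₀ : K * sin t₀ + t₀ = j * π + π / 2) :
    ∃ c > 0, ∀ a > 0, 0 < rootAngle K j a - t₀ ∧
      rootAngle K j a - t₀ ≤ π / 2 * exp (-(2 * a * c)) := by
  have hpi := pi_pos
  have hj0 : 0 ≤ (j : ℝ) * π := by positivity
  have hK : 0 < K := by linarith
  have b1 : (j * π + π / 2) / K < 1 := (div_lt_one hK).2 hj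
  have b0 : 0 ≤ (j * π + π / 2) / K := by positivity
  -- On the branch `sin t ≤ (j π + π / 2) / K`, so this is a lower bound for `cos t` that does not
  -- depend on `a`.
  refine ⟨√(1 - ((j * π + π / 2) / K) ^ 2), sqrt_pos.2 (by nlinarith), fun a ha => ?_⟩
  obtain ⟨hb, h⟩ := rootAngle_spec ha hj
  set t := rootAngle K j a
  have hs0 : 0 < sin t := sin_pos_of_pos_of_lt_pi hb.1.1 (by linarith [hb.1.2])
  have hc0 : 0 < cos t := cos_pos_of_mem_Ioo ⟨by linarith [hb.1.1], hb.1.2⟩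
  have hcos : √(1 - ((j * π + π / 2) / K) ^ 2) ≤ cos t := by
    rw [cos_eq_sqrt_one_sub_sin_sq (by linarith [hb.1.1]) hb.1.2.le]
    have : sin t ≤ (j * π + π / 2) / K := (le_div_iff₀ hK).2 (by linarith [hb.2.2])
    exact sqrt_le_sqrt (by nlinarith)
  have key := sin_eq_exp_mul_cos (j := j) h
  set u := K * sin t + t - (j * π + π / 2) with hu
  have hu1 : -(π / 2) < u := by linarith [hb.2.1, hb.1.1]
  have hu2 : u < π / 2 := by linarith [hb.2.2, hb.1.2]
  have hZ : 0 < cos (K * sin t - j * π - t) :=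
    cos_pos_of_mem_Ioo ⟨by linarith [hb.2.1, hb.1.2], by linarith [hb.2.2, hb.1.1]⟩
  have hsu : 0 < sin u := by rw [key]; positivity
  have hu0 : 0 < u := by
    by_contra! hle
    exact absurd hsu (not_lt.2 (sin_nonpos_of_nonpos_of_neg_pi_le hle (by linarith)))
  have hδ : 0 < t - t₀ := by
    by_contra! hle
    have : sin t ≤ sin t₀ :=
      sin_le_sin_of_le_of_le_pi_div_two (by linarith [hb.1.1]) ht₀.2.le (by linarith)
    nlinarith
  refine ⟨hδ, ?_⟩
  have hsin : sin t₀ ≤ sin t :=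
    sin_le_sin_of_le_of_le_pi_div_two (by linarith [ht₀.1]) hb.1.2.le (by linarith)
  -- Here `u = K (sin t - sin t₀) + (t - t₀)` with a non-negative first term; Jordan's inequality
  -- then bounds `u` by `π / 2 * sin u`.
  have hδu : t - t₀ ≤ u := by nlinarith
  have hjordan := mul_le_sin hu0.le hu2.le
  have hle : sin u ≤ exp (-(2 * a * √(1 - ((j * π + π / 2) / K) ^ 2))) := by
    rw [key]
    calc _ ≤ exp (-(2 * a * cos t)) * 1 :=
          mul_le_mul_of_nonneg_left (cos_le_one _) (exp_pos _).le
      _ ≤ _ := by rw [mul_one]; gcongr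
  calc t - t₀ ≤ u := hδu
    _ = π / 2 * (2 / π * u) := by field_simp
    _ ≤ π / 2 * sin u := by gcongr
    _ ≤ _ := by gcongr

theorem tendsto_mul_exp_neg {c : ℝ} (hc : 0 < c) :
    Tendsto (fun a : ℝ => a * exp (-(a * c))) atTop (𝓝 0) := by
  have h := (tendsto_pow_mul_exp_neg_atTop_nhds_zero 1).comp
    (tendsto_id.atTop_mul_const hc : Tendsto (fun a : ℝ => a * c) atTop atTop)
  have h2 := h.mul_const (c⁻¹)
  rw [zero_mul] at h2
  refine h2.congr fun a => ?_
  simp only [Function.comp, pow_one]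
  field_simp

/-- The factor `a` matters: it is what permits replacing `exp (-2 a cos t)` by `exp (-2 a cos t₀)`.
-/
theorem tendsto_rootAngle {K t₀ : ℝ} {j : ℕ} (hj : j * π + π / 2 < K)
    (ht₀ : t₀ ∈ Ioo 0 (π / 2)) (h₀ : K * sin t₀ + t₀ = j * π + π / 2) :
    Tendsto (fun a => a * (rootAngle K j a - t₀)) atTop (𝓝 0) ∧
      Tendsto (rootAngle K j) atTop (𝓝 t₀) := by
  obtain ⟨c, hc, h⟩ := rootAngle_sub_mem hj ht₀ h₀
  have h1 : Tendsto (fun a => a * (rootAngle K j a - t₀)) atTop (𝓝 0) := by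
    have lim := (tendsto_mul_exp_neg (mul_pos two_pos hc)).const_mul (π / 2)
    rw [mul_zero] at lim
    refine squeeze_zero' ?_ ?_ lim
    · filter_upwards [eventually_gt_atTop 0] with a ha using mul_nonneg ha.le (h a ha).1.le
    · filter_upwards [eventually_gt_atTop 0] with a ha
      calc a * (rootAngle K j a - t₀) ≤ a * (π / 2 * exp (-(2 * a * c))) :=
            mul_le_mul_of_nonneg_left (h a ha).2 ha.le
        _ = _ := by rw [show 2 * a * c = a * (2 * c) by ring]; ring
  refine ⟨h1, ?_⟩
  have h2 : Tendsto (fun a => rootAngle K j a - t₀) atTop (𝓝 0) := by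
    refine squeeze_zero' ?_ ?_ h1
    · filter_upwards [eventually_gt_atTop 0] with a ha using (h a ha).1.le
    · filter_upwards [eventually_ge_atTop 1] with a ha
      exact le_mul_of_one_le_left (h a (by linarith)).1.le ha
  simpa using h2.add_const t₀

/-- The coefficient of the first exponentially small correction of the limit angle. -/
def angleCoeff (K t₀ : ℝ) : ℝ := sin (2 * t₀) / (1 + K * cos t₀)

theorem angleCoeff_pos {K t₀ : ℝ} (hK : 0 < K) (ht₀ : t₀ ∈ Ioo 0 (π / 2)) :
    0 < angleCoeff K t₀ := by
  have : 0 < cos t₀ := cos_pos_of_mem_Ioo ⟨by linarith [ht₀.1, pi_pos], ht₀.2⟩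
  have : 0 < sin (2 * t₀) := sin_pos_of_pos_of_lt_pi (by linarith [ht₀.1]) (by linarith [ht₀.2])
  unfold angleCoeff; positivity

/-- Dividing the exact identity by `D(t) = W(t) / (t - t₀)` gives the fixed-point form `t - t₀ = B
exp(η) R(t)`. Here `R = Z / D` is differentiable at `t₀` with value `angleCoeff`, and `η` accounts
for freezing `cos t` at `t₀` in the exponent. First `t - t₀ = O(B)`, then `η = O(a B)`, and
substituting back gives the error `O(a B²)`. -/
theorem rootAngle_sub_isBigO {K t₀ : ℝ} {j : ℕ} (hj : j * π + π / 2 < K)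
    (ht₀ : t₀ ∈ Ioo 0 (π / 2)) (h₀ : K * sin t₀ + t₀ = j * π + π / 2) :
    (fun a => rootAngle K j a - t₀ - angleCoeff K t₀ * exp (-(2 * a * cos t₀))) =O[atTop]
      fun a => a * exp (-(2 * a * cos t₀)) ^ 2 := by
  obtain ⟨haδ, hT⟩ := tendsto_rootAngle hj ht₀ h₀
  obtain ⟨c, hc, hbd⟩ := rootAngle_sub_mem hj ht₀ h₀
  have hpi := pi_pos
  have hK : 0 < K := lt_trans (by positivity) hj
  have hc0 : 0 < cos t₀ := cos_pos_of_mem_Ioo ⟨by linarith [ht₀.1, pi_pos], ht₀.2⟩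
  set T := rootAngle K j
  set W : ℝ → ℝ := fun t => sin (K * sin t + t - (j * π + π / 2)) with hW
  set Z : ℝ → ℝ := fun t => cos (K * sin t - j * π - t) with hZ
  have hW0 : W t₀ = 0 := by simp [hW, h₀]
  have hZ0 : Z t₀ = sin (2 * t₀) := by
    simp only [hZ]
    rw [show K * sin t₀ - j * π - t₀ = π / 2 - 2 * t₀ by linarith, cos_pi_div_two_sub]
  have dW : HasDerivAt W (1 + K * cos t₀) t₀ := by
    have := ((((hasDerivAt_sin t₀).const_mul K).add (hasDerivAt_id t₀)).sub_const
      (j * π + π / 2)).sin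
    convert! this using 1
    simp only [Pi.add_apply, id, h₀, sub_self, cos_zero]
    ring
  have hW_an : AnalyticAt ℝ W t₀ := by
    have : ContDiff ℝ ⊤ W := by unfold W; fun_prop
    exact this.contDiffAt.analyticAt
  set D := dslope W t₀ with hD
  have hD0 : D t₀ = 1 + K * cos t₀ := by rw [hD, dslope_same, dW.deriv]
  have hD_diff : DifferentiableAt ℝ D t₀ := by
    obtain ⟨p, hp⟩ := hW_an
    exact hp.has_fpower_series_dslope_fslope.analyticAt.differentiableAt
  have hw : 0 < 1 + K * cos t₀ := by positivity
  have hZ_diff : DifferentiableAt ℝ Z t₀ := by unfold Z; fun_prop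
  set R : ℝ → ℝ := fun t => Z t / D t with hR
  have hR_diff : DifferentiableAt ℝ R t₀ := hZ_diff.div hD_diff (by rw [hD0]; exact hw.ne')
  have hR0 : R t₀ = angleCoeff K t₀ := by simp only [hR, hZ0, hD0, angleCoeff]
  have hRT : Tendsto (fun a => R (T a)) atTop (𝓝 (R t₀)) := hR_diff.continuousAt.tendsto.comp hT
  have hDT : ∀ᶠ a in atTop, D (T a) ≠ 0 := by
    have : Tendsto (fun a => D (T a)) atTop (𝓝 (D t₀)) := hD_diff.continuousAt.tendsto.comp hT
    exact this.eventually_ne (by rw [hD0]; exact hw.ne')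
  set B : ℝ → ℝ := fun a => exp (-(2 * a * cos t₀)) with hB
  set η : ℝ → ℝ := fun a => 2 * a * (cos t₀ - cos (T a)) with hη
  have hη_O : η =O[atTop] fun a => a * (T a - t₀) := by
    have : (fun a => cos (T a) - cos t₀) =O[atTop] fun a => T a - t₀ :=
      (hasDerivAt_cos t₀).isBigO_sub.comp_tendsto hT
    have h2 := ((isBigO_refl (fun a : ℝ => a) atTop).mul this.neg_left).const_mul_left 2
    refine h2.congr_left fun a => ?_
    simp only [hη]; ring
  have hη0 : Tendsto η atTop (𝓝 0) := hη_O.trans_tendsto haδ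
  have hexp : (fun a => exp (η a) - 1) =O[atTop] fun a => a * (T a - t₀) := by
    have : (fun a => exp (η a) - exp 0) =O[atTop] fun a => η a - 0 :=
      (hasDerivAt_exp 0).isBigO_sub.comp_tendsto hη0
    simp only [exp_zero, sub_zero] at this
    exact this.trans hη_O
  have hfix : (fun a => T a - t₀) =ᶠ[atTop] fun a => B a * (exp (η a) * R (T a)) := by
    filter_upwards [eventually_gt_atTop 0, hDT] with a ha hDa
    have key := sin_eq_exp_mul_cos (j := j) (rootAngle_spec ha hj).2
    change W (T a) = exp (-(2 * a * cos (T a))) * Z (T a) at key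
    have hsl : (T a - t₀) * D (T a) = W (T a) := by
      have := sub_smul_dslope W t₀ (T a)
      rw [hW0, sub_zero, smul_eq_mul] at this
      exact this
    have hBη : exp (-(2 * a * cos (T a))) = B a * exp (η a) := by
      simp only [hB, hη]; rw [← exp_add]; ring_nf
    rw [key, hBη] at hsl
    simp only [hR]
    field_simp
    linarith
  have hδB : (fun a => T a - t₀) =O[atTop] B := by
    refine hfix.trans_isBigO ?_
    have h1 : Tendsto (fun a => exp (η a) * R (T a)) atTop (𝓝 (exp 0 * R t₀)) :=
      ((continuous_exp.tendsto 0).comp hη0).mul hRT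
    simpa using (isBigO_refl B atTop).mul (h1.isBigO_one ℝ)
  have haδB : (fun a => a * (T a - t₀)) =O[atTop] fun a => a * B a :=
    (isBigO_refl (fun a : ℝ => a) atTop).mul hδB
  have hone : (fun _ : ℝ => (1 : ℝ)) =O[atTop] fun a : ℝ => a :=
    (isLittleO_const_id_atTop (1 : ℝ)).isBigO
  have hRδ : (fun a => R (T a) - R t₀) =O[atTop] fun a => a * B a := by
    have h1 : (fun a => R (T a) - R t₀) =O[atTop] fun a => T a - t₀ :=
      hR_diff.hasDerivAt.isBigO_sub.comp_tendsto hT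
    refine h1.trans (hδB.trans ?_)
    simpa using hone.mul (isBigO_refl B atTop)
  have hfac : (fun a => (exp (η a) - 1) * R (T a) + (R (T a) - R t₀)) =O[atTop]
      fun a => a * B a := by
    refine IsBigO.add ?_ hRδ
    simpa using (hexp.trans haδB).mul (hRT.isBigO_one ℝ)
  have hfin := (isBigO_refl B atTop).mul hfac
  refine (IsBigO.congr' hfin ?_ ?_)
  · filter_upwards [hfix] with a ha
    rw [ha, ← hR0]
    ring
  · exact Eventually.of_forall fun a => by simp only [hB]; ring

/-- With `β = exp (-(a cos t₀))` the previous error is `O(a β⁴)`, and `a β → 0`. -/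
theorem rootAngle_sub_isLittleO {K t₀ : ℝ} {j : ℕ} (hj : j * π + π / 2 < K)
    (ht₀ : t₀ ∈ Ioo 0 (π / 2)) (h₀ : K * sin t₀ + t₀ = j * π + π / 2) :
    (fun a => rootAngle K j a - t₀ - angleCoeff K t₀ * exp (-(2 * a * cos t₀))) =o[atTop]
      fun a => exp (-(a * cos t₀)) ^ 3 := by
  have hc0 : 0 < cos t₀ := cos_pos_of_mem_Ioo ⟨by linarith [ht₀.1, pi_pos], ht₀.2⟩
  refine (rootAngle_sub_isBigO hj ht₀ h₀).trans_isLittleO ?_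
  have h1 : (fun a => a * exp (-(a * cos t₀))) =o[atTop] fun _ => (1 : ℝ) :=
    (isLittleO_one_iff ℝ).2 (tendsto_mul_exp_neg hc0)
  have := h1.mul_isBigO (isBigO_refl (fun a : ℝ => exp (-(a * cos t₀)) ^ 3) atTop)
  refine this.congr (fun a => ?_) (fun a => one_mul _)
  rw [show -(2 * a * cos t₀) = -(a * cos t₀) + -(a * cos t₀) by ring, exp_add]
  ring

theorem tendsto_cos_rootAngle_sub_div {K t₀ : ℝ} {j : ℕ} (hj : j * π + π / 2 < K)
    (ht₀ : t₀ ∈ Ioo 0 (π / 2)) (h₀ : K * sin t₀ + t₀ = j * π + π / 2) :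
    Tendsto (fun a => (cos (rootAngle K j a) - cos t₀) / exp (-(2 * a * cos t₀))) atTop
      (𝓝 (-sin t₀ * angleCoeff K t₀)) := by
  have hc0 : 0 < cos t₀ := cos_pos_of_mem_Ioo ⟨by linarith [ht₀.1, pi_pos], ht₀.2⟩
  obtain ⟨haδ, hT⟩ := tendsto_rootAngle hj ht₀ h₀
  have hslope : Tendsto (fun a => dslope cos t₀ (rootAngle K j a)) atTop (𝓝 (-sin t₀)) := by
    have h1 : ContinuousAt (dslope cos t₀) t₀ := continuousAt_dslope_same.2 differentiableAt_cos
    have h2 := h1.tendsto.comp hT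
    rwa [dslope_same, (hasDerivAt_cos t₀).deriv] at h2
  have hδ : Tendsto (fun a => (rootAngle K j a - t₀) / exp (-(2 * a * cos t₀))) atTop
      (𝓝 (angleCoeff K t₀)) := by
    have h1 : (fun a => rootAngle K j a - t₀ - angleCoeff K t₀ * exp (-(2 * a * cos t₀)))
        =o[atTop] fun a => exp (-(2 * a * cos t₀)) := by
      refine (rootAngle_sub_isBigO hj ht₀ h₀).trans_isLittleO ?_
      have h2 : (fun a => a * exp (-(a * (2 * cos t₀)))) =o[atTop] fun _ => (1 : ℝ) :=
        (isLittleO_one_iff ℝ).2 (tendsto_mul_exp_neg (by positivity))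
      have := h2.mul_isBigO (isBigO_refl (fun a : ℝ => exp (-(2 * a * cos t₀))) atTop)
      refine this.congr (fun a => ?_) (fun a => one_mul _)
      rw [show a * (2 * cos t₀) = 2 * a * cos t₀ by ring]; ring
    have h3 := (h1.tendsto_div_nhds_zero).add_const (angleCoeff K t₀)
    rw [zero_add] at h3
    refine h3.congr fun a => ?_
    have := (exp_pos (-(2 * a * cos t₀))).ne'
    field_simp
    ring
  refine (hslope.mul hδ).congr fun a => ?_
  rw [← sub_smul_dslope cos t₀, smul_eq_mul]
  ring

/-! ### The limit frequencies -/

theorem limitFreq_asymptotics (κ₀ : ℕ) :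
    ∃ (α₀ : Fin κ₀ → ℝ) (α₂ : ℝ → ℝ), ∀ j : Fin κ₀,
      α₀ j ∈ Ioo (0 : ℝ) (1 / 2) ∧
      sin (π * α₀ j) = (((j : ℕ) : ℝ) + 1 - 1 / 2 - α₀ j) / ((κ₀ : ℝ) + 1 / 4) ∧
      α₂ (α₀ j) ≠ 0 ∧
      ∃ ρ : ℝ → ℝ,
        ρ =o[atTop] (fun E =>
          exp ((((κ₀ : ℝ) + 1 / 4) * π - E) * cos (π * α₀ j)) ^ 3) ∧
        ∀ᶠ E in atTop,
          limitFreq κ₀ E j =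
            E * cos (π * (α₀ j + α₂ (α₀ j) *
              exp ((((κ₀ : ℝ) + 1 / 4) * π - E) * cos (π * α₀ j)) ^ 2 + ρ E)) := by
  choose t ht h using fun j : Fin κ₀ => exists_limit_angle (branch_top_lt_wellProduct j)
  have hK := wellProduct_pos κ₀
  have hpi := pi_pos
  -- `α₂` is one function of the limit value alone; the index `j` enters only through `α₀ j`.
  refine ⟨fun j => t j / π, fun x => angleCoeff (wellProduct κ₀) (π * x) / π, fun j => ?_⟩
  have hp : π * (t j / π) = t j := by field_simp
  have hKdef : ((κ₀ : ℝ) + 1 / 4) * π = wellProduct κ₀ := rfl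
  simp only [hp]
  have hd : Tendsto (fun E : ℝ => E - wellProduct κ₀) atTop atTop :=
    tendsto_atTop_add_const_right _ _ tendsto_id
  refine ⟨⟨div_pos (ht j).1 hpi, ?_⟩, ?_, ?_, fun E =>
    (rootAngle (wellProduct κ₀) j (E - wellProduct κ₀) - t j -
      angleCoeff (wellProduct κ₀) (t j) * exp (-(2 * (E - wellProduct κ₀) * cos (t j)))) / π,
    ?_, ?_⟩
  · rw [div_lt_iff₀ hpi]; linarith [(ht j).2]
  · have hj := h j
    unfold wellProduct at hj
    field_simp
    field_simp at hj
    linear_combination hj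
  · exact (div_pos (angleCoeff_pos hK (ht j)) hpi).ne'
  · have := ((rootAngle_sub_isLittleO (branch_top_lt_wellProduct j) (ht j) (h j)).comp_tendsto
      hd).const_mul_left (1 / π)
    refine this.congr (fun E => ?_) (fun E => ?_)
    · simp only [Function.comp]; ring
    · simp only [Function.comp, hKdef]; ring_nf
  · filter_upwards [eventually_gt_atTop (wellProduct κ₀)] with E hE
    rw [limitFreq_eq hE, hKdef]
    congr 2
    have : exp ((wellProduct κ₀ - E) * cos (t j)) ^ 2
        = exp (-(2 * (E - wellProduct κ₀) * cos (t j))) := by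
      rw [← exp_nat_mul]; push_cast; ring_nf
    rw [this]
    field_simp
    ring

theorem limitAngle_lt {K t₁ t₂ : ℝ} {i j : ℕ} (hK : 0 < K) (hij : i < j)
    (ht₁ : t₁ ∈ Ioo 0 (π / 2)) (ht₂ : t₂ ∈ Ioo 0 (π / 2))
    (h₁ : K * sin t₁ + t₁ = i * π + π / 2) (h₂ : K * sin t₂ + t₂ = j * π + π / 2) : t₁ < t₂ := by
  by_contra! hle
  have hs : sin t₂ ≤ sin t₁ :=
    sin_le_sin_of_le_of_le_pi_div_two (by linarith [ht₂.1, pi_pos]) ht₁.2.le hle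
  have hij' : (i : ℝ) < j := by exact_mod_cast hij
  nlinarith [pi_pos]

/-- Let `J` be the largest index with `c J ≠ 0`. The limit angles increase with the index, so `cos
(t J)` is the smallest rate and the correction of index `J` decays slowest. Subtracting the limit of
the relation and dividing by that correction leaves `c J` times a nonzero constant. -/
theorem eq_zero_of_sum_cos_rootAngle_eq_zero {K : ℝ} {n : ℕ}
    (hn : ∀ j : Fin n, ((j : ℕ) : ℝ) * π + π / 2 < K) {c : Fin n → ℝ}
    (hc : ∀ a > 0, ∑ j, c j * cos (rootAngle K j a) = 0) : c = 0 := by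
  by_contra hne
  obtain ⟨j₀, hj₀⟩ : ∃ j, c j ≠ 0 := by
    by_contra! hall
    exact hne (funext hall)
  have hK : 0 < K := lt_trans (by have := pi_pos; positivity) (hn j₀)
  choose t ht h using fun j : Fin n => exists_limit_angle (hn j)
  obtain ⟨J, hJ, hmax⟩ := (Finset.univ.filter fun j => c j ≠ 0).exists_max_image id
    ⟨j₀, by simp [hj₀]⟩
  have hJ0 : c J ≠ 0 := (Finset.mem_filter.1 hJ).2
  -- The constant terms must cancel among themselves before the exponentially small ones can be
  -- compared.
  have hlim0 : ∑ j, c j * cos (t j) = 0 := by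
    have h1 : Tendsto (fun a => ∑ j, c j * cos (rootAngle K j a)) atTop (𝓝 (∑ j, c j * cos (t j))) :=
      tendsto_finsetSum _ fun j _ =>
        ((continuous_cos.tendsto _).comp (tendsto_rootAngle (hn j) (ht j) (h j)).2).const_mul _
    have h2 : Tendsto (fun a => ∑ j, c j * cos (rootAngle K j a)) atTop (𝓝 0) :=
      tendsto_const_nhds.congr' (by
        filter_upwards [eventually_gt_atTop 0] with a ha using (hc a ha).symm)
    exact tendsto_nhds_unique h1 h2
  set B : Fin n → ℝ → ℝ := fun j a => exp (-(2 * a * cos (t j))) with hB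
  have hterm : ∀ j, Tendsto (fun a => c j * ((cos (rootAngle K j a) - cos (t j)) / B J a)) atTop
      (𝓝 (if j = J then c J * (-sin (t J) * angleCoeff K (t J)) else 0)) := by
    intro j
    have hj := tendsto_cos_rootAngle_sub_div (hn j) (ht j) (h j)
    split_ifs with hjJ
    · subst hjJ; exact hj.const_mul _
    · by_cases hcj : c j = 0
      · simp [hcj]
      · have hlt : j < J := lt_of_le_of_ne (hmax j (by simp [hcj])) hjJ
        have htlt := limitAngle_lt hK (Fin.lt_def.1 hlt) (ht j) (ht J) (h j) (h J)
        have hcos : cos (t J) < cos (t j) :=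
          cos_lt_cos_of_nonneg_of_le_pi_div_two (ht j).1.le (ht J).2.le htlt
        have hratio : Tendsto (fun a => B j a / B J a) atTop (𝓝 0) := by
          have h1 : Tendsto (fun a : ℝ => -(a * (2 * (cos (t j) - cos (t J))))) atTop atBot :=
            tendsto_neg_atTop_atBot.comp (tendsto_id.atTop_mul_const (by linarith))
          refine (tendsto_exp_atBot.comp h1).congr fun a => ?_
          simp only [hB, Function.comp, ← exp_sub]
          ring_nf
        have h2 := (hj.mul hratio).const_mul (c j)
        rw [mul_zero, mul_zero] at h2
        refine h2.congr fun a => ?_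
        have : B j a ≠ 0 := (exp_pos _).ne'
        change c j * ((cos (rootAngle K j a) - cos (t j)) / B j a * (B j a / B J a)) = _
        field_simp
  have hsum := tendsto_finsetSum Finset.univ fun j (_ : j ∈ Finset.univ) => hterm j
  rw [Finset.sum_ite_eq' Finset.univ J, if_pos (Finset.mem_univ J)] at hsum
  have hzero : Tendsto (fun a => ∑ j, c j * ((cos (rootAngle K j a) - cos (t j)) / B J a)) atTop
      (𝓝 0) := by
    refine tendsto_const_nhds.congr' ?_
    filter_upwards [eventually_gt_atTop 0] with a ha
    have : ∑ j, c j * ((cos (rootAngle K j a) - cos (t j)) / B J a)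
        = (∑ j, c j * cos (rootAngle K j a) - ∑ j, c j * cos (t j)) / B J a := by
      rw [← Finset.sum_sub_distrib, Finset.sum_div]
      exact Finset.sum_congr rfl fun j _ => by ring
    rw [this, hc a ha, hlim0]; simp
  have hfin := tendsto_nhds_unique hsum hzero
  have hsin : 0 < sin (t J) :=
    sin_pos_of_pos_of_lt_pi (ht J).1 (by linarith [(ht J).2, pi_pos])
  have hcoef := angleCoeff_pos hK (ht J)
  exact (mul_ne_zero hJ0 (mul_ne_zero (neg_ne_zero.2 hsin.ne') hcoef.ne')) hfin

/-- After division by `E`, a vanishing combination is analytic in `a = E - K` on the connected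
half-line `a > 0`, so the identity theorem carries it from `[E₁, E₂]` to `a → ∞`. -/
theorem nonDegenerateOn_limitFreq {κ₀ : ℕ} {E₁ E₂ : ℝ} (hE₁ : wellProduct κ₀ < E₁)
    (h12 : E₁ < E₂) : NonDegenerateOn (limitFreq κ₀) E₁ E₂ := by
  intro c hc
  by_contra! hall
  refine hc (eq_zero_of_sum_cos_rootAngle_eq_zero (K := wellProduct κ₀)
    branch_top_lt_wellProduct fun a ha => ?_)
  set f : ℝ → ℝ := fun a => ∑ j : Fin κ₀, c j * cos (rootAngle (wellProduct κ₀) j a) with hf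
  have han : AnalyticOnNhd ℝ f (Ioi 0) := fun a ha =>
    Finset.analyticAt_fun_sum _ fun j _ =>
      analyticAt_const.mul
        (analyticAt_cos.comp (analyticAt_rootAngle ha (branch_top_lt_wellProduct j)))
  set m := (E₁ + E₂) / 2 - wellProduct κ₀ with hm
  refine han.eqOn_zero_of_preconnected_of_eventuallyEq_zero isPreconnected_Ioi (z₀ := m)
    (by simp only [mem_Ioi, hm]; linarith) ?_ ha
  have hnhds : Ioo (E₁ - wellProduct κ₀) (E₂ - wellProduct κ₀) ∈ 𝓝 m :=
    Ioo_mem_nhds (by simp only [hm]; linarith) (by simp only [hm]; linarith)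
  filter_upwards [hnhds] with b hb
  have hE : wellProduct κ₀ < b + wellProduct κ₀ := by linarith [hb.1]
  have h0 := hall (b + wellProduct κ₀) ⟨by linarith [hb.1], by linarith [hb.2]⟩
  have hpos : 0 < b + wellProduct κ₀ := (wellProduct_pos κ₀).trans hE
  have : (b + wellProduct κ₀) * f b = 0 := by
    rw [← h0, hf, Finset.mul_sum]
    refine Finset.sum_congr rfl fun j _ => ?_
    rw [limitFreq_eq hE, add_sub_cancel_right]; ring
  exact (mul_eq_zero.1 this).resolve_left hpos.ne'

/-! ### The derivatives of the profile -/

theorem profile_pos (m : ℕ) (z : ℝ) : 0 < profile m z := by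
  have := cosh_pos z; have := cosh_pos 1
  unfold profile; positivity

theorem profile_le_one (m : ℕ) (z : ℝ) : profile m z ≤ 1 := by
  have := cosh_pos z; have := cosh_pos 1
  unfold profile
  exact inv_le_one_of_one_le₀ (le_add_of_nonneg_left (by positivity))

theorem one_sub_profile (m : ℕ) (z : ℝ) :
    1 - profile m z = (cosh z / cosh 1) ^ m * profile m z := by
  have := cosh_pos z; have := cosh_pos 1
  have : (cosh z / cosh 1) ^ m + 1 ≠ 0 := by positivity
  unfold profile; field_simp; ring

theorem one_sub_profile_le (m : ℕ) (z : ℝ) : 1 - profile m z ≤ (cosh z / cosh 1) ^ m := by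
  have := cosh_pos z; have := cosh_pos 1
  rw [one_sub_profile]
  exact mul_le_of_le_one_right (by positivity) (profile_le_one m z)

theorem profile_le (m : ℕ) (z : ℝ) : profile m z ≤ (cosh 1 / cosh z) ^ m := by
  have := cosh_pos z; have := cosh_pos 1
  unfold profile
  rw [← inv_div (cosh z), inv_pow]
  exact inv_anti₀ (by positivity) (by linarith)

theorem continuous_profile (m : ℕ) : Continuous (profile m) := by
  unfold profile
  refine Continuous.inv₀ (by fun_prop) fun z => ?_
  have := cosh_pos z; have := cosh_pos 1
  positivity

theorem profile_neg (m : ℕ) (z : ℝ) : profile m (-z) = profile m z := by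
  simp [profile]

theorem hasDerivAt_profile (m : ℕ) (z : ℝ) :
    HasDerivAt (profile m) (-(m * tanh z * (1 - profile m z) * profile m z)) z := by
  have hz := cosh_pos z
  have h1 := cosh_pos 1
  have hne : (cosh z / cosh 1) ^ m + 1 ≠ 0 := by positivity
  have h := ((((hasDerivAt_cosh z).div_const (cosh 1)).pow m).add_const 1).inv hne
  have e : profile m = fun z => ((cosh z / cosh 1) ^ m + 1)⁻¹ := rfl
  rw [e]
  convert! h using 1
  change -(m * tanh z * (1 - profile m z) * profile m z) = _
  rw [one_sub_profile, tanh_eq_sinh_div_cosh]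
  unfold profile
  rcases m with _ | m
  · simp
  · simp only [Nat.add_sub_cancel, Pi.pow_apply, pow_succ]
    field_simp

theorem hasDerivAt_tanh (z : ℝ) : HasDerivAt tanh (1 - tanh z * tanh z) z := by
  have hz := cosh_pos z
  have h := (hasDerivAt_sinh z).div (hasDerivAt_cosh z) hz.ne'
  have e : tanh = sinh / cosh := by funext z; exact tanh_eq_sinh_div_cosh z
  rw [← e] at h
  convert! h using 1
  rw [tanh_eq_sinh_div_cosh]
  field_simp

theorem abs_tanh_le_one (z : ℝ) : |tanh z| ≤ 1 := by
  have hz := cosh_pos z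
  rw [tanh_eq_sinh_div_cosh, abs_div, abs_of_pos hz, div_le_one hz]
  exact abs_le_of_sq_le_sq (by linarith [cosh_sq z]) hz.le

/-- The algebra of functions of `(m, z)` generated by `m`, `tanh z` and `h_m(z)`. -/
def profileAlg : Subalgebra ℝ (ℕ → ℝ → ℝ) :=
  Algebra.adjoin ℝ {(fun (m : ℕ) _ => (m : ℝ)), (fun _ z => tanh z), profile}

theorem natCast_mem_profileAlg : (fun (m : ℕ) _ => (m : ℝ)) ∈ profileAlg :=
  Algebra.subset_adjoin (by simp [mem_insert_iff])

theorem tanh_mem_profileAlg : (fun _ z => tanh z) ∈ profileAlg :=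
  Algebra.subset_adjoin (by simp [mem_insert_iff])

theorem profile_mem_profileAlg : profile ∈ profileAlg :=
  Algebra.subset_adjoin (by simp [mem_insert_iff])

/-- Closure under differentiation comes from `tanh' = 1 - tanh²` and `h' = -m tanh (1 - h) h`. -/
theorem exists_hasDerivAt_of_mem_profileAlg {f : ℕ → ℝ → ℝ} (hf : f ∈ profileAlg) :
    ∃ f' ∈ profileAlg, ∀ m z, HasDerivAt (f m) (f' m z) z := by
  unfold profileAlg at hf
  induction hf using Algebra.adjoin_induction with
  | mem x hx =>
    rcases hx with rfl | rfl | rfl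
    · exact ⟨0, zero_mem _, fun m z => hasDerivAt_const _ _⟩
    · exact ⟨_, sub_mem (one_mem _) (mul_mem tanh_mem_profileAlg tanh_mem_profileAlg),
        fun m z => hasDerivAt_tanh z⟩
    · exact ⟨_, neg_mem (mul_mem (mul_mem (mul_mem natCast_mem_profileAlg tanh_mem_profileAlg)
        (sub_mem (one_mem _) profile_mem_profileAlg)) profile_mem_profileAlg),
        fun m z => hasDerivAt_profile m z⟩
  | algebraMap r => exact ⟨0, zero_mem _, fun m z => hasDerivAt_const _ _⟩
  | add f g _ _ hf hg =>
    obtain ⟨f', hf', df⟩ := hf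
    obtain ⟨g', hg', dg⟩ := hg
    exact ⟨f' + g', add_mem hf' hg', fun m z => (df m z).add (dg m z)⟩
  | mul f g hfm hgm hf hg =>
    obtain ⟨f', hf', df⟩ := hf
    obtain ⟨g', hg', dg⟩ := hg
    exact ⟨f' * g + f * g', add_mem (mul_mem hf' hgm) (mul_mem hfm hg'),
      fun m z => (df m z).mul (dg m z)⟩

theorem exists_bound_of_mem_profileAlg {f : ℕ → ℝ → ℝ} (hf : f ∈ profileAlg) :
    ∃ (C : ℝ) (k : ℕ), ∀ m z, |f m z| ≤ C * ((m : ℝ) + 1) ^ k := by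
  unfold profileAlg at hf
  induction hf using Algebra.adjoin_induction with
  | mem x hx =>
    rcases hx with rfl | rfl | rfl
    · refine ⟨1, 1, fun m z => ?_⟩
      rw [abs_of_nonneg (Nat.cast_nonneg m)]; linarith
    · exact ⟨1, 0, fun m z => by simpa using abs_tanh_le_one z⟩
    · refine ⟨1, 0, fun m z => ?_⟩
      rw [abs_of_pos (profile_pos m z)]; simpa using profile_le_one m z
  | algebraMap r => exact ⟨|r|, 0, fun m z => by simp⟩
  | add f g _ _ hf hg =>
    obtain ⟨C, k, hf⟩ := hf
    obtain ⟨D, n, hg⟩ := hg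
    refine ⟨|C| + |D|, k + n, fun m z => ?_⟩
    have h1 : (1 : ℝ) ≤ (m : ℝ) + 1 := by linarith [(Nat.cast_nonneg m : (0 : ℝ) ≤ m)]
    have b1 : C * ((m : ℝ) + 1) ^ k ≤ |C| * ((m : ℝ) + 1) ^ (k + n) :=
      mul_le_mul (le_abs_self C) (pow_le_pow_right₀ h1 (by omega)) (by positivity) (abs_nonneg _)
    have b2 : D * ((m : ℝ) + 1) ^ n ≤ |D| * ((m : ℝ) + 1) ^ (k + n) :=
      mul_le_mul (le_abs_self D) (pow_le_pow_right₀ h1 (by omega)) (by positivity) (abs_nonneg _)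
    calc |f m z + g m z| ≤ |f m z| + |g m z| := abs_add_le _ _
      _ ≤ _ := by linarith [hf m z, hg m z]
  | mul f g _ _ hf hg =>
    obtain ⟨C, k, hf⟩ := hf
    obtain ⟨D, n, hg⟩ := hg
    refine ⟨C * D, k + n, fun m z => ?_⟩
    calc |f m z * g m z| = |f m z| * |g m z| := abs_mul _ _
      _ ≤ (C * ((m : ℝ) + 1) ^ k) * (D * ((m : ℝ) + 1) ^ n) :=
        mul_le_mul (hf m z) (hg m z) (abs_nonneg _) ((abs_nonneg _).trans (hf m z))
      _ = _ := by ring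

/-- The factor `1 - h` survives differentiation, since its derivative `m tanh (1 - h) h` contains it
again. It supplies the decay `q^m` inside `(-1, 1)`, against which the polynomial growth in `m` of
the other factor is negligible. -/
theorem exists_iteratedDeriv_profile_eq (k : ℕ) :
    ∃ f ∈ profileAlg, ∀ m, iteratedDeriv (k + 1) (profile m) =
      fun z => (1 - profile m z) * f m z := by
  induction k with
  | zero =>
    refine ⟨_, neg_mem (mul_mem (mul_mem natCast_mem_profileAlg tanh_mem_profileAlg)
      profile_mem_profileAlg), fun m => ?_⟩
    funext z
    rw [zero_add, iteratedDeriv_one, (hasDerivAt_profile m z).deriv]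
    simp only [Pi.neg_apply, Pi.mul_apply]; ring
  | succ k ih =>
    obtain ⟨f, hf, e⟩ := ih
    obtain ⟨f', hf', df⟩ := exists_hasDerivAt_of_mem_profileAlg hf
    refine ⟨_, add_mem hf' (mul_mem (mul_mem (mul_mem natCast_mem_profileAlg tanh_mem_profileAlg)
      profile_mem_profileAlg) hf), fun m => ?_⟩
    funext z
    rw [iteratedDeriv_succ, e]
    have := (((hasDerivAt_profile m z).const_sub 1).mul (df m z)).deriv
    refine this.trans ?_
    simp only [Pi.add_apply, Pi.mul_apply]; ring

theorem exists_bound_iteratedDeriv_profile (k : ℕ) {ρ : ℝ} (hρ : |ρ| < 1) :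
    ∃ b : ℕ → ℝ, Tendsto b atTop (𝓝 0) ∧ ∀ m z, |z| ≤ |ρ| →
      |iteratedDeriv (k + 1) (profile m) z| ≤ b m := by
  obtain ⟨f, hf, e⟩ := exists_iteratedDeriv_profile_eq k
  obtain ⟨C, n, hC⟩ := exists_bound_of_mem_profileAlg hf
  have h1 := cosh_pos 1
  have hρ0 := cosh_pos ρ
  set q := cosh ρ / cosh 1 with hq
  have hq0 : 0 < q := by positivity
  have hq1 : q < 1 := by
    rw [hq, div_lt_one h1, cosh_lt_cosh, abs_one]; exact hρ
  refine ⟨fun m => q ^ m * (C * ((m : ℝ) + 1) ^ n), ?_, fun m z hz => ?_⟩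
  · have h := (tendsto_pow_const_mul_const_pow_of_abs_lt_one n
      (by rwa [abs_of_pos hq0] : |q| < 1)).comp (tendsto_add_atTop_nat 1)
    have h2 := h.const_mul (C / q)
    rw [mul_zero] at h2
    refine h2.congr fun m => ?_
    simp only [Function.comp]
    push_cast
    rw [pow_succ]
    field_simp
  · rw [e, abs_mul, abs_of_nonneg (by linarith [profile_le_one m z])]
    refine mul_le_mul ((one_sub_profile_le m z).trans ?_) (hC m z) (abs_nonneg _) (by positivity)
    have hz' : cosh z ≤ cosh ρ := cosh_le_cosh.2 hz
    have := cosh_pos z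
    exact pow_le_pow_left₀ (by positivity) (by rw [hq]; gcongr) m

/-! ### Bounded families of polynomials -/

variable {ι : Type*} {l : Filter ι}

/-- All derivatives of the polynomials `P i` are bounded on bounded sets, eventually uniformly
in `i`. -/
def PolyBdd (l : Filter ι) (P : ι → Polynomial ℝ) : Prop :=
  ∀ (k : ℕ) (R : ℝ), ∃ C : ℝ, ∀ᶠ i in l, ∀ x, |x| ≤ R →
    |(Polynomial.derivative^[k] (P i)).eval x| ≤ C

theorem PolyBdd.C {a : ι → ℝ} {M : ℝ} (ha : ∀ᶠ i in l, |a i| ≤ M) :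
    PolyBdd l fun i => Polynomial.C (a i) := by
  intro k R
  refine ⟨M, ha.mono fun i hi x _ => ?_⟩
  rcases Nat.eq_zero_or_pos k with rfl | hk
  · simpa using hi
  · rw [Polynomial.iterate_derivative_C hk]; simpa using (abs_nonneg _).trans hi

theorem PolyBdd.X : PolyBdd l fun _ => (Polynomial.X : Polynomial ℝ) := by
  intro k R
  refine ⟨max R 1, Eventually.of_forall fun i x hx => ?_⟩
  rcases k with _ | _ | k
  · simpa using Or.inl hx
  · simp
  · rw [Function.iterate_succ_apply, Polynomial.derivative_X, Function.iterate_succ_apply,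
      Polynomial.derivative_one, Polynomial.iterate_derivative_zero]
    simp

theorem PolyBdd.sub {P Q : ι → Polynomial ℝ} (hP : PolyBdd l P) (hQ : PolyBdd l Q) :
    PolyBdd l fun i => P i - Q i := by
  intro k R
  obtain ⟨C, hC⟩ := hP k R
  obtain ⟨D, hD⟩ := hQ k R
  refine ⟨C + D, ?_⟩
  filter_upwards [hC, hD] with i h1 h2 x hx
  rw [Polynomial.iterate_derivative_sub, Polynomial.eval_sub]
  exact (abs_sub _ _).trans (add_le_add (h1 x hx) (h2 x hx))

theorem PolyBdd.mul {P Q : ι → Polynomial ℝ} (hP : PolyBdd l P) (hQ : PolyBdd l Q) :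
    PolyBdd l fun i => P i * Q i := by
  intro k R
  choose C hC using fun n => hP n R
  choose D hD using fun n => hQ n R
  refine ⟨∑ n ∈ Finset.range k.succ, (k.choose n : ℝ) * (C (k - n) * D n), ?_⟩
  have h1 : ∀ᶠ i in l, ∀ n ∈ Finset.range k.succ, ∀ x, |x| ≤ R →
      |(Polynomial.derivative^[k - n] (P i)).eval x| ≤ C (k - n) :=
    (Finset.eventually_all _).2 fun n _ => hC (k - n)
  have h2 : ∀ᶠ i in l, ∀ n ∈ Finset.range k.succ, ∀ x, |x| ≤ R →
      |(Polynomial.derivative^[n] (Q i)).eval x| ≤ D n :=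
    (Finset.eventually_all _).2 fun n _ => hD n
  filter_upwards [h1, h2] with i h1 h2 x hx
  rw [Polynomial.iterate_derivative_mul, Polynomial.eval_finsetSum]
  refine (Finset.abs_sum_le_sum_abs _ _).trans (Finset.sum_le_sum fun n hn => ?_)
  rw [nsmul_eq_mul, Polynomial.eval_mul, Polynomial.eval_natCast, Polynomial.eval_mul, abs_mul,
    abs_mul, Nat.abs_cast]
  refine mul_le_mul_of_nonneg_left ?_ (Nat.cast_nonneg _)
  exact mul_le_mul (h1 n hn x hx) (h2 n hn x hx) (abs_nonneg _)
    ((abs_nonneg _).trans (h1 n hn x hx))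

theorem PolyBdd.one : PolyBdd l fun _ => (1 : Polynomial ℝ) := by
  simpa using PolyBdd.C (l := l) (a := fun _ => 1) (M := 1) (by simp)

theorem PolyBdd.pow {P : ι → Polynomial ℝ} (hP : PolyBdd l P) (n : ℕ) :
    PolyBdd l fun i => P i ^ n := by
  induction n with
  | zero => simpa using PolyBdd.one
  | succ n ih => simpa only [pow_succ] using ih.mul hP

theorem PolyBdd.prod {σ : Type*} (s : Finset σ) {P : σ → ι → Polynomial ℝ}
    (hP : ∀ j, PolyBdd l (P j)) : PolyBdd l fun i => ∏ j ∈ s, P j i := by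
  classical
  induction s using Finset.induction_on with
  | empty => simpa using PolyBdd.one
  | insert j s hj ih => simpa only [Finset.prod_insert hj] using (hP j).mul ih

/-! ### The corrector is small -/

section Corrector

variable {κ₀ : ℕ} {m : ι → ℕ} {T : ι → ℝ} {z : ι → Fin κ₀ → ℝ}

theorem polyBdd_hermiteBasis (S : ℕ) {T₁ : ℝ} (hT : ∀ᶠ i in l, |T i| ≤ T₁) {ρ : ℝ}
    (hz : ∀ j, ∀ᶠ i in l, |signedNode (z i) j| ≤ ρ) (j : Fin κ₀ ⊕ Fin κ₀) (n : ℕ) :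
    PolyBdd l fun i => hermiteBasis S (T i) (z i) j n := by
  have hnode : ∀ j, PolyBdd l fun i => Polynomial.X - Polynomial.C (signedNode (z i) j) :=
    fun j => PolyBdd.X.sub (PolyBdd.C (hz j))
  have hT2 : ∀ᶠ i in l, |T i ^ 2| ≤ T₁ ^ 2 := hT.mono fun i hi => by
    rw [abs_pow]; exact pow_le_pow_left₀ (abs_nonneg _) hi 2
  unfold hermiteBasis nodeWeight
  exact ((PolyBdd.C (Eventually.of_forall fun _ => le_rfl)).mul ((hnode j).pow _)).mul
    ((((PolyBdd.X.pow 2).sub (PolyBdd.C hT2)).pow _).mul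
      (PolyBdd.prod _ fun j' => (hnode j').pow _))

/-- The divisor in the recursion stays away from zero: the nodes lie in `(-1, 1)` while `T ≥ T₀ >
1`, and distinct nodes are at least `d` apart. -/
theorem exists_le_abs_eval_nodeWeight (S : ℕ) {T₀ : ℝ} (hT₀ : 1 < T₀)
    (hT : ∀ᶠ i in l, T₀ ≤ T i) {ρ : ℝ} (hρ : ρ < 1)
    (hz : ∀ j, ∀ᶠ i in l, |signedNode (z i) j| ≤ ρ) {d : ℝ} (hd : 0 < d)
    (hsep : ∀ j j', j ≠ j' → ∀ᶠ i in l, d ≤ |signedNode (z i) j - signedNode (z i) j'|)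
    (j : Fin κ₀ ⊕ Fin κ₀) :
    ∃ c > 0, ∀ᶠ i in l, c ≤ |(nodeWeight S (T i) (z i) j).eval (signedNode (z i) j)| := by
  have hd2 : 0 < T₀ ^ 2 - 1 := by nlinarith
  refine ⟨(T₀ ^ 2 - 1) ^ (2 * S) * ∏ _j' ∈ Finset.univ.erase j, d ^ (2 * S),
    mul_pos (pow_pos hd2 _) (Finset.prod_pos fun _ _ => pow_pos hd _), ?_⟩
  have hsep' : ∀ᶠ i in l, ∀ j' ∈ Finset.univ.erase j,
      d ≤ |signedNode (z i) j - signedNode (z i) j'| :=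
    (Finset.eventually_all _).2 fun j' hj' => hsep j j' (Finset.ne_of_mem_erase hj').symm
  filter_upwards [hT, hz j, hsep'] with i h1 h2 h3
  simp only [nodeWeight, Polynomial.eval_mul, Polynomial.eval_pow, Polynomial.eval_sub,
    Polynomial.eval_X, Polynomial.eval_C, Polynomial.eval_prod, abs_mul, abs_pow, Finset.abs_prod]
  refine mul_le_mul (pow_le_pow_left₀ hd2.le ?_ _) (Finset.prod_le_prod
    (fun _ _ => (pow_pos hd _).le) fun j' hj' => pow_le_pow_left₀ hd.le (h3 j' hj') _)
    (Finset.prod_nonneg fun _ _ => (pow_pos hd _).le) (by positivity)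
  have hs : signedNode (z i) j ^ 2 ≤ 1 := by
    rw [← sq_abs]; nlinarith [abs_nonneg (signedNode (z i) j)]
  rw [abs_sub_comm]
  refine le_trans ?_ (le_abs_self _)
  nlinarith

/-- Induction along the triangular system: the derivative of `h_m` at the node tends to `0`, the
earlier coefficients tend to `0` and meet bounded derivatives of the basis, and the divisor is
bounded below. -/
theorem tendsto_hermiteCoeff (S : ℕ) (hm : Tendsto m l atTop) {T₀ T₁ : ℝ} (hT₀ : 1 < T₀)
    (hT : ∀ᶠ i in l, T₀ ≤ T i) (hT' : ∀ᶠ i in l, |T i| ≤ T₁) {ρ : ℝ} (hρ0 : 0 ≤ ρ) (hρ : ρ < 1)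
    (hz : ∀ j, ∀ᶠ i in l, |signedNode (z i) j| ≤ ρ) {d : ℝ} (hd : 0 < d)
    (hsep : ∀ j j', j ≠ j' → ∀ᶠ i in l, d ≤ |signedNode (z i) j - signedNode (z i) j'|)
    (j : Fin κ₀ ⊕ Fin κ₀) (n : ℕ) :
    Tendsto (fun i => hermiteCoeff (m i) S (T i) (z i) j n) l (𝓝 0) := by
  induction n using Nat.strong_induction_on with
  | _ n ih =>
    obtain ⟨c, hc, hlow⟩ := exists_le_abs_eval_nodeWeight S hT₀ hT hρ hz hd hsep j
    obtain ⟨b, hb, hbd⟩ := exists_bound_iteratedDeriv_profile (2 * n)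
      (show |ρ| < 1 by rwa [abs_of_nonneg hρ0])
    have h1 : Tendsto (fun i => iteratedDeriv (2 * n + 1) (profile (m i)) (signedNode (z i) j))
        l (𝓝 0) := by
      refine squeeze_zero_norm' ?_ (hb.comp hm)
      filter_upwards [hz j] with i hi
      exact hbd (m i) _ (by rwa [abs_of_nonneg hρ0])
    have h2 : Tendsto (fun i => ∑ k : Fin n, hermiteCoeff (m i) S (T i) (z i) j k *
        (Polynomial.derivative^[2 * n + 1] (hermiteBasis S (T i) (z i) j k)).eval
          (signedNode (z i) j)) l (𝓝 (∑ _k : Fin n, 0)) := by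
      refine tendsto_finsetSum _ fun k _ => ?_
      obtain ⟨C, hC⟩ := polyBdd_hermiteBasis S hT' hz j k (2 * n + 1) ρ
      refine (isLittleO_one_iff ℝ).1 ?_
      have hO : (fun i => (Polynomial.derivative^[2 * n + 1]
          (hermiteBasis S (T i) (z i) j k)).eval (signedNode (z i) j)) =O[l] fun _ => (1 : ℝ) := by
        refine IsBigO.of_bound C ?_
        filter_upwards [hC, hz j] with i h1 h2
        simpa using h1 _ h2
      simpa using ((isLittleO_one_iff ℝ).2 (ih k k.2)).mul_isBigO hO
    have h3 := (h1.neg.sub h2).abs.div_const c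
    simp only [Finset.sum_const_zero, neg_zero, sub_zero, abs_zero, zero_div] at h3
    refine squeeze_zero_norm' ?_ h3
    filter_upwards [hlow] with i hi
    rw [hermiteCoeff, Real.norm_eq_abs, abs_div]
    exact div_le_div_of_nonneg_left (abs_nonneg _) hc hi

theorem exists_bound_corrector (S : ℕ) (hm : Tendsto m l atTop) {T₀ T₁ : ℝ} (hT₀ : 1 < T₀)
    (hT : ∀ᶠ i in l, T₀ ≤ T i) (hT' : ∀ᶠ i in l, |T i| ≤ T₁) {ρ : ℝ} (hρ0 : 0 ≤ ρ) (hρ : ρ < 1)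
    (hz : ∀ j, ∀ᶠ i in l, |signedNode (z i) j| ≤ ρ) {d : ℝ} (hd : 0 < d)
    (hsep : ∀ j j', j ≠ j' → ∀ᶠ i in l, d ≤ |signedNode (z i) j - signedNode (z i) j'|)
    (R : ℝ) :
    ∃ b : ι → ℝ, Tendsto b l (𝓝 0) ∧ ∀ᶠ i in l, ∀ x, |x| ≤ R →
      |(corrector (m i) S (T i) (z i)).eval x| ≤ b i := by
  choose C hC using fun (j : Fin κ₀ ⊕ Fin κ₀) (n : ℕ) => polyBdd_hermiteBasis S hT' hz j n 0 R
  refine ⟨fun i => ∑ j, ∑ n ∈ Finset.range S, |hermiteCoeff (m i) S (T i) (z i) j n| * C j n,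
    ?_, ?_⟩
  · have : Tendsto (fun i => ∑ j, ∑ n ∈ Finset.range S,
        |hermiteCoeff (m i) S (T i) (z i) j n| * C j n) l
        (𝓝 (∑ j : Fin κ₀ ⊕ Fin κ₀, ∑ n ∈ Finset.range S, |0| * C j n)) :=
      tendsto_finsetSum _ fun j _ => tendsto_finsetSum _ fun n _ =>
        (tendsto_hermiteCoeff S hm hT₀ hT hT' hρ0 hρ hz hd hsep j n).abs.mul_const _
    simpa using this
  · have hall : ∀ᶠ i in l, ∀ j ∈ (Finset.univ : Finset (Fin κ₀ ⊕ Fin κ₀)),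
        ∀ n ∈ Finset.range S, ∀ x, |x| ≤ R →
        |(Polynomial.derivative^[0] (hermiteBasis S (T i) (z i) j n)).eval x| ≤ C j n :=
      (Finset.eventually_all _).2 fun j _ => (Finset.eventually_all _).2 fun n _ => hC j n
    filter_upwards [hall] with i hi x hx
    rw [corrector, Polynomial.eval_finsetSum]
    refine (Finset.abs_sum_le_sum_abs _ _).trans (Finset.sum_le_sum fun j hj => ?_)
    rw [Polynomial.eval_finsetSum]
    refine (Finset.abs_sum_le_sum_abs _ _).trans (Finset.sum_le_sum fun n hn => ?_)
    rw [Polynomial.eval_mul, Polynomial.eval_C, abs_mul]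
    exact mul_le_mul_of_nonneg_left (hi j hj n hn x hx) (abs_nonneg _)

end Corrector

/-! ### Symmetry of the potential -/

section Symmetry

variable {κ₀ : ℕ}

theorem signedNode_swap (z : Fin κ₀ → ℝ) (j : Fin κ₀ ⊕ Fin κ₀) :
    signedNode z j.swap = -signedNode z j := by
  rcases j with p | p <;> simp [signedNode]

theorem iterate_derivative_comp_neg_X (p : Polynomial ℝ) (k : ℕ) :
    Polynomial.derivative^[k] (p.comp (-Polynomial.X))
      = (-1) ^ k * (Polynomial.derivative^[k] p).comp (-Polynomial.X) := by
  induction k generalizing p with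
  | zero => simp
  | succ k ih =>
    rw [Function.iterate_succ_apply, Polynomial.derivative_comp, Polynomial.derivative_neg,
      Polynomial.derivative_X, neg_one_mul, Polynomial.iterate_derivative_neg, ih,
      Function.iterate_succ_apply, pow_succ]
    ring

theorem nodeWeight_swap_comp (S : ℕ) (T : ℝ) (z : Fin κ₀ → ℝ) (j : Fin κ₀ ⊕ Fin κ₀) :
    (nodeWeight S T z j.swap).comp (-Polynomial.X) = nodeWeight S T z j := by
  unfold nodeWeight
  simp only [Polynomial.mul_comp, Polynomial.pow_comp, Polynomial.sub_comp, Polynomial.X_comp,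
    Polynomial.C_comp, Polynomial.prod_comp, neg_sq]
  congr 1
  refine Finset.prod_bij' (fun i _ => i.swap) (fun i _ => i.swap) ?_ ?_ ?_ ?_ ?_
  · intro i hi
    simp only [Finset.mem_erase, Finset.mem_univ, and_true] at hi ⊢
    exact fun h => hi (by rw [← h, Sum.swap_swap])
  · intro i hi
    simp only [Finset.mem_erase, Finset.mem_univ, and_true] at hi ⊢
    exact fun h => hi (by simpa using congrArg Sum.swap h)
  · intro i _; simp
  · intro i _; simp
  · intro i _
    rw [signedNode_swap, pow_mul, pow_mul]
    congr 1
    rw [map_neg]; ring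

theorem hermiteBasis_swap_comp (S : ℕ) (T : ℝ) (z : Fin κ₀ → ℝ) (j : Fin κ₀ ⊕ Fin κ₀) (n : ℕ) :
    (hermiteBasis S T z j.swap n).comp (-Polynomial.X) = -hermiteBasis S T z j n := by
  unfold hermiteBasis
  rw [Polynomial.mul_comp, Polynomial.mul_comp, nodeWeight_swap_comp, Polynomial.pow_comp,
    Polynomial.sub_comp, Polynomial.X_comp, Polynomial.C_comp, Polynomial.C_comp, signedNode_swap,
    map_neg]
  have : (-Polynomial.X - -Polynomial.C (signedNode z j)) ^ (2 * n + 1)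
      = -(Polynomial.X - Polynomial.C (signedNode z j)) ^ (2 * n + 1) := by
    rw [← Odd.neg_pow ⟨n, rfl⟩]; ring
  rw [this]; ring

/-- Odd derivatives of the even function `h_m` change sign under reflection, and so does each basis
polynomial. Coefficients and basis thus both flip, which makes the corrector even, as the spectral
characterization requires of the potential. -/
theorem hermiteCoeff_swap (m S : ℕ) (T : ℝ) (z : Fin κ₀ → ℝ) (j : Fin κ₀ ⊕ Fin κ₀) (n : ℕ) :
    hermiteCoeff m S T z j.swap n = -hermiteCoeff m S T z j n := by
  induction n using Nat.strong_induction_on with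
  | _ n ih =>
    rw [hermiteCoeff, hermiteCoeff]
    have hw : (nodeWeight S T z j.swap).eval (signedNode z j.swap)
        = (nodeWeight S T z j).eval (signedNode z j) := by
      rw [← nodeWeight_swap_comp S T z j, Polynomial.eval_comp, signedNode_swap]; simp
    have hh : iteratedDeriv (2 * n + 1) (profile m) (signedNode z j.swap)
        = -iteratedDeriv (2 * n + 1) (profile m) (signedNode z j) := by
      have h1 := iteratedDeriv_comp_neg (2 * n + 1) (profile m) (signedNode z j)
      simp only [profile_neg, smul_eq_mul] at h1
      rw [signedNode_swap, h1, Odd.neg_one_pow ⟨n, rfl⟩]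
      ring
    have hb : ∀ k, (Polynomial.derivative^[2 * n + 1] (hermiteBasis S T z j.swap k)).eval
        (signedNode z j.swap)
        = (Polynomial.derivative^[2 * n + 1] (hermiteBasis S T z j k)).eval (signedNode z j) := by
      intro k
      have h1 := iterate_derivative_comp_neg_X (hermiteBasis S T z j.swap k) (2 * n + 1)
      rw [hermiteBasis_swap_comp, Polynomial.iterate_derivative_neg, Odd.neg_one_pow ⟨n, rfl⟩] at h1
      have h2 := congrArg (Polynomial.eval (signedNode z j)) h1
      simp only [Polynomial.eval_neg, Polynomial.eval_mul, Polynomial.eval_one,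
        Polynomial.eval_comp, Polynomial.eval_X] at h2
      rw [signedNode_swap]
      linarith
    have hs : ∑ k : Fin n, hermiteCoeff m S T z j.swap k *
        (Polynomial.derivative^[2 * n + 1] (hermiteBasis S T z j.swap k)).eval
          (signedNode z j.swap) = -∑ k : Fin n, hermiteCoeff m S T z j k *
        (Polynomial.derivative^[2 * n + 1] (hermiteBasis S T z j k)).eval (signedNode z j) := by
      rw [← Finset.sum_neg_distrib]
      refine Finset.sum_congr rfl fun k _ => ?_
      rw [ih k k.2, hb]; ring
    rw [hw, hh, hs]
    ring

theorem eval_corrector_neg (m S : ℕ) (T : ℝ) (z : Fin κ₀ → ℝ) (x : ℝ) :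
    (corrector m S T z).eval (-x) = (corrector m S T z).eval x := by
  simp only [corrector, Polynomial.eval_finsetSum, Polynomial.eval_mul, Polynomial.eval_C]
  rw [← (Equiv.sumComm (Fin κ₀) (Fin κ₀)).sum_comp]
  refine Finset.sum_congr rfl fun j _ => Finset.sum_congr rfl fun n _ => ?_
  have h := congrArg (Polynomial.eval x) (hermiteBasis_swap_comp S T z j n)
  simp only [Polynomial.eval_comp, Polynomial.eval_neg, Polynomial.eval_X] at h
  rw [Equiv.sumComm_apply, hermiteCoeff_swap, h]
  ring

theorem potential_neg (m S : ℕ) (T : ℝ) (yp : Fin κ₀ → ℝ) (E y : ℝ) :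
    potential m S T yp E (-y) = potential m S T yp E y := by
  simp only [potential, neg_div, profile_neg, eval_corrector_neg]

theorem continuous_potential (m S : ℕ) (T : ℝ) (yp : Fin κ₀ → ℝ) (E : ℝ) :
    Continuous (potential m S T yp E) := by
  unfold potential
  have h1 : Continuous fun y => profile m (y / halfWidth κ₀ E) :=
    (continuous_profile m).comp (by fun_prop)
  have h2 : Continuous fun y => (corrector m S T fun p => yp p / halfWidth κ₀ E).eval
      (y / halfWidth κ₀ E) := (Polynomial.continuous _).comp (by fun_prop)
  fun_prop

end Symmetry

/-! ### Stability of non-degeneracy -/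

/-- Annihilating vectors along a subsequence can be normalized to the unit sphere, where a limit
point would annihilate `g`. Pointwise convergence in `E` is enough, as the limit vector is tested at
a single `E`. -/
theorem NonDegenerateOn.eventually_of_tendsto {n : ℕ} {f : ℕ → ℝ → Fin n → ℝ} {g : ℝ → Fin n → ℝ}
    {E₁ E₂ : ℝ} (hg : NonDegenerateOn g E₁ E₂)
    (h : ∀ E ∈ Icc E₁ E₂, ∀ j, Tendsto (fun m => f m E j) atTop (𝓝 (g E j))) :
    ∀ᶠ m in atTop, NonDegenerateOn (f m) E₁ E₂ := by
  by_contra hcon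
  obtain ⟨φ, hφ, hdeg⟩ := extraction_of_frequently_atTop (not_eventually.1 hcon)
  have hc : ∀ k, ∃ c ∈ Metric.sphere (0 : Fin n → ℝ) 1, ∀ E ∈ Icc E₁ E₂,
      ∑ j, c j * f (φ k) E j = 0 := by
    intro k
    have hk := hdeg k
    unfold NonDegenerateOn at hk
    push Not at hk
    obtain ⟨c, hc0, hc⟩ := hk
    have hn : ‖c‖ ≠ 0 := norm_ne_zero_iff.2 hc0
    refine ⟨‖c‖⁻¹ • c, by simp [norm_smul, hn], fun E hE => ?_⟩
    have : ∑ j, (‖c‖⁻¹ • c) j * f (φ k) E j = ‖c‖⁻¹ * ∑ j, c j * f (φ k) E j := by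
      rw [Finset.mul_sum]
      exact Finset.sum_congr rfl fun j _ => by simp [mul_assoc]
    rw [this, hc E hE, mul_zero]
  choose c hcs hcz using hc
  obtain ⟨c₀, hc₀, ψ, hψ, hlim⟩ := (isCompact_sphere (0 : Fin n → ℝ) 1).tendsto_subseq hcs
  have hc₀0 : c₀ ≠ 0 := by
    rintro rfl
    simp at hc₀
  obtain ⟨E, hE, hne⟩ := hg c₀ hc₀0
  refine hne ?_
  have h1 : Tendsto (fun k => ∑ j, c (ψ k) j * f (φ (ψ k)) E j) atTop (𝓝 (∑ j, c₀ j * g E j)) :=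
    tendsto_finsetSum _ fun j _ => ((tendsto_pi_nhds.1 hlim) j).mul
      ((h E hE j).comp (hφ.tendsto_atTop.comp hψ.tendsto_atTop))
  refine tendsto_nhds_unique h1 ?_
  simp only [hcz _ E hE]
  exact tendsto_const_nhds

/-! ### Frequencies from Prüfer angles -/

theorem wellFreq_spec {Q : ℝ → ℝ} (hQ : Continuous Q) (heven : ∀ y, Q (-y) = Q y) {E : ℝ}
    (hE : 0 < E) {n : ℕ} (hbot : prueferEnd Q (-E ^ 2) < π) (htop : n * π < prueferEnd Q 0)
    {j : ℕ} (hj : j < n) :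
    wellFreq Q j ∈ Ioo 0 E ∧ prueferEnd Q (-wellFreq Q j ^ 2) = (j + 1) * π ∧
      IsNthSmallest (evenDirichletSpectrum Q) j (-wellFreq Q j ^ 2) := by
  have hadm := isAdmissible_of_continuous hQ
  have hiff : ∀ {x}, IsNthSmallest (evenDirichletSpectrum Q) j x ↔
      prueferEnd Q x = (j + 1) * π := fun {x} => by
    rw [evenDirichletSpectrum_eq hQ heven]
    exact isNthSmallest_iff hadm.strictMono hadm.continuous hadm.prueferEnd_pos hbot
  have hjn : (j : ℝ) + 1 ≤ n := by exact_mod_cast hj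
  have hpi := pi_pos
  obtain ⟨μ, -, hμ⟩ : ((j : ℝ) + 1) * π ∈ prueferEnd Q '' Icc (-E ^ 2) 0 :=
    intermediate_value_Icc (by nlinarith [sq_nonneg E]) hadm.continuous.continuousOn
      ⟨by nlinarith [(Nat.cast_nonneg j : (0 : ℝ) ≤ j)], by nlinarith⟩
  have hspec : IsNthSmallest (evenDirichletSpectrum Q) j
      (Classical.epsilon (IsNthSmallest (evenDirichletSpectrum Q) j)) :=
    Classical.epsilon_spec (p := IsNthSmallest (evenDirichletSpectrum Q) j) ⟨μ, hiff.2 hμ⟩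
  have hε := hiff.1 hspec
  unfold wellFreq
  set ε := Classical.epsilon (IsNthSmallest (evenDirichletSpectrum Q) j)
  have h0 : ε < 0 := hadm.strictMono.lt_iff_lt.1 (by rw [hε]; nlinarith)
  have h1 : -E ^ 2 < ε := hadm.strictMono.lt_iff_lt.1 (by
    rw [hε]; nlinarith [(Nat.cast_nonneg j : (0 : ℝ) ≤ j)])
  have hsq : -√(-ε) ^ 2 = ε := by rw [sq_sqrt (by linarith)]; ring
  rw [hsq]
  exact ⟨⟨sqrt_pos.2 (by linarith), (sqrt_lt' hE).2 (by linarith)⟩, hε, hspec⟩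

/-! ### Convergence of the regularized well to the square well -/

/-- The base of the exponential rate at which `h_m(z)` approaches the indicator of `(-1, 1)`. -/
def contrast (z : ℝ) : ℝ := min (cosh z / cosh 1) (cosh 1 / cosh z)

theorem continuous_contrast : Continuous contrast := by
  unfold contrast
  exact Continuous.min (by fun_prop) (Continuous.div (by fun_prop) (by fun_prop)
    fun z => (cosh_pos z).ne')

theorem contrast_pos (z : ℝ) : 0 < contrast z := by
  have := cosh_pos z; have := cosh_pos 1
  exact lt_min (by positivity) (by positivity)

theorem contrast_le_one (z : ℝ) : contrast z ≤ 1 := by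
  have hz := cosh_pos z; have h1 := cosh_pos 1
  rcases le_total (cosh z) (cosh 1) with h | h
  · exact (min_le_left _ _).trans ((div_le_one h1).2 h)
  · exact (min_le_right _ _).trans ((div_le_one hz).2 h)

theorem contrast_lt_one {z : ℝ} (h0 : 0 ≤ z) (h : z ≠ 1) : contrast z < 1 := by
  have hz := cosh_pos z; have h1 := cosh_pos 1
  rcases lt_or_gt_of_ne h with h | h
  · refine (min_le_left _ _).trans_lt ((div_lt_one h1).2 (cosh_lt_cosh.2 ?_))
    rwa [abs_one, abs_of_nonneg h0]
  · refine (min_le_right _ _).trans_lt ((div_lt_one hz).2 (cosh_lt_cosh.2 ?_))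
    rwa [abs_one, abs_of_nonneg h0]

theorem one_sub_profile_le_contrast_pow (m : ℕ) {z : ℝ} (h0 : 0 ≤ z) (h : z ≤ 1) :
    1 - profile m z ≤ contrast z ^ m := by
  have hz := cosh_pos z; have h1 := cosh_pos 1
  have hle : cosh z ≤ cosh 1 := cosh_le_cosh.2 (by rwa [abs_one, abs_of_nonneg h0])
  have : contrast z = cosh z / cosh 1 :=
    min_eq_left (((div_le_one h1).2 hle).trans ((one_le_div hz).2 hle))
  rw [this]
  exact one_sub_profile_le m z

theorem profile_le_contrast_pow (m : ℕ) {z : ℝ} (h : 1 ≤ z) :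
    profile m z ≤ contrast z ^ m := by
  have hz := cosh_pos z; have h1 := cosh_pos 1
  have hle : cosh 1 ≤ cosh z := cosh_le_cosh.2 (by rwa [abs_one, abs_of_nonneg (by linarith)])
  have : contrast z = cosh 1 / cosh z :=
    min_eq_right (((div_le_one hz).2 hle).trans ((one_le_div h1).2 hle))
  rw [this]
  exact profile_le m z

/-- Dominated convergence: the base is below `1` except at `z = 1`, the edge of the well. -/
theorem tendsto_integral_contrast_pow {R : ℝ} (hR : 0 ≤ R) :
    Tendsto (fun m : ℕ => ∫ z in (0 : ℝ)..R, contrast z ^ m) atTop (𝓝 0) := by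
  have h := intervalIntegral.tendsto_integral_filter_of_dominated_convergence (μ := MeasureTheory.volume)
    (a := 0) (b := R) (l := atTop) (F := fun (m : ℕ) z => contrast z ^ m) (f := fun _ => 0)
    (fun _ => 1)
    (Eventually.of_forall fun m => (continuous_contrast.pow m).aestronglyMeasurable)
    (Eventually.of_forall fun m => Eventually.of_forall fun z _ => by
      rw [Real.norm_eq_abs, abs_of_pos (pow_pos (contrast_pos z) m)]
      exact pow_le_one₀ (contrast_pos z).le (contrast_le_one z))
    intervalIntegrable_const
    (by
      have hne : ∀ᵐ z : ℝ, z ≠ 1 := by simp [MeasureTheory.ae_iff]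
      filter_upwards [hne] with z hz hzR
      rw [uIoc_of_le hR] at hzR
      exact tendsto_pow_atTop_nhds_zero_of_lt_one (contrast_pos z).le
        (contrast_lt_one hzR.1.le hz))
  simpa using h

theorem abs_step_sub_potential_le {κ₀ m S : ℕ} {T E : ℝ} {yp : Fin κ₀ → ℝ}
    (hE : wellProduct κ₀ < E) {b : ℝ}
    (hb : ∀ x, |x| ≤ (halfWidth κ₀ E)⁻¹ →
      |(corrector m S T fun p => yp p / halfWidth κ₀ E).eval x| ≤ b) :
    ∀ y ∈ Ico (0 : ℝ) 1, |step (halfWidth κ₀ E) (-E ^ 2) 0 y - potential m S T yp E y|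
      ≤ E ^ 2 * (contrast (y / halfWidth κ₀ E) ^ m + b) := by
  intro y hy
  have hr := halfWidth_mem_Ioo hE
  set r := halfWidth κ₀ E
  have hg := hb (y / r) (by
    rw [abs_of_nonneg (div_nonneg hy.1 hr.1.le), div_eq_mul_inv]
    exact mul_le_of_le_one_left (inv_nonneg.2 hr.1.le) hy.2.le)
  have hp := profile_pos m (y / r)
  have hp1 := profile_le_one m (y / r)
  unfold potential step
  change |_ - -E ^ 2 * (profile m (y / r) + (corrector m S T fun p => yp p / r).eval (y / r))| ≤ _
  set g := (corrector m S T fun p => yp p / r).eval (y / r)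
  split_ifs with h
  · have hc := one_sub_profile_le_contrast_pow m (div_nonneg hy.1 hr.1.le)
      ((div_le_one hr.1).2 h.le)
    have e : -E ^ 2 - -E ^ 2 * (profile m (y / r) + g) = -(E ^ 2 * ((1 - profile m (y / r)) - g)) := by
      ring
    rw [e, abs_neg, abs_mul, abs_of_nonneg (sq_nonneg E)]
    refine mul_le_mul_of_nonneg_left ((abs_sub _ _).trans (add_le_add ?_ hg)) (sq_nonneg E)
    rwa [abs_of_nonneg (by linarith)]
  · have hc := profile_le_contrast_pow m ((one_le_div hr.1).2 (not_lt.1 h))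
    have e : 0 - -E ^ 2 * (profile m (y / r) + g) = E ^ 2 * (profile m (y / r) + g) := by ring
    rw [e, abs_mul, abs_of_nonneg (sq_nonneg E)]
    refine mul_le_mul_of_nonneg_left ((abs_add_le _ _).trans (add_le_add ?_ hg)) (sq_nonneg E)
    rwa [abs_of_pos hp]

theorem abs_prueferEnd_step_sub_le {κ₀ m S : ℕ} {T E : ℝ} {yp : Fin κ₀ → ℝ}
    (hE : wellProduct κ₀ < E) {b : ℝ}
    (hb : ∀ x, |x| ≤ (halfWidth κ₀ E)⁻¹ →
      |(corrector m S T fun p => yp p / halfWidth κ₀ E).eval x| ≤ b) (μ : ℝ) :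
    |prueferEnd (step (halfWidth κ₀ E) (-E ^ 2) 0) μ - prueferEnd (potential m S T yp E) μ| ≤
      exp (1 + E ^ 2 + |μ|) *
        (E ^ 2 * ((∫ z in (0 : ℝ)..(halfWidth κ₀ E)⁻¹, contrast z ^ m) + b)) := by
  have hr := halfWidth_mem_Ioo hE
  have hdiff := abs_step_sub_potential_le hE hb
  set r := halfWidth κ₀ E
  have hcp : Continuous fun z => contrast z ^ m := continuous_contrast.pow m
  have hJ : ∀ u, HasDerivAt (fun u => ∫ z in (0 : ℝ)..u, contrast z ^ m) (contrast u ^ m) u :=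
    fun u => intervalIntegral.integral_hasDerivAt_right (hcp.intervalIntegrable _ _)
      hcp.aestronglyMeasurable.stronglyMeasurableAtFilter hcp.continuousAt
  -- The primitive of the pointwise bound, after the substitution `z = y / r`.
  set I : ℝ → ℝ := fun y => E ^ 2 * (r * (∫ z in (0 : ℝ)..(y / r), contrast z ^ m) + b * y) with hI
  have hId : ∀ y, HasDerivAt I (E ^ 2 * (contrast (y / r) ^ m + b)) y := by
    intro y
    have h1 : HasDerivAt (fun y : ℝ => y / r) (1 / r) y := (hasDerivAt_id y).div_const r
    have h2 := (hJ (y / r)).comp y h1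
    have h3 := ((h2.const_mul r).add ((hasDerivAt_id y).const_mul b)).const_mul (E ^ 2)
    convert! h3 using 1
    have := hr.1.ne'
    field_simp
  have hM : ∀ y ∈ Ico (0 : ℝ) 1, |1 + step r (-E ^ 2) 0 y| ≤ 1 + E ^ 2 := by
    intro y _
    unfold step
    split_ifs
    · rw [abs_le]; constructor <;> nlinarith [sq_nonneg E]
    · rw [add_zero, abs_one]; nlinarith [sq_nonneg E]
  have key := (isAdmissible_step hr (-E ^ 2) 0).abs_prueferEnd_sub_le
    (isAdmissible_of_continuous (continuous_potential m S T yp E)) hM (I := I)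
    (fun y _ => (hId y).continuousAt.continuousWithinAt) (by simp [hI])
    (fun y _ => (hId y).hasDerivWithinAt) hdiff μ
  refine key.trans (mul_le_mul_of_nonneg_left ?_ (exp_pos _).le)
  simp only [hI, one_div, mul_one]
  refine mul_le_mul_of_nonneg_left (add_le_add_left ?_ b) (sq_nonneg E)
  refine mul_le_of_le_one_left ?_ hr.2.le
  exact intervalIntegral.integral_nonneg (inv_nonneg.2 hr.1.le)
    fun z _ => (pow_pos (contrast_pos z) m).le

/-- The limits of the interpolation nodes. -/
def limitNode (κ₀ : ℕ) (j : Fin κ₀ ⊕ Fin κ₀) : ℝ :=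
  signedNode (fun p : Fin κ₀ => (((p : ℕ) : ℝ) + 1) * π / wellProduct κ₀) j

theorem exists_int_limitNode (κ₀ : ℕ) : ∃ n : Fin κ₀ ⊕ Fin κ₀ → ℤ, Function.Injective n ∧
    ∀ j, limitNode κ₀ j = n j * (π / wellProduct κ₀) ∧ |n j| ≤ κ₀ := by
  refine ⟨Sum.elim (fun p => ((p : ℕ) : ℤ) + 1) (fun p => -(((p : ℕ) : ℤ) + 1)), ?_, ?_⟩
  · rintro (p | p) (p' | p') h <;> simp only [Sum.elim_inl, Sum.elim_inr] at h
    · congr 1; ext; omega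
    · omega
    · omega
    · congr 1; ext; omega
  · rintro (p | p)
    · refine ⟨by simp only [limitNode, signedNode, Sum.elim_inl]; push_cast; ring, ?_⟩
      have := p.2
      simp only [Sum.elim_inl]
      rw [abs_le]; omega
    · refine ⟨by simp only [limitNode, signedNode, Sum.elim_inr]; push_cast; ring, ?_⟩
      have := p.2
      simp only [Sum.elim_inr]
      rw [abs_le]; omega

theorem abs_limitNode_lt (κ₀ : ℕ) : ∃ ρ, 0 ≤ ρ ∧ ρ < 1 ∧ ∀ j, |limitNode κ₀ j| < ρ := by
  obtain ⟨n, -, hn⟩ := exists_int_limitNode κ₀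
  have hK := wellProduct_pos κ₀
  -- The limit nodes are `± p π / K` with `p ≤ κ₀`, and `K = (κ₀ + 1/4) π`; the value `1/8` leaves
  -- room on both sides.
  refine ⟨(κ₀ + 1 / 8) * (π / wellProduct κ₀), by positivity, ?_, fun j => ?_⟩
  · rw [← mul_div_assoc, div_lt_one hK]
    unfold wellProduct
    nlinarith [pi_pos]
  · obtain ⟨h1, h2⟩ := hn j
    have h2' : |(n j : ℝ)| ≤ κ₀ := by exact_mod_cast h2
    have hq : 0 < π / wellProduct κ₀ := by positivity
    rw [h1, abs_mul, abs_of_pos hq]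
    exact mul_lt_mul_of_pos_right (by linarith) hq

theorem le_abs_limitNode_sub (κ₀ : ℕ) {j j' : Fin κ₀ ⊕ Fin κ₀} (h : j ≠ j') :
    π / wellProduct κ₀ ≤ |limitNode κ₀ j - limitNode κ₀ j'| := by
  obtain ⟨n, hinj, hn⟩ := exists_int_limitNode κ₀
  have hq : 0 < π / wellProduct κ₀ := div_pos pi_pos (wellProduct_pos κ₀)
  rw [(hn j).1, (hn j').1, ← sub_mul, abs_mul, abs_of_pos hq]
  refine le_mul_of_one_le_left hq.le ?_
  have : 1 ≤ |n j - n j'| := Int.one_le_abs (sub_ne_zero.2 fun e => h (hinj e))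
  exact_mod_cast this

theorem tendsto_signedNode {κ₀ : ℕ} {E₁ E₂ : ℝ} (hE₁ : wellProduct κ₀ < E₁)
    {yp : ℕ → ℝ → Fin κ₀ → ℝ}
    (hyp : ∀ p : Fin κ₀, TendstoUniformlyOn (fun m E => yp m E p)
      (fun E => (((p : ℕ) : ℝ) + 1) * π / E) atTop (Icc E₁ E₂)) (j : Fin κ₀ ⊕ Fin κ₀) :
    Tendsto (fun i : ℕ × ℝ => signedNode (fun p => yp i.1 i.2 p / halfWidth κ₀ i.2) j)
      (atTop ×ˢ 𝓟 (Icc E₁ E₂)) (𝓝 (limitNode κ₀ j)) := by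
  have hK := wellProduct_pos κ₀
  have main : ∀ p : Fin κ₀, Tendsto (fun i : ℕ × ℝ => yp i.1 i.2 p / halfWidth κ₀ i.2)
      (atTop ×ˢ 𝓟 (Icc E₁ E₂)) (𝓝 ((((p : ℕ) : ℝ) + 1) * π / wellProduct κ₀)) := by
    intro p
    rw [Metric.tendsto_nhds]
    intro ε hε
    rcases lt_or_ge E₂ E₁ with h12 | h12
    · simp [Icc_eq_empty (not_le.2 h12)]
    have hE₂ : 0 < E₂ := by linarith
    have hev := Metric.tendstoUniformlyOn_iff.1 (hyp p) (ε * wellProduct κ₀ / E₂) (by positivity)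
    rw [eventually_prod_principal_iff]
    filter_upwards [hev] with m hm E hE
    have hE0 : 0 < E := by linarith [hE.1]
    have h := hm E hE
    rw [dist_comm, Real.dist_eq] at h
    rw [Real.dist_eq]
    have e : yp m E p / halfWidth κ₀ E - (((p : ℕ) : ℝ) + 1) * π / wellProduct κ₀
        = (yp m E p - (((p : ℕ) : ℝ) + 1) * π / E) * (E / wellProduct κ₀) := by
      unfold halfWidth; field_simp
    change |yp m E p / halfWidth κ₀ E - _| < ε
    have hq : 0 < E / wellProduct κ₀ := by positivity
    rw [e, abs_mul, abs_of_pos hq]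
    calc _ < ε * wellProduct κ₀ / E₂ * (E / wellProduct κ₀) := mul_lt_mul_of_pos_right h hq
      _ = ε * (E / E₂) := by field_simp
      _ ≤ ε * 1 := by gcongr; exact (div_le_one hE₂).2 hE.2
      _ = ε := mul_one ε
  rcases j with p | p
  · exact main p
  · exact (main p).neg

/-- Convergence along `atTop ×ˢ 𝓟 (Icc E₁ E₂)` expresses uniformity in `E`. Compactness bounds `T`
away from `1` and from above, and limit nodes spaced by at least `π / K` give an eventual separation
of half that amount. -/
theorem tendsto_prueferEnd_potential {κ₀ : ℕ} {E₁ E₂ : ℝ} (hE₁ : wellProduct κ₀ < E₁) (S : ℕ)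
    {T : ℝ → ℝ} (hT : ContinuousOn T (Icc E₁ E₂)) (hT1 : ∀ E ∈ Icc E₁ E₂, 1 < T E)
    {yp : ℕ → ℝ → Fin κ₀ → ℝ}
    (hyp : ∀ p : Fin κ₀, TendstoUniformlyOn (fun m E => yp m E p)
      (fun E => (((p : ℕ) : ℝ) + 1) * π / E) atTop (Icc E₁ E₂)) :
    ∃ β : ℕ × ℝ → ℝ, Tendsto β (atTop ×ˢ 𝓟 (Icc E₁ E₂)) (𝓝 0) ∧
      ∀ᶠ i in atTop ×ˢ 𝓟 (Icc E₁ E₂), ∀ μ, |μ| ≤ i.2 ^ 2 →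
        |prueferEnd (step (halfWidth κ₀ i.2) (-i.2 ^ 2) 0) μ -
          prueferEnd (potential i.1 S (T i.2) (yp i.1 i.2) i.2) μ| ≤ β i := by
  have hK := wellProduct_pos κ₀
  set l : Filter (ℕ × ℝ) := atTop ×ˢ 𝓟 (Icc E₁ E₂) with hl
  rcases lt_or_ge E₂ E₁ with h12 | h12
  · exact ⟨fun _ => 0, tendsto_const_nhds, by simp [hl, Icc_eq_empty (not_le.2 h12)]⟩
  have hmem : ∀ᶠ i : ℕ × ℝ in l, i.2 ∈ Icc E₁ E₂ :=
    tendsto_snd.eventually (mem_principal_self (Icc E₁ E₂))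
  obtain ⟨Em, hEm, hmin⟩ := isCompact_Icc.exists_isMinOn (nonempty_Icc.2 h12) hT
  obtain ⟨EM, hEM, hmax⟩ := isCompact_Icc.exists_isMaxOn (nonempty_Icc.2 h12) hT
  obtain ⟨ρ, hρ0, hρ1, hρ⟩ := abs_limitNode_lt κ₀
  have hnode := tendsto_signedNode hE₁ hyp
  have hq : 0 < π / wellProduct κ₀ := div_pos pi_pos hK
  obtain ⟨b, hb, hbd⟩ := exists_bound_corrector (l := l) (m := fun i => i.1) (T := fun i => T i.2)
    (z := fun i p => yp i.1 i.2 p / halfWidth κ₀ i.2) S tendsto_fst (hT1 Em hEm)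
    (hmem.mono fun i hi => hmin hi)
    (T₁ := T EM) (hmem.mono fun i hi => by
      rw [abs_of_pos (by linarith [hT1 i.2 hi])]; exact hmax hi) hρ0 hρ1
    (fun j => ((hnode j).abs.eventually_lt_const (hρ j)).mono fun i hi => hi.le)
    (half_pos hq)
    (fun j j' hjj => (((hnode j).sub (hnode j')).abs.eventually_const_lt
      ((half_lt_self hq).trans_le (le_abs_limitNode_sub κ₀ hjj))).mono fun i hi => hi.le)
    (E₂ / wellProduct κ₀)
  have hR : 0 ≤ E₂ / wellProduct κ₀ := div_nonneg (by linarith) hK.le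
  -- The Lipschitz factor `exp (1 + E² + |μ|)` is bounded using `|μ| ≤ E² ≤ E₂²`.
  refine ⟨fun i => exp (1 + E₂ ^ 2 + E₂ ^ 2) *
    (E₂ ^ 2 * ((∫ z in (0 : ℝ)..(E₂ / wellProduct κ₀), contrast z ^ i.1) + b i)), ?_, ?_⟩
  · have h1 := (tendsto_integral_contrast_pow hR).comp (tendsto_fst (f := atTop)
      (g := 𝓟 (Icc E₁ E₂)))
    simpa using ((h1.add hb).const_mul (E₂ ^ 2)).const_mul (exp (1 + E₂ ^ 2 + E₂ ^ 2))
  · filter_upwards [hmem, hbd] with i hi hbi μ hμ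
    have hEi : wellProduct κ₀ < i.2 := hE₁.trans_le hi.1
    have hE0 : 0 < i.2 := hK.trans hEi
    have hinv : (halfWidth κ₀ i.2)⁻¹ = i.2 / wellProduct κ₀ := by unfold halfWidth; rw [inv_div]
    have hle : (halfWidth κ₀ i.2)⁻¹ ≤ E₂ / wellProduct κ₀ := by rw [hinv]; gcongr; exact hi.2
    have hsq : i.2 ^ 2 ≤ E₂ ^ 2 := pow_le_pow_left₀ hE0.le hi.2 2
    refine (abs_prueferEnd_step_sub_le hEi (fun x hx => hbi x (hx.trans hle)) μ).trans ?_
    have hb0 : 0 ≤ b i := (abs_nonneg _).trans (hbi 0 (by simpa using hR))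
    have hcp : Continuous fun z => contrast z ^ i.1 := continuous_contrast.pow i.1
    have hJ0 : 0 ≤ ∫ z in (0 : ℝ)..(halfWidth κ₀ i.2)⁻¹, contrast z ^ i.1 :=
      intervalIntegral.integral_nonneg (by rw [hinv]; positivity)
        fun z _ => (pow_pos (contrast_pos z) _).le
    have hJ : (∫ z in (0 : ℝ)..(halfWidth κ₀ i.2)⁻¹, contrast z ^ i.1)
        ≤ ∫ z in (0 : ℝ)..(E₂ / wellProduct κ₀), contrast z ^ i.1 :=
      intervalIntegral.integral_mono_interval le_rfl (by rw [hinv]; positivity) hle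
        (Eventually.of_forall fun z => (pow_pos (contrast_pos z) _).le)
        (hcp.intervalIntegrable _ _)
    exact mul_le_mul (exp_le_exp.2 (by linarith)) (mul_le_mul hsq (by linarith) (by linarith)
      (sq_nonneg _)) (mul_nonneg (sq_nonneg _) (by linarith)) (exp_pos _).le

/-! ### The regularized frequencies -/

section Regularized

variable {κ₀ : ℕ} {E₁ E₂ : ℝ} {T : ℝ → ℝ} {yp : ℕ → ℝ → Fin κ₀ → ℝ}

theorem eventually_freq_spec (hE₁ : wellProduct κ₀ < E₁) (S : ℕ)
    (hT : ContinuousOn T (Icc E₁ E₂)) (hT1 : ∀ E ∈ Icc E₁ E₂, 1 < T E)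
    (hyp : ∀ p : Fin κ₀, TendstoUniformlyOn (fun m E => yp m E p)
      (fun E => (((p : ℕ) : ℝ) + 1) * π / E) atTop (Icc E₁ E₂)) :
    ∀ᶠ m in atTop, ∀ E ∈ Icc E₁ E₂, ∀ j : Fin κ₀,
      freq m S (T E) (yp m E) E j ∈ Ioo 0 E ∧
      prueferEnd (potential m S (T E) (yp m E) E) (-freq m S (T E) (yp m E) E j ^ 2)
        = ((j : ℕ) + 1) * π ∧
      IsNthSmallest (evenDirichletSpectrum (potential m S (T E) (yp m E) E)) j
        (-freq m S (T E) (yp m E) E j ^ 2) := by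
  obtain ⟨β, hβ, hle⟩ := tendsto_prueferEnd_potential hE₁ S hT hT1 hyp
  have hpi := pi_pos
  -- The square well has `Θ(-E²) ≤ π / 2` and `Θ(0) > E r = κ₀ π + π / 4`. An error below `π / 4`
  -- therefore keeps the bottom angle under `π` and the top angle above `κ₀ π`.
  have h := hle.and (hβ.eventually_lt_const (show (0 : ℝ) < π / 4 by positivity))
  rw [eventually_prod_principal_iff] at h
  filter_upwards [h] with m hm E hE j
  obtain ⟨h1, h2⟩ := hm E hE
  have hEK : wellProduct κ₀ < E := hE₁.trans_le hE.1
  have hE0 : 0 < E := (wellProduct_pos κ₀).trans hEK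
  have hr := halfWidth_mem_Ioo hEK
  have hb := abs_le.1 (h1 (-E ^ 2) (by rw [abs_neg, abs_of_nonneg (sq_nonneg E)]))
  have ht := abs_le.1 (h1 0 (by rw [abs_zero]; positivity))
  have hb' := prueferEnd_step_bottom_le hr E
  have ht' := mul_lt_prueferEnd_step hr hE0
  have hEr : E * halfWidth κ₀ E = κ₀ * π + π / 4 := by
    unfold halfWidth wellProduct; field_simp
  rw [hEr] at ht'
  exact wellFreq_spec (n := κ₀) (continuous_potential _ _ _ _ _) (potential_neg _ _ _ _ _) hE0
    (by linarith [hb.1]) (by linarith [ht.2]) j.2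

/-- Since the end angles are increasing in `μ`, comparing a frequency with `x` amounts to comparing
the angle at `-x²` with `(j + 1) π`. That strict comparison holds for the square well and passes to
large `m`. -/
theorem tendsto_freq (hE₁ : wellProduct κ₀ < E₁) (S : ℕ)
    (hT : ContinuousOn T (Icc E₁ E₂)) (hT1 : ∀ E ∈ Icc E₁ E₂, 1 < T E)
    (hyp : ∀ p : Fin κ₀, TendstoUniformlyOn (fun m E => yp m E p)
      (fun E => (((p : ℕ) : ℝ) + 1) * π / E) atTop (Icc E₁ E₂)) {E : ℝ} (hE : E ∈ Icc E₁ E₂)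
    (j : Fin κ₀) :
    Tendsto (fun m => freq m S (T E) (yp m E) E j) atTop (𝓝 (limitFreq κ₀ E j)) := by
  have hspec := eventually_freq_spec hE₁ S hT hT1 hyp
  obtain ⟨β, hβ, hle⟩ := tendsto_prueferEnd_potential hE₁ S hT hT1 hyp
  have hEK : wellProduct κ₀ < E := hE₁.trans_le hE.1
  have hE0 : 0 < E := (wellProduct_pos κ₀).trans hEK
  have hadm := isAdmissible_step (halfWidth_mem_Ioo hEK) (-E ^ 2) 0
  have hlim := isNthLargest_limitFreq hEK j
  have hΘ := prueferEnd_eq_of_isNthLargest hEK hlim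
  have hmemlim := hlim.1.1
  set lam := limitFreq κ₀ E j
  have hconv : ∀ μ, |μ| ≤ E ^ 2 → Tendsto
      (fun m => prueferEnd (potential m S (T E) (yp m E) E) μ) atTop
      (𝓝 (prueferEnd (step (halfWidth κ₀ E) (-E ^ 2) 0) μ)) := by
    intro μ hμ
    have hpair : Tendsto (fun m : ℕ => (m, E)) atTop (atTop ×ˢ 𝓟 (Icc E₁ E₂)) :=
      tendsto_id.prodMk (tendsto_principal.2 (Eventually.of_forall fun _ => hE))
    rw [tendsto_iff_dist_tendsto_zero]
    refine squeeze_zero' (Eventually.of_forall fun _ => dist_nonneg) ?_ (hβ.comp hpair)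
    filter_upwards [hpair.eventually hle] with m hm
    rw [dist_comm, Real.dist_eq]
    exact hm μ hμ
  have habs : ∀ x, 0 < x → x < E → |(-x ^ 2)| ≤ E ^ 2 := fun x h0 h1 => by
    rw [abs_neg, abs_of_nonneg (sq_nonneg x)]; exact pow_le_pow_left₀ h0.le h1.le 2
  rw [tendsto_order]
  constructor
  · intro x hx
    rcases le_or_gt x 0 with h0 | h0
    · filter_upwards [hspec] with m hm using h0.trans_lt (hm E hE j).1.1
    · have hlt : (((j : ℕ) : ℝ) + 1) * π < prueferEnd (step (halfWidth κ₀ E) (-E ^ 2) 0) (-x ^ 2) := by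
        rw [← hΘ]; exact hadm.strictMono (by nlinarith)
      filter_upwards [hspec, (hconv _ (habs x h0 (hx.trans hmemlim.2))).eventually_const_lt hlt]
        with m hm hm'
      obtain ⟨h1, h2, -⟩ := hm E hE j
      rw [← h2] at hm'
      have := (isAdmissible_of_continuous (continuous_potential m S (T E) (yp m E) E)).strictMono.lt_iff_lt.1 hm'
      exact lt_of_pow_lt_pow_left₀ 2 h1.1.le (by linarith)
  · intro x hx
    rcases le_or_gt E x with h0 | h0
    · filter_upwards [hspec] with m hm using (hm E hE j).1.2.trans_le h0
    · have hx0 : 0 < x := hmemlim.1.trans hx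
      have hlt : prueferEnd (step (halfWidth κ₀ E) (-E ^ 2) 0) (-x ^ 2) < (((j : ℕ) : ℝ) + 1) * π := by
        rw [← hΘ]; exact hadm.strictMono (by nlinarith [hmemlim.1])
      filter_upwards [hspec, (hconv _ (habs x hx0 h0)).eventually_lt_const hlt] with m hm hm'
      obtain ⟨h1, h2, -⟩ := hm E hE j
      rw [← h2] at hm'
      have := (isAdmissible_of_continuous (continuous_potential m S (T E) (yp m E) E)).strictMono.lt_iff_lt.1 hm'
      exact lt_of_pow_lt_pow_left₀ 2 hx0.le (by linarith)

end Regularized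

end ShearFreq

end

/-! ### Assembly of the main theorem -/

theorem theorem5p5 (κ₀ : ℕ) (hκ₀ : 1 ≤ κ₀) :
    -- asymptotic expansion of the limit frequencies
    (∃ (α₀ : Fin κ₀ → ℝ) (α₂ : ℝ → ℝ), ∀ j : Fin κ₀,
      α₀ j ∈ Set.Ioo (0 : ℝ) (1 / 2) ∧
      Real.sin (Real.pi * α₀ j) = (((j : ℕ) : ℝ) + 1 - 1 / 2 - α₀ j) / ((κ₀ : ℝ) + 1 / 4) ∧
      α₂ (α₀ j) ≠ 0 ∧
      ∃ ρ : ℝ → ℝ,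
        Asymptotics.IsLittleO Filter.atTop ρ (fun E =>
          Real.exp ((((κ₀ : ℝ) + 1 / 4) * Real.pi - E) * Real.cos (Real.pi * α₀ j)) ^ 3) ∧
        ∀ᶠ E in Filter.atTop,
          ShearFreq.limitFreq κ₀ E j =
            E * Real.cos (Real.pi * (α₀ j + α₂ (α₀ j) *
              Real.exp ((((κ₀ : ℝ) + 1 / 4) * Real.pi - E) * Real.cos (Real.pi * α₀ j)) ^ 2 +
              ρ E))) ∧
    ∃ Estar : ℝ, ((κ₀ : ℝ) + 1 / 4) * Real.pi < Estar ∧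
      -- the limit frequencies are well defined
      (∀ E : ℝ, Estar ≤ E → ∀ j : Fin κ₀,
        ShearFreq.IsNthLargest (ShearFreq.secularRoots κ₀ E) j (ShearFreq.limitFreq κ₀ E j)) ∧
      ∀ E₁ E₂ : ℝ, Estar ≤ E₁ → E₁ < E₂ →
        -- non-degeneracy of the limit frequency vector
        ShearFreq.NonDegenerateOn (ShearFreq.limitFreq κ₀) E₁ E₂ ∧
        -- non-degeneracy of the frequency vector of the regularized operator
        ∀ (S : ℕ) (T : ℝ → ℝ) (yp : ℕ → ℝ → Fin κ₀ → ℝ),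
          ContinuousOn T (Set.Icc E₁ E₂) → (∀ E ∈ Set.Icc E₁ E₂, 1 < T E) →
          (∀ m : ℕ, ∀ E ∈ Set.Icc E₁ E₂, ∀ p : Fin κ₀,
            yp m E p ∈ Set.Ioo 0 (ShearFreq.halfWidth κ₀ E)) →
          (∀ p : Fin κ₀, TendstoUniformlyOn (fun m E => yp m E p)
            (fun E => (((p : ℕ) : ℝ) + 1) * Real.pi / E) Filter.atTop (Set.Icc E₁ E₂)) →
          ∃ mbar : ℕ, ∀ m : ℕ, mbar ≤ m →
            (∀ E ∈ Set.Icc E₁ E₂, ∀ j : Fin κ₀,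
              ShearFreq.freq m S (T E) (yp m E) E j ∈ Set.Ioo 0 E ∧
              ShearFreq.IsNthSmallest
                (ShearFreq.evenDirichletSpectrum (ShearFreq.potential m S (T E) (yp m E) E)) j
                (-ShearFreq.freq m S (T E) (yp m E) E j ^ 2)) ∧
            ShearFreq.NonDegenerateOn
              (fun E => ShearFreq.freq m S (T E) (yp m E) E) E₁ E₂ := by
  have hK : ((κ₀ : ℝ) + 1 / 4) * Real.pi = ShearFreq.wellProduct κ₀ := rfl
  -- Every threshold above `K` would serve: the analyticity of the roots holds for all `E > K`.
  refine ⟨ShearFreq.limitFreq_asymptotics κ₀, ShearFreq.wellProduct κ₀ + 1, by rw [hK]; linarith,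
    fun E hE j => ShearFreq.isNthLargest_limitFreq (by linarith) j, fun E₁ E₂ hE₁ h12 => ?_⟩
  have hE₁' : ShearFreq.wellProduct κ₀ < E₁ := by linarith
  have hlim := ShearFreq.nonDegenerateOn_limitFreq hE₁' h12
  refine ⟨hlim, fun S T yp hT hT1 _ hyp => ?_⟩
  have hspec := ShearFreq.eventually_freq_spec hE₁' S hT hT1 hyp
  have hnd := hlim.eventually_of_tendsto fun E hE j =>
    ShearFreq.tendsto_freq hE₁' S hT hT1 hyp hE j
  obtain ⟨mbar, hm⟩ := Filter.eventually_atTop.1 (hspec.and hnd)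
  exact ⟨mbar, fun m hmm => ⟨fun E hE j =>
    ⟨((hm m hmm).1 E hE j).1, ((hm m hmm).1 E hE j).2.2⟩, (hm m hmm).2⟩⟩
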